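/- Let $n\ge 1$ and let $\Gamma_+=\{k\in\mathbb R^n : k_i>0 \text{ for all } i\}$. Let $\Gamma\subset\mathbb R^n$ be an open set, invariant under permutations of the coordinates, with $\Gamma_+\subset\Gamma$. A function $W\in C^\infty(\Gamma)$ is called a Weingarten function on $\Gamma$ if it is - symmetric under permutations of the coordinates; - homogeneous of some real degree $\alpha$, i.e. $W(ck)=c^\alpha W(k)$ whenever $c>0$ and $k,ck\in\Gamma$; - monotonically increasing (not necessarily strictly) in its variables, i.e. $W(k)\le W(k')$ whenever $k,k'\in\Gamma$ and $k_i\le k_i'$ for all $i$; - positive on $\Gamma_+$. It is called odd if it extends to a Weingarten function on $\Gamma\cup(-\Gamma)$ satisfying $W(-k)=-W(k)$. Let $W$ be an odd Weingarten function on $\Gamma$. Let $\overline M^{\,n+1}$ be a complete connected smooth Riemannian manifold, let $M^n$ be a compact connected smooth manifold (without boundary), and let $0<T\le+\infty$. Let $F:M\times[0,T)\to\overline M$ be a $W$-flow: $F$ is smooth, each $F_t=F(\cdot,t)$ is an immersion, and there is a smooth field $N(p,t)\in T_{F(p,t)}\overline M$ such that $N(\cdot,t)$ is a unit normal field of $F_t$,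 the principal curvatures $(k_1(p,t),\dots,k_n(p,t))$ of $F_t$ at $p$ with respect to $N(p,t)$ (the eigenvalues of $\langle\overline\nabla_u\, dF_t(v),N\rangle$ relative to the induced metric, where $\overline\nabla$ is the Levi-Civita connection of $\overline M$) lie in $\Gamma$, and $$\frac{\partial F}{\partial t}(p,t)=W\big(k_1(p,t),\dots,k_n(p,t)\big)\,N(p,t)\qquad\text{for all }(p,t)\in M\times[0,T).$$ If $F_0$ is an embedding, then $F_t$ is an embedding for every $t\in[0,T)$. -/

import Mathlib

open Set Topology Manifold Bundle
open scoped ContDiff Pointwise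

/-! ### Weingarten functions -/

/-- `W` (of which only the values on `Γ` matter) is a Weingarten function on the open set
`Γ ⊆ ℝⁿ`. Monotonicity in all the variables refers to the coordinatewise order of `ℝⁿ` and is
not required to be strict. -/
structure IsWeingartenFunction {n : ℕ} (Γ : Set (Fin n → ℝ)) (W : (Fin n → ℝ) → ℝ) : Prop where
  isOpen : IsOpen Γ
  posCone_subset : {k : Fin n → ℝ | ∀ i, 0 < k i} ⊆ Γ
  smooth : ContDiffOn ℝ ∞ W Γ
  perm_mem : ∀ (σ : Equiv.Perm (Fin n)), ∀ k ∈ Γ, (k ∘ σ) ∈ Γ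
  symmetric : ∀ (σ : Equiv.Perm (Fin n)), ∀ k ∈ Γ, W (k ∘ σ) = W k
  homogeneous : ∃ α : ℝ, ∀ c : ℝ, 0 < c → ∀ k ∈ Γ, c • k ∈ Γ → W (c • k) = c ^ α * W k
  monotone : MonotoneOn W Γ
  pos : ∀ k : Fin n → ℝ, (∀ i, 0 < k i) → 0 < W k

/-- A Weingarten function on `Γ` is odd if it extends to a Weingarten function `W'` on
`Γ ∪ (-Γ)` with `W' (-k) = - W' k`. -/
def IsOddWeingartenFunction {n : ℕ} (Γ : Set (Fin n → ℝ)) (W : (Fin n → ℝ) → ℝ) : Prop :=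
  IsWeingartenFunction Γ W ∧
    ∃ W' : (Fin n → ℝ) → ℝ, IsWeingartenFunction (Γ ∪ -Γ) W' ∧ EqOn W' W Γ ∧
      ∀ k ∈ Γ ∪ -Γ, W' (-k) = - W' k

noncomputable section

/-! ### The second fundamental form of a hypersurface, computed in charts -/

section Geometry

variable {n m : ℕ}
  {M : Type*} [TopologicalSpace M] [ChartedSpace (EuclideanSpace ℝ (Fin n)) M]
  {N : Type*} [TopologicalSpace N] [ChartedSpace (EuclideanSpace ℝ (Fin m)) N]
  [RiemannianBundle (fun q : N => TangentSpace (𝓡 m) q)]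

/-- The coefficients `g_y(a, b)` of the Riemannian metric of `N`, read at the point `y` of the
target of the chart around `q`. -/
def metricInChart (q : N) (y a b : EuclideanSpace ℝ (Fin m)) : ℝ :=
  inner ℝ
    (mfderiv 𝓘(ℝ, EuclideanSpace ℝ (Fin m)) (𝓡 m) (extChartAt (𝓡 m) q).symm y a :
      TangentSpace (𝓡 m) ((extChartAt (𝓡 m) q).symm y))
    (mfderiv 𝓘(ℝ, EuclideanSpace ℝ (Fin m)) (𝓡 m) (extChartAt (𝓡 m) q).symm y b :
      TangentSpace (𝓡 m) ((extChartAt (𝓡 m) q).symm y))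

/-- The Christoffel symbols of the first kind `⟨∇_a b, c⟩` of the Levi-Civita connection of `N`,
in the chart around `q`, for constant coordinate fields `a, b, c`. -/
def christoffelInChart (q : N) (y a b c : EuclideanSpace ℝ (Fin m)) : ℝ :=
  (fderiv ℝ (fun z => metricInChart q z b c) y a
    + fderiv ℝ (fun z => metricInChart q z a c) y b
    - fderiv ℝ (fun z => metricInChart q z a b) y c) / 2

/-- The second fundamental form `⟨∇_u (df v), ν⟩` of `f : M → N` at `p`, for vectors `u, v, ν`
given by their components in the charts around `p` and `f p`. It equals
`⟨D²f(u, v), ν⟩ + ⟨∇_{df u} df v, ν⟩`, where `f` is read in the charts and the last term is the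
Christoffel symbol of the first kind. -/
def secondFundamentalFormInChart (f : M → N) (p : M) (ν : EuclideanSpace ℝ (Fin m))
    (u v : EuclideanSpace ℝ (Fin n)) : ℝ :=
  let fc : EuclideanSpace ℝ (Fin n) → EuclideanSpace ℝ (Fin m) :=
    writtenInExtChartAt (𝓡 n) (𝓡 m) p f
  let x : EuclideanSpace ℝ (Fin n) := extChartAt (𝓡 n) p p
  let y : EuclideanSpace ℝ (Fin m) := extChartAt (𝓡 m) (f p) (f p)
  metricInChart (f p) y (fderiv ℝ (fderiv ℝ fc) x u v) ν
    + christoffelInChart (f p) y (fderiv ℝ fc x u) (fderiv ℝ fc x v) ν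

/-- The scalar second fundamental form `⟨∇_u (df v), ν⟩` at `p` of a map `f : M → N` in the
direction of the vector `ν ∈ T_{f p} N`, where `∇` is the Levi-Civita connection of `N`. With this
sign a round sphere in Euclidean space has positive principal curvatures with respect to the
inward normal. -/
def secondFundamentalForm (f : M → N) (p : M) (ν : TangentSpace (𝓡 m) (f p))
    (u v : TangentSpace (𝓡 n) p) : ℝ :=
  secondFundamentalFormInChart f p
    (mfderiv (𝓡 m) 𝓘(ℝ, EuclideanSpace ℝ (Fin m)) (extChartAt (𝓡 m) (f p)) (f p) ν)
    (mfderiv (𝓡 n) 𝓘(ℝ, EuclideanSpace ℝ (Fin n)) (extChartAt (𝓡 n) p) p u)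
    (mfderiv (𝓡 n) 𝓘(ℝ, EuclideanSpace ℝ (Fin n)) (extChartAt (𝓡 n) p) p v)

/-- `ν` is a unit normal vector of `f` at `p`. -/
def IsUnitNormalAt (f : M → N) (p : M) (ν : TangentSpace (𝓡 m) (f p)) : Prop :=
  inner ℝ ν ν = (1 : ℝ) ∧
    ∀ v : TangentSpace (𝓡 n) p, inner ℝ (mfderiv (𝓡 n) (𝓡 m) f p v) ν = (0 : ℝ)

/-- `k = (k₁, …, kₙ)` lists (with multiplicities, in some order) the principal curvatures of `f`
at `p` with respect to the unit normal `ν`: the eigenvalues of the second fundamental form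
relative to the first fundamental form, i.e. there is a basis of `T_p M`, orthonormal for the
metric induced by `f`, in which the second fundamental form is the diagonal matrix of `k`. -/
def IsPrincipalCurvatures (f : M → N) (p : M) (ν : TangentSpace (𝓡 m) (f p))
    (k : Fin n → ℝ) : Prop :=
  ∃ e : Module.Basis (Fin n) ℝ (TangentSpace (𝓡 n) p),
    (∀ i j, inner ℝ (mfderiv (𝓡 n) (𝓡 m) f p (e i)) (mfderiv (𝓡 n) (𝓡 m) f p (e j))
      = if i = j then (1 : ℝ) else 0) ∧
    ∀ i j, secondFundamentalForm f p ν (e i) (e j) = if i = j then k i else 0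

end Geometry

/-! ### Weingarten flows -/

/-- The time interval `[0, T)`, where `T ≤ +∞`. -/
def timeInterval (T : EReal) : Set ℝ := {t : ℝ | 0 ≤ t ∧ (t : EReal) < T}

section Flow

variable {n : ℕ}
  {M : Type*} [TopologicalSpace M] [ChartedSpace (EuclideanSpace ℝ (Fin n)) M]
  {N : Type*} [TopologicalSpace N] [ChartedSpace (EuclideanSpace ℝ (Fin (n + 1))) N]
  [IsManifold (𝓡 (n + 1)) ∞ N]
  [RiemannianBundle (fun q : N => TangentSpace (𝓡 (n + 1)) q)]

/-- `F : M × [0, T) → N` (written `F t p`) is a `W`-flow: a smooth one-parameter family of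
immersions of hypersurfaces, oriented by a smooth family `ν` of unit normals, whose principal
curvatures lie in `Γ` and which solve `∂F/∂t = W(k₁, …, kₙ) ν`. -/
structure IsWeingartenFlow (Γ : Set (Fin n → ℝ)) (W : (Fin n → ℝ) → ℝ) (T : EReal)
    (F : ℝ → M → N) : Prop where
  smooth : ContMDiffOn ((𝓡 n).prod 𝓘(ℝ, ℝ)) (𝓡 (n + 1)) ∞
    (fun x : M × ℝ => F x.2 x.1) (univ ×ˢ timeInterval T)
  immersion : ∀ t ∈ timeInterval T, IsImmersion (𝓡 n) (𝓡 (n + 1)) ∞ (F t)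
  evolution : ∃ ν : ∀ (t : ℝ) (p : M), TangentSpace (𝓡 (n + 1)) (F t p),
    ContMDiffOn ((𝓡 n).prod 𝓘(ℝ, ℝ)) (𝓡 (n + 1)).tangent ∞
      (fun x : M × ℝ => (⟨F x.2 x.1, ν x.2 x.1⟩ : TangentBundle (𝓡 (n + 1)) N))
      (univ ×ˢ timeInterval T) ∧
    ∀ t ∈ timeInterval T, ∀ p : M,
      IsUnitNormalAt (n := n) (F t) p (ν t p) ∧
      ∃ k ∈ Γ, IsPrincipalCurvatures (F t) p (ν t p) k ∧
        mfderivWithin 𝓘(ℝ, ℝ) (𝓡 (n + 1)) (fun s : ℝ => F s p) (timeInterval T) t (1 : ℝ)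
          = W k • ν t p

end Flow

end

/-! An immersion of a compact manifold fails to be an embedding only through a double point F_t(p) =
F_t(q) with p ≠ q. Immersions are locally injective, uniformly in nearby times, so near a given time
all double points lie in a compact set Z of pairs disjoint from the diagonal
(`exists_isCompact_doublePoints`). Hence injectivity persists for a short time, and the point is to
exclude a first time t₀ > 0 at which it is lost (`IsWeingartenFlow.injective_of_forall_lt`).

Let e be a smooth map into a Euclidean space that is injective and immersive on the compact region
swept out up to t₀. The function h = ‖e(F_t p) - e(F_t q)‖² is smooth and positive on Z before t₀.
If ∂h/∂t ≥ -C h at minimizing pairs close to a contact, then the minimum of h decays at most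
exponentially and cannot vanish at t₀ (`IsCompact.ne_zero_of_deriv_ge`).

To obtain this inequality, put v = e(F_t p) - e(F_t q) at a minimizing pair. By the first order
condition v is orthogonal to the images of both tangent spaces, so the two normals almost agree up
to sign. Let l₁, l₂ be the inner products of v with the images of the normals; for normals pointing
from the second sheet to the first they are positive, comparable to ‖v‖, and differ by O(‖v‖²)
(`IsMinimalPair.normals_close`). The second order condition, tested on tangent vectors matched by
orthogonal projection, compares the second fundamental forms
(`IsMinimalPair.secondForm_comparison`). A Courant–Fischer argument along the matching map then
orders the sorted principal curvatures: k₂ - O(‖v‖) ≤ k₁ (`IsMinimalPair.eigenvalue_comparison`).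
Since W is monotone and locally Lipschitz, ∂h/∂t = 2 (W(k₁) l₁ - W(k₂) l₂) ≥ -C ‖v‖². All errors are
proportional to h, so weak monotonicity suffices and no strong maximum principle is needed.

Oddness enters through W(-k)(-ν) = W(k) ν: a normal can be reversed without changing the velocity,
so both normals may be assumed to point from the second sheet to the first, whatever the given
orientation at the contact. -/

/-! ### Simultaneous diagonalization and comparison of eigenvalues -/

section Eigenvalues

variable {n : ℕ} {H : Type*} [NormedAddCommGroup H] [NormedSpace ℝ H]

/-- `k` lists the eigenvalues of the bilinear form `B` relative to the inner product `g`. -/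
def IsEigenvalueList (g B : H →L[ℝ] H →L[ℝ] ℝ) (k : Fin n → ℝ) : Prop :=
  ∃ e : Module.Basis (Fin n) ℝ H, (∀ i j, g (e i) (e j) = if i = j then (1 : ℝ) else 0) ∧
    ∀ i j, B (e i) (e j) = if i = j then k i else 0

theorem IsEigenvalueList.comp_perm {g B : H →L[ℝ] H →L[ℝ] ℝ} {k : Fin n → ℝ}
    (h : IsEigenvalueList g B k) (σ : Equiv.Perm (Fin n)) : IsEigenvalueList g B (k ∘ σ) := by
  obtain ⟨e, h1, h2⟩ := h
  refine ⟨e.reindex σ.symm, fun i j => ?_, fun i j => ?_⟩ <;> simp [h1, h2]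

theorem IsEigenvalueList.neg {g B : H →L[ℝ] H →L[ℝ] ℝ} {k : Fin n → ℝ}
    (h : IsEigenvalueList g B k) : IsEigenvalueList g (-B) (-k) := by
  obtain ⟨e, h1, h2⟩ := h
  refine ⟨e, h1, fun i j => ?_⟩
  by_cases hij : i = j <;> simp [h2, hij]

theorem Module.Basis.bilin_apply_self_of_diagonal (e : Module.Basis (Fin n) ℝ H)
    {B : H →L[ℝ] H →L[ℝ] ℝ} {k : Fin n → ℝ}
    (h : ∀ i j, B (e i) (e j) = if i = j then k i else 0) (a : H) :
    B a a = ∑ i, k i * e.repr a i ^ 2 := by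
  conv_lhs => rw [← e.sum_repr a]
  simp only [map_sum, map_smul, sum_apply, _root_.smul_apply, h,
    smul_eq_mul, mul_ite, mul_zero, Finset.sum_ite_eq', Finset.mem_univ, if_true]
  exact Finset.sum_congr rfl fun i _ => by ring

/-- For forms `B₁`, `B₂` with ordered eigenvalues and any linear map `L`, a vector that realizes
both sides of the Courant–Fischer principle. -/
theorem IsEigenvalueList.exists_rayleigh {g₁ B₁ g₂ B₂ : H →L[ℝ] H →L[ℝ] ℝ} {k₁ k₂ : Fin n → ℝ}
    (h₁ : IsEigenvalueList g₁ B₁ k₁) (h₂ : IsEigenvalueList g₂ B₂ k₂) (hk₁ : Monotone k₁)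
    (hk₂ : Monotone k₂) (L : H →ₗ[ℝ] H) (j : Fin n) :
    ∃ a, a ≠ 0 ∧ B₁ a a ≤ k₁ j * g₁ a a ∧ k₂ j * g₂ (L a) (L a) ≤ B₂ (L a) (L a) := by
  obtain ⟨e₁, hg₁, hB₁⟩ := h₁
  obtain ⟨e₂, hg₂, hB₂⟩ := h₂
  -- The kernel of `T` is cut out by n - 1 conditions: the `e₂`-coordinates of `L a` below j and the
  -- `e₁`-coordinates of `a` above j vanish. `L` need not be injective; if `L a = 0`, the second
  -- inequality is trivial.
  let T : H →ₗ[ℝ] ({i : Fin n // i ≠ j} → ℝ) := LinearMap.pi fun i =>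
    if (i : Fin n) < j then (e₂.coord i).comp L else e₁.coord i
  have : FiniteDimensional ℝ H := e₁.finiteDimensional_of_finite
  have hT : T.ker ≠ ⊥ := by
    apply LinearMap.ker_ne_bot_of_finrank_lt
    rw [Module.finrank_eq_card_basis e₁]
    simp only [Module.finrank_fintype_fun_eq_card, Fintype.card_subtype_compl,
      Fintype.card_fin, Fintype.card_unique]
    have := j.pos
    omega
  obtain ⟨a, haT, ha⟩ := (Submodule.ne_bot_iff _).1 hT
  have hlt : ∀ i, i < j → e₂.repr (L a) i = 0 := fun i hi => by
    have := congrFun (LinearMap.mem_ker.1 haT) ⟨i, hi.ne⟩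
    simpa [T, hi] using this
  have hgt : ∀ i, j < i → e₁.repr a i = 0 := fun i hi => by
    have := congrFun (LinearMap.mem_ker.1 haT) ⟨i, hi.ne'⟩
    simpa [T, hi.le.not_gt] using this
  refine ⟨a, ha, ?_, ?_⟩
  · rw [e₁.bilin_apply_self_of_diagonal hB₁,
      e₁.bilin_apply_self_of_diagonal (k := fun _ => 1) hg₁, Finset.mul_sum]
    refine Finset.sum_le_sum fun i _ => ?_
    rcases le_or_gt i j with hij | hij
    · rw [one_mul]; exact mul_le_mul_of_nonneg_right (hk₁ hij) (sq_nonneg _)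
    · simp [hgt i hij]
  · rw [e₂.bilin_apply_self_of_diagonal hB₂,
      e₂.bilin_apply_self_of_diagonal (k := fun _ => 1) hg₂, Finset.mul_sum]
    refine Finset.sum_le_sum fun i _ => ?_
    rcases le_or_gt j i with hij | hij
    · rw [one_mul]; exact mul_le_mul_of_nonneg_right (hk₂ hij) (sq_nonneg _)
    · simp [hlt i hij]

theorem IsEigenvalueList.apply_self_pos {g B : H →L[ℝ] H →L[ℝ] ℝ} {k : Fin n → ℝ}
    (h : IsEigenvalueList g B k) {a : H} (ha : a ≠ 0) : 0 < g a a := by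
  obtain ⟨e, hg, -⟩ := h
  rw [e.bilin_apply_self_of_diagonal (k := fun _ => 1) hg]
  have : e.repr a ≠ 0 := by simpa using ha
  obtain ⟨i, hi⟩ := Finsupp.ne_iff.1 this
  exact Finset.sum_pos' (fun i _ => by positivity)
    ⟨i, Finset.mem_univ _, by have : e.repr a i ≠ 0 := hi; positivity⟩

/-- Ordered eigenvalues depend continuously on the pair of forms. -/
theorem IsEigenvalueList.abs_sub_le {g₁ B₁ g₂ B₂ : H →L[ℝ] H →L[ℝ] ℝ} {k₁ k₂ : Fin n → ℝ}
    (h₁ : IsEigenvalueList g₁ B₁ k₁) (h₂ : IsEigenvalueList g₂ B₂ k₂) (hk₁ : Monotone k₁)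
    (hk₂ : Monotone k₂) {η : ℝ} (hη : η ≤ 1 / 2)
    (hg : ∀ a, |g₁ a a - g₂ a a| ≤ η * g₂ a a) (hB : ∀ a, |B₁ a a - B₂ a a| ≤ η * g₂ a a)
    (j : Fin n) : |k₁ j - k₂ j| ≤ 2 * (1 + |k₂ j|) * η := by
  -- Since η ≤ 1/2, the two norms satisfy A₂ ≤ 2 A₁; this is the source of the factor 2.
  have key : ∀ x y A₁ A₂ b₁ b₂ : ℝ, 0 < A₂ → |A₁ - A₂| ≤ η * A₂ → |b₁ - b₂| ≤ η * A₂ →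
      |x - y| ≤ (1 + |y|) * η * A₂ / A₁ → 0 < A₁ → |x - y| ≤ 2 * (1 + |y|) * η := by
    intro x y A₁ A₂ b₁ b₂ hA₂ hA _ hxy hA₁
    have hη0 : 0 ≤ η := by
      by_contra hneg
      have := (abs_nonneg _).trans hA
      nlinarith
    refine hxy.trans ?_
    rw [div_le_iff₀ hA₁]
    have h3 := (abs_le.1 hA).1
    have : A₂ ≤ 2 * A₁ := by nlinarith
    have h4 : 0 ≤ (1 + |y|) * η := by positivity
    nlinarith
  have aux : ∀ y A₁ A₂ : ℝ, |A₁ - A₂| ≤ η * A₂ → |y * (A₁ - A₂)| ≤ |y| * (η * A₂) := by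
    intro y A₁ A₂ h
    rw [abs_mul]
    exact mul_le_mul_of_nonneg_left h (abs_nonneg _)
  rw [abs_le]
  constructor
  · obtain ⟨a, ha, h3, h4⟩ := h₁.exists_rayleigh h₂ hk₁ hk₂ LinearMap.id j
    simp only [LinearMap.id_apply] at h4
    have p1 := h₁.apply_self_pos ha
    have p2 := h₂.apply_self_pos ha
    by_cases hle : k₂ j ≤ k₁ j
    -- With both values equal, `key` only says that the right-hand side is nonnegative.
    · have := key (k₂ j) (k₂ j) _ _ _ _ p2 (hg a) (hB a) (by
        simp only [sub_self, abs_zero]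
        have : 0 ≤ η * g₂ a a := (abs_nonneg _).trans (hg a)
        have h5 := abs_nonneg (k₂ j)
        have : 0 ≤ (1 + |k₂ j|) * η * g₂ a a := by nlinarith
        positivity) p1
      simp only [sub_self, abs_zero] at this
      linarith
    · push Not at hle
      have := key (k₁ j) (k₂ j) _ _ _ _ p2 (hg a) (hB a) (by
        rw [le_div_iff₀ p1, abs_of_neg (by linarith)]
        have h5 := (abs_le.1 (aux (k₂ j) _ _ (hg a))).2
        have h6 := (abs_le.1 (hB a)).1
        nlinarith) p1
      linarith [(abs_le.1 this).1]
  · obtain ⟨a, ha, h3, h4⟩ := h₂.exists_rayleigh h₁ hk₂ hk₁ LinearMap.id j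
    simp only [LinearMap.id_apply] at h4
    have p1 := h₁.apply_self_pos ha
    have p2 := h₂.apply_self_pos ha
    by_cases hle : k₁ j ≤ k₂ j
    · have := key (k₂ j) (k₂ j) _ _ _ _ p2 (hg a) (hB a) (by
        simp only [sub_self, abs_zero]
        have : 0 ≤ η * g₂ a a := (abs_nonneg _).trans (hg a)
        have h5 := abs_nonneg (k₂ j)
        have : 0 ≤ (1 + |k₂ j|) * η * g₂ a a := by nlinarith
        positivity) p1
      simp only [sub_self, abs_zero] at this
      linarith
    · push Not at hle
      have := key (k₁ j) (k₂ j) _ _ _ _ p2 (hg a) (hB a) (by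
        rw [le_div_iff₀ p1, abs_of_pos (by linarith)]
        have h5 := (abs_le.1 (aux (k₂ j) _ _ (hg a))).1
        have h6 := (abs_le.1 (hB a)).2
        nlinarith) p1
      linarith [(abs_le.1 this).2]

end Eigenvalues

/-! ### Comparison of two sheets at an almost minimal pair -/

section Sheets

set_option maxSynthPendingDepth 3

variable {V : Type*} [NormedAddCommGroup V] [NormedSpace ℝ V]

/-- The bilinear form `(a, b) ↦ ⟨∇_a b, ν⟩` on constant fields, where `D` is the derivative of the
metric. -/
noncomputable def christoffelForm (D : V →L[ℝ] V →L[ℝ] V →L[ℝ] ℝ) (ν : V) : V →L[ℝ] V →L[ℝ] ℝ :=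
  (1 / 2 : ℝ) • (((ContinuousLinearMap.apply ℝ ℝ ν).postcomp V).comp D
    + (((ContinuousLinearMap.apply ℝ ℝ ν).postcomp V).comp D).flip - D ν)

theorem christoffelForm_apply (D : V →L[ℝ] V →L[ℝ] V →L[ℝ] ℝ) (ν a b : V) :
    christoffelForm D ν a b = (D a b ν + D b a ν - D ν a b) / 2 := by
  simp [christoffelForm]; ring

theorem abs_christoffelForm_le {D : V →L[ℝ] V →L[ℝ] V →L[ℝ] ℝ} {ν a b : V} {d m r s : ℝ}
    (hD : ‖D‖ ≤ d) (hν : ‖ν‖ ≤ m) (ha : ‖a‖ ≤ r) (hb : ‖b‖ ≤ s) :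
    |christoffelForm D ν a b| ≤ 3 / 2 * (d * m * r * s) := by
  have key : ∀ x y z : V, ∀ x' y' z' : ℝ, ‖x‖ ≤ x' → ‖y‖ ≤ y' → ‖z‖ ≤ z' →
      |D x y z| ≤ d * x' * y' * z' := by
    intro x y z x' y' z' hx hy hz
    have := (norm_nonneg _).trans hx
    have := (norm_nonneg _).trans hy
    have := (norm_nonneg _).trans hz
    have := (norm_nonneg _).trans hD
    calc |D x y z| ≤ ‖D x y‖ * ‖z‖ := (D x y).le_opNorm z
      _ ≤ (‖D x‖ * ‖y‖) * ‖z‖ := by gcongr; exact (D x).le_opNorm y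
      _ ≤ (‖D‖ * ‖x‖ * ‖y‖) * ‖z‖ := by gcongr; exact D.le_opNorm x
      _ ≤ _ := by gcongr
  have h1 := abs_le.1 (key a b ν _ _ _ ha hb hν)
  have h2 := abs_le.1 (key b a ν _ _ _ hb ha hν)
  have h3 := abs_le.1 (key ν a b _ _ _ hν ha hb)
  rw [christoffelForm_apply, abs_le]
  constructor <;> linarith

variable {H : Type*} [NormedAddCommGroup H] [NormedSpace ℝ H]
  {E : Type*} [NormedAddCommGroup E] [InnerProductSpace ℝ E]

/-- The first fundamental form of a sheet with differential `A`. -/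
noncomputable def firstForm (g : V →L[ℝ] V →L[ℝ] ℝ) (A : H →L[ℝ] V) : H →L[ℝ] H →L[ℝ] ℝ :=
  g.bilinearComp A A

/-- The second fundamental form of a sheet with differential `A` and second derivative `S`. -/
noncomputable def secondForm (g : V →L[ℝ] V →L[ℝ] ℝ) (D : V →L[ℝ] V →L[ℝ] V →L[ℝ] ℝ)
    (A : H →L[ℝ] V) (S : H →L[ℝ] H →L[ℝ] V) (ν : V) : H →L[ℝ] H →L[ℝ] ℝ :=
  ((g.flip ν).postcomp H).comp S + (christoffelForm D ν).bilinearComp A A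

theorem firstForm_apply (g : V →L[ℝ] V →L[ℝ] ℝ) (A : H →L[ℝ] V) (a b : H) :
    firstForm g A a b = g (A a) (A b) := rfl

theorem secondForm_apply (g : V →L[ℝ] V →L[ℝ] ℝ) (D : V →L[ℝ] V →L[ℝ] V →L[ℝ] ℝ)
    (A : H →L[ℝ] V) (S : H →L[ℝ] H →L[ℝ] V) (ν : V) (a b : H) :
    secondForm g D A S ν a b = g (S a b) ν + christoffelForm D ν (A a) (A b) := rfl

theorem secondForm_neg (g : V →L[ℝ] V →L[ℝ] ℝ) (D : V →L[ℝ] V →L[ℝ] V →L[ℝ] ℝ)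
    (A : H →L[ℝ] V) (S : H →L[ℝ] H →L[ℝ] V) (ν : V) :
    secondForm g D A S (-ν) = -secondForm g D A S ν := by
  ext a b
  simp [secondForm_apply, christoffelForm_apply]
  ring

/-- First order data of an immersed sheet with differential `A` and unit normal `ν`, in a space
with inner product `g`. -/
structure IsSheet (g : V →L[ℝ] V →L[ℝ] ℝ) (A : H →L[ℝ] V) (ν : V) : Prop where
  symm : ∀ u w, g u w = g w u
  injective : Function.Injective A
  normal : ∀ a, g (A a) ν = 0
  unit : g ν ν = 1

theorem IsSheet.neg {g : V →L[ℝ] V →L[ℝ] ℝ} {A : H →L[ℝ] V} {ν : V} (h : IsSheet g A ν) :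
    IsSheet g A (-ν) :=
  ⟨h.symm, h.injective, by simp [h.normal], by simp [h.unit]⟩

/-- The tangent space lies in the kernel of g(·, ν), and both have codimension one. -/
theorem IsSheet.exists_eq_of_orthogonal {g : V →L[ℝ] V →L[ℝ] ℝ} {A : H →L[ℝ] V} {ν : V}
    (h : IsSheet g A ν) [FiniteDimensional ℝ V]
    (hdim : Module.finrank ℝ V = Module.finrank ℝ H + 1) {w : V} (hw : g w ν = 0) :
    ∃ a, A a = w := by
  have hle : (A : H →ₗ[ℝ] V).range ≤ (g.flip ν : V →ₗ[ℝ] ℝ).ker := by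
    rintro _ ⟨a, rfl⟩
    simpa using h.normal a
  have h1 : (g.flip ν : V →ₗ[ℝ] ℝ).range = ⊤ := by
    rw [LinearMap.range_eq_top]
    exact LinearMap.surjective_of_ne_zero fun h0 => by
      have := congrArg (fun f => f ν) h0
      simp [h.unit] at this
  have h2 := (g.flip ν : V →ₗ[ℝ] ℝ).finrank_range_add_finrank_ker
  have h3 := LinearMap.finrank_range_of_inj (f := (A : H →ₗ[ℝ] V)) h.injective
  rw [h1, finrank_top, Module.finrank_self] at h2
  have heq := Submodule.eq_of_le_of_finrank_eq hle (by omega)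
  have : w ∈ (A : H →ₗ[ℝ] V).range := by rw [heq]; simpa using hw
  exact this

theorem IsSheet.exists_eq_sub {g : V →L[ℝ] V →L[ℝ] ℝ} {A : H →L[ℝ] V} {ν : V}
    (h : IsSheet g A ν) [FiniteDimensional ℝ V]
    (hdim : Module.finrank ℝ V = Module.finrank ℝ H + 1) (u : V) :
    ∃ a, A a = u - g u ν • ν :=
  h.exists_eq_of_orthogonal hdim (by simp [h.unit])

/-- A covector that kills the tangent hyperplane is a multiple of the conormal. It is applied to u ↦
⟨v, P u⟩, which kills the hyperplane at a critical pair. -/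
theorem IsSheet.apply_eq {g : V →L[ℝ] V →L[ℝ] ℝ} {A : H →L[ℝ] V} {ν : V}
    (h : IsSheet g A ν) [FiniteDimensional ℝ V]
    (hdim : Module.finrank ℝ V = Module.finrank ℝ H + 1) {θ : V →L[ℝ] ℝ}
    (hθ : ∀ a, θ (A a) = 0) (u : V) : θ u = θ ν * g ν u := by
  obtain ⟨a, ha⟩ := h.exists_eq_sub hdim u
  have := hθ a
  rw [ha, map_sub, map_smul, smul_eq_mul, sub_eq_zero] at this
  rw [this, h.symm ν u, mul_comm]

/-- `L` is the orthogonal projection onto the tangent space of the sheet, pulled back by `A`. It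
matches tangent vectors of two nearby sheets, which have no common parametrization. -/
theorem IsSheet.exists_projection {g : V →L[ℝ] V →L[ℝ] ℝ} {A : H →L[ℝ] V} {ν : V}
    (h : IsSheet g A ν) [FiniteDimensional ℝ V]
    (hdim : Module.finrank ℝ V = Module.finrank ℝ H + 1) (B : H →L[ℝ] V) :
    ∃ L : H →ₗ[ℝ] H, ∀ a, A (L a) = B a - g (B a) ν • ν := by
  obtain ⟨l, hl⟩ := LinearMap.exists_leftInverse_of_injective (A : H →ₗ[ℝ] V)
    (LinearMap.ker_eq_bot.2 h.injective)
  refine ⟨l.comp ((LinearMap.id - (g.flip ν : V →ₗ[ℝ] ℝ).smulRight ν).comp (B : H →ₗ[ℝ] V)),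
    fun a => ?_⟩
  obtain ⟨b, hb⟩ := h.exists_eq_sub hdim (B a)
  have : l (A b) = b := LinearMap.congr_fun hl b
  simp only [LinearMap.comp_apply, LinearMap.sub_apply, LinearMap.id_apply,
    LinearMap.smulRight_apply, ContinuousLinearMap.coe_coe, ContinuousLinearMap.flip_apply]
  rw [← hb, this]

end Sheets

/-! ### Quantitative consequences of the first and second order conditions. -/

section SheetPairs

set_option maxSynthPendingDepth 3

variable {V : Type*} [NormedAddCommGroup V] [NormedSpace ℝ V]
  {H : Type*} [NormedAddCommGroup H] [NormedSpace ℝ H]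
  {E : Type*} [NormedAddCommGroup E] [InnerProductSpace ℝ E]

/-- Two sheets at which the distance `‖v‖`, measured in the inner product space `E`, satisfies the
first and second order conditions of a minimum. Here `P`, `Q` are the first two derivatives of the
immersion of the ambient space into `E`, `D` is the derivative of the metric `g`, and `A`, `S` are
the first two derivatives of the sheet. -/
structure IsMinimalPair (K : ℝ) (v : E) (P₁ P₂ : V →L[ℝ] E) (Q₁ Q₂ : V →L[ℝ] V →L[ℝ] E)
    (g₁ g₂ : V →L[ℝ] V →L[ℝ] ℝ) (D₁ D₂ : V →L[ℝ] V →L[ℝ] V →L[ℝ] ℝ) (A₁ A₂ : H →L[ℝ] V)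
    (S₁ S₂ : H →L[ℝ] H →L[ℝ] V) (ν₁ ν₂ : V) : Prop where
  one_le : 1 ≤ K
  pos : 0 < ‖v‖
  small : 14 * K ^ 7 * ‖v‖ ≤ 1 / 2
  sheet₁ : IsSheet g₁ A₁ ν₁
  sheet₂ : IsSheet g₂ A₂ ν₂
  coercive₁ : ∀ u, ‖u‖ ^ 2 ≤ K * g₁ u u
  coercive₂ : ∀ u, ‖u‖ ^ 2 ≤ K * g₂ u u
  norm_P₁ : ‖P₁‖ ≤ K
  norm_P₂ : ‖P₂‖ ≤ K
  norm_P_sub : ‖P₁ - P₂‖ ≤ K * ‖v‖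
  norm_Q₂ : ‖Q₂‖ ≤ K
  norm_Q_sub : ‖Q₁ - Q₂‖ ≤ K * ‖v‖
  norm_g₁ : ‖g₁‖ ≤ K
  norm_g₂ : ‖g₂‖ ≤ K
  norm_g_sub : ‖g₁ - g₂‖ ≤ K * ‖v‖
  norm_D₂ : ‖D₂‖ ≤ K
  norm_D_sub : ‖D₁ - D₂‖ ≤ K * ‖v‖
  critical₁ : ∀ a, inner ℝ v (P₁ (A₁ a)) = 0
  critical₂ : ∀ a, inner ℝ v (P₂ (A₂ a)) = 0
  chord : ∃ d, ‖d‖ ≤ K * ‖v‖ ∧ ‖v - P₁ d‖ ≤ K * ‖v‖ ^ 2 ∧ ‖v - P₂ d‖ ≤ K * ‖v‖ ^ 2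
  second_order : ∀ a b, 0 ≤ ‖P₁ (A₁ a) - P₂ (A₂ b)‖ ^ 2
    + inner ℝ v ((Q₁ (A₁ a) (A₁ a) + P₁ (S₁ a a)) - (Q₂ (A₂ b) (A₂ b) + P₂ (S₂ b b)))

theorem ContinuousLinearMap.norm_apply₂_le {X Y Z : Type*} [NormedAddCommGroup X] [NormedSpace ℝ X]
    [NormedAddCommGroup Y] [NormedSpace ℝ Y] [NormedAddCommGroup Z] [NormedSpace ℝ Z]
    {f : X →L[ℝ] Y →L[ℝ] Z} {x : X} {y : Y} {c r s : ℝ} (hf : ‖f‖ ≤ c) (hx : ‖x‖ ≤ r)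
    (hy : ‖y‖ ≤ s) : ‖f x y‖ ≤ c * r * s := by
  have := (norm_nonneg _).trans hx
  have := (norm_nonneg _).trans hy
  have := (norm_nonneg _).trans hf
  exact (f.le_opNorm₂ x y).trans (by gcongr)

theorem ContinuousLinearMap.norm_apply_le {X Y : Type*} [NormedAddCommGroup X] [NormedSpace ℝ X]
    [NormedAddCommGroup Y] [NormedSpace ℝ Y]
    {f : X →L[ℝ] Y} {x : X} {c r : ℝ} (hf : ‖f‖ ≤ c) (hx : ‖x‖ ≤ r) : ‖f x‖ ≤ c * r := by
  have := (norm_nonneg _).trans hx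
  have := (norm_nonneg _).trans hf
  exact (f.le_opNorm x).trans (by gcongr)

/-- Difference of the values of two bilinear maps on the diagonal. -/
theorem ContinuousLinearMap.norm_apply_self_sub_le {X Z : Type*} [NormedAddCommGroup X]
    [NormedSpace ℝ X] [NormedAddCommGroup Z] [NormedSpace ℝ Z] {f f' : X →L[ℝ] X →L[ℝ] Z} {x y : X}
    {c c' r s d : ℝ} (hf : ‖f - f'‖ ≤ c) (hf' : ‖f'‖ ≤ c') (hx : ‖x‖ ≤ r) (hy : ‖y‖ ≤ s)
    (hxy : ‖x - y‖ ≤ d) : ‖f x x - f' y y‖ ≤ c * r * r + c' * d * (r + s) := by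
  have h : f x x - f' y y = (f - f') x x + (f' (x - y) x + f' y (x - y)) := by
    simp only [sub_apply, map_sub]; abel
  rw [h]
  have h1 := norm_apply₂_le hf hx hx
  have h2 := norm_apply₂_le hf' hxy hx
  have h3 := norm_apply₂_le hf' hy hxy
  calc _ ≤ _ := norm_add_le _ _
    _ ≤ c * r * r + (c' * d * r + c' * s * d) :=
      add_le_add h1 ((norm_add_le _ _).trans (add_le_add h2 h3))
    _ = _ := by ring

namespace IsMinimalPair

variable {K : ℝ} {v : E} {P₁ P₂ : V →L[ℝ] E} {Q₁ Q₂ : V →L[ℝ] V →L[ℝ] E}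
    {g₁ g₂ : V →L[ℝ] V →L[ℝ] ℝ} {D₁ D₂ : V →L[ℝ] V →L[ℝ] V →L[ℝ] ℝ} {A₁ A₂ : H →L[ℝ] V}
    {S₁ S₂ : H →L[ℝ] H →L[ℝ] V} {ν₁ ν₂ : V}

theorem norm_normal_le_of_unit {g : V →L[ℝ] V →L[ℝ] ℝ} {ν : V} (hK : 1 ≤ K)
    (hg : ∀ u, ‖u‖ ^ 2 ≤ K * g u u) (hν : g ν ν = 1) : ‖ν‖ ≤ K := by
  have := hg ν
  rw [hν] at this
  nlinarith [norm_nonneg ν]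

/-- The upper bound is Cauchy–Schwarz. For the lower bound, v is P d up to a quadratic error, so ⟨v,
P d⟩ ≥ ‖v‖²/2, while this number equals ⟨v, P ν⟩ g(ν, d) with d = O(‖v‖). Thus ⟨v, P ν⟩ is
comparable to ‖v‖, which later permits division by it. -/
theorem covector_bounds [FiniteDimensional ℝ V]
    (hdim : Module.finrank ℝ V = Module.finrank ℝ H + 1) {P : V →L[ℝ] E} {g : V →L[ℝ] V →L[ℝ] ℝ}
    {A : H →L[ℝ] V} {ν : V} (hs : IsSheet g A ν) (hK : 1 ≤ K) (hv : 0 < ‖v‖)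
    (hsmall : 2 * K * ‖v‖ ≤ 1) (hco : ∀ u, ‖u‖ ^ 2 ≤ K * g u u) (hP : ‖P‖ ≤ K) (hg : ‖g‖ ≤ K)
    (hcrit : ∀ a, inner ℝ v (P (A a)) = 0) {d : V} (hd : ‖d‖ ≤ K * ‖v‖)
    (hvd : ‖v - P d‖ ≤ K * ‖v‖ ^ 2) :
    (∀ u, inner ℝ v (P u) = inner ℝ v (P ν) * g ν u) ∧ |inner ℝ v (P ν)| ≤ K ^ 2 * ‖v‖ ∧
      ‖v‖ ≤ 2 * K ^ 3 * |inner ℝ v (P ν)| := by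
  have hν := norm_normal_le_of_unit hK hco hs.unit
  have h1 : ∀ u, inner ℝ v (P u) = inner ℝ v (P ν) * g ν u := fun u =>
    hs.apply_eq hdim (θ := (innerSL ℝ v).comp P) hcrit u
  refine ⟨h1, ?_, ?_⟩
  · calc |inner ℝ v (P ν)| ≤ ‖v‖ * ‖P ν‖ := abs_real_inner_le_norm _ _
      _ ≤ ‖v‖ * (K * K) := by gcongr; exact ContinuousLinearMap.norm_apply_le hP hν
      _ = _ := by ring
  · have h2 : ‖v‖ ^ 2 / 2 ≤ inner ℝ v (P d) := by
      have : inner ℝ v (P d) = ‖v‖ ^ 2 - inner ℝ v (v - P d) := by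
        rw [inner_sub_right, real_inner_self_eq_norm_sq]; ring
      have h3 := (abs_le.1 (abs_real_inner_le_norm v (v - P d))).2
      have h4 : ‖v‖ * ‖v - P d‖ ≤ ‖v‖ * (K * ‖v‖ ^ 2) := by gcongr
      nlinarith [sq_nonneg ‖v‖]
    have h5 : |g ν d| ≤ K * K * (K * ‖v‖) := ContinuousLinearMap.norm_apply₂_le hg hν hd
    rw [h1] at h2
    have h6 : inner ℝ v (P ν) * g ν d ≤ |inner ℝ v (P ν)| * (K * K * (K * ‖v‖)) :=
      (le_abs_self _).trans (by rw [abs_mul]; gcongr)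
    have : ‖v‖ * ‖v‖ ≤ ‖v‖ * (2 * K ^ 3 * |inner ℝ v (P ν)|) := by nlinarith
    exact le_of_mul_le_mul_left this hv

/-- At an almost minimal pair the two covectors defined by `v`, and hence the two normals, almost
agree. -/
theorem normals_close [FiniteDimensional ℝ V]
    (hdim : Module.finrank ℝ V = Module.finrank ℝ H + 1)
    (h : IsMinimalPair K v P₁ P₂ Q₁ Q₂ g₁ g₂ D₁ D₂ A₁ A₂ S₁ S₂ ν₁ ν₂)
    (hl₁ : 0 < (inner ℝ v (P₁ ν₁) : ℝ)) (hl₂ : 0 < (inner ℝ v (P₂ ν₂) : ℝ)) :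
    ‖(inner ℝ v (P₁ ν₁) : ℝ) • ν₁ - (inner ℝ v (P₂ ν₂) : ℝ) • ν₂‖ ≤ 2 * K ^ 5 * ‖v‖ ^ 2 ∧
      |(inner ℝ v (P₁ ν₁) : ℝ) - inner ℝ v (P₂ ν₂)| ≤ 3 * K ^ 9 * ‖v‖ ^ 2 := by
  obtain ⟨d, hd, hd₁, hd₂⟩ := h.chord
  have hK := h.one_le
  have hv := h.pos
  have hK0 : 0 < K := by linarith
  have hsmall : 2 * K * ‖v‖ ≤ 1 := by
    have : K ≤ K ^ 7 := le_self_pow₀ hK (by norm_num)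
    have := h.small
    nlinarith
  obtain ⟨c₁, u₁, b₁⟩ := covector_bounds hdim h.sheet₁ hK hv hsmall h.coercive₁ h.norm_P₁ h.norm_g₁
    h.critical₁ hd hd₁
  obtain ⟨c₂, u₂, b₂⟩ := covector_bounds hdim h.sheet₂ hK hv hsmall h.coercive₂ h.norm_P₂ h.norm_g₂
    h.critical₂ hd hd₂
  have hν₁ := norm_normal_le_of_unit hK h.coercive₁ h.sheet₁.unit
  have hν₂ := norm_normal_le_of_unit hK h.coercive₂ h.sheet₂.unit
  generalize hl : (inner ℝ v (P₁ ν₁) : ℝ) = l₁ at *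
  generalize hl' : (inner ℝ v (P₂ ν₂) : ℝ) = l₂ at *
  rw [abs_of_pos hl₁] at u₁ b₁
  rw [abs_of_pos hl₂] at u₂ b₂
  have hn₁ : ‖l₁ • ν₁‖ ≤ K ^ 3 * ‖v‖ := by
    rw [norm_smul, Real.norm_of_nonneg hl₁.le]
    calc l₁ * ‖ν₁‖ ≤ (K ^ 2 * ‖v‖) * K := by gcongr
      _ = _ := by ring
  have hn₂ : ‖l₂ • ν₂‖ ≤ K ^ 3 * ‖v‖ := by
    rw [norm_smul, Real.norm_of_nonneg hl₂.le]
    calc l₂ * ‖ν₂‖ ≤ (K ^ 2 * ‖v‖) * K := by gcongr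
      _ = _ := by ring
  have hθ : ∀ u, |(inner ℝ v (P₁ u) : ℝ) - inner ℝ v (P₂ u)| ≤ K * ‖v‖ ^ 2 * ‖u‖ := fun u => by
    rw [← inner_sub_right, ← sub_apply]
    calc _ ≤ ‖v‖ * ‖(P₁ - P₂) u‖ := abs_real_inner_le_norm _ _
      _ ≤ ‖v‖ * (K * ‖v‖ * ‖u‖) := by
        gcongr; exact ContinuousLinearMap.norm_apply_le h.norm_P_sub le_rfl
      _ = _ := by ring
  set m := l₁ • ν₁ - l₂ • ν₂ with hm
  have hm' : ‖m‖ ≤ 2 * K ^ 5 * ‖v‖ ^ 2 := by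
    -- The covectors ⟨v, P₁ ·⟩ and ⟨v, P₂ ·⟩ differ by O(‖v‖²). Their difference is tested on `m`
    -- itself, and coercivity of g₁ turns this into a bound on ‖m‖.
    have e1 : g₁ m m = (inner ℝ v (P₁ m) - inner ℝ v (P₂ m)) - (g₁ - g₂) (l₂ • ν₂) m := by
      have e0 : g₁ m = l₁ • g₁ ν₁ - l₂ • g₁ ν₂ := by rw [hm]; simp only [map_sub, map_smul]
      rw [c₁, c₂, e0]
      simp only [map_smul, sub_apply, _root_.smul_apply, smul_eq_mul]
      ring
    have e2 : |(g₁ - g₂) (l₂ • ν₂) m| ≤ K * ‖v‖ * (K ^ 3 * ‖v‖) * ‖m‖ :=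
      ContinuousLinearMap.norm_apply₂_le h.norm_g_sub hn₂ le_rfl
    have e3 := h.coercive₁ m
    have e4 : K * ‖v‖ ^ 2 * ‖m‖ ≤ K ^ 4 * ‖v‖ ^ 2 * ‖m‖ := by
      gcongr; exact le_self_pow₀ hK (by norm_num)
    have e5 : g₁ m m ≤ 2 * K ^ 4 * ‖v‖ ^ 2 * ‖m‖ := by
      rw [e1]
      have := (abs_le.1 (hθ m)).2
      have := (abs_le.1 e2).1
      nlinarith
    rcases (norm_nonneg m).eq_or_lt with h0 | h0
    · rw [← h0]; positivity
    · have : ‖m‖ * ‖m‖ ≤ ‖m‖ * (2 * K ^ 5 * ‖v‖ ^ 2) := by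
        calc ‖m‖ * ‖m‖ = ‖m‖ ^ 2 := by ring
          _ ≤ K * (2 * K ^ 4 * ‖v‖ ^ 2 * ‖m‖) := e3.trans (by gcongr)
          _ = _ := by ring
      exact le_of_mul_le_mul_left this h0
  refine ⟨hm', ?_⟩
  -- Squares are compared first, through l_i² = ⟨v, P_i (l_i ν_i)⟩. Dividing by l₁ + l₂ ≥ ‖v‖ / K³
  -- then costs one power of ‖v‖.
  have e1 : (l₁ - l₂) * (l₁ + l₂) =
      (inner ℝ v (P₁ (l₁ • ν₁)) - inner ℝ v (P₂ (l₁ • ν₁))) + inner ℝ v (P₂ m) := by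
    rw [hm]
    simp only [map_smul, map_sub, inner_smul_right, inner_sub_right, hl, hl']
    ring
  have e2 : |(inner ℝ v (P₂ m) : ℝ)| ≤ ‖v‖ * (K * (2 * K ^ 5 * ‖v‖ ^ 2)) :=
    (abs_real_inner_le_norm _ _).trans
      (by gcongr; exact ContinuousLinearMap.norm_apply_le h.norm_P₂ hm')
  have e3 : |l₁ - l₂| * (l₁ + l₂) ≤ 3 * K ^ 6 * ‖v‖ ^ 3 := by
    have e4 := hθ (l₁ • ν₁)
    calc |l₁ - l₂| * (l₁ + l₂) = |(l₁ - l₂) * (l₁ + l₂)| := by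
          rw [abs_mul, abs_of_pos (add_pos hl₁ hl₂)]
      _ ≤ K * ‖v‖ ^ 2 * (K ^ 3 * ‖v‖) + ‖v‖ * (K * (2 * K ^ 5 * ‖v‖ ^ 2)) := by
          rw [e1]
          exact (abs_add_le _ _).trans (add_le_add (e4.trans (by gcongr)) e2)
      _ = K ^ 4 * ‖v‖ ^ 3 + 2 * K ^ 6 * ‖v‖ ^ 3 := by ring
      _ ≤ K ^ 6 * ‖v‖ ^ 3 + 2 * K ^ 6 * ‖v‖ ^ 3 := by gcongr; norm_num
      _ = _ := by ring
  have e5 : ‖v‖ ≤ K ^ 3 * (l₁ + l₂) := by linarith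
  have : ‖v‖ * |l₁ - l₂| ≤ ‖v‖ * (3 * K ^ 9 * ‖v‖ ^ 2) := by
    calc ‖v‖ * |l₁ - l₂| ≤ K ^ 3 * (l₁ + l₂) * |l₁ - l₂| := by gcongr
      _ = K ^ 3 * (|l₁ - l₂| * (l₁ + l₂)) := by ring
      _ ≤ K ^ 3 * (3 * K ^ 6 * ‖v‖ ^ 3) := by gcongr
      _ = _ := by ring
  exact le_of_mul_le_mul_left this hv

/-- The second order condition at an almost minimal pair compares the second fundamental forms
along a linear map `L` which is almost an isometry. -/
theorem secondForm_comparison [FiniteDimensional ℝ V]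
    (hdim : Module.finrank ℝ V = Module.finrank ℝ H + 1)
    (h : IsMinimalPair K v P₁ P₂ Q₁ Q₂ g₁ g₂ D₁ D₂ A₁ A₂ S₁ S₂ ν₁ ν₂)
    (hl₁ : 0 < (inner ℝ v (P₁ ν₁) : ℝ)) (hl₂ : 0 < (inner ℝ v (P₂ ν₂) : ℝ)) :
    ∃ L : H →ₗ[ℝ] H, ∀ a,
      |firstForm g₁ A₁ a a - firstForm g₂ A₂ (L a) (L a)|
          ≤ 7 * K ^ 7 * ‖v‖ * firstForm g₁ A₁ a a ∧
      (inner ℝ v (P₂ ν₂) : ℝ) * secondForm g₂ D₂ A₂ S₂ ν₂ (L a) (L a)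
        ≤ (inner ℝ v (P₁ ν₁) : ℝ) * secondForm g₁ D₁ A₁ S₁ ν₁ a a
          + 30 * K ^ 13 * ‖v‖ ^ 2 * firstForm g₁ A₁ a a := by
  obtain ⟨d, hd, hd₁, hd₂⟩ := h.chord
  have hK := h.one_le
  have hv := h.pos
  have hK0 : 0 < K := by linarith
  have hp : ∀ m n : ℕ, m ≤ n → K ^ m ≤ K ^ n := fun m n hmn => pow_le_pow_right₀ hK hmn
  have hsmall : 2 * K * ‖v‖ ≤ 1 := by
    have := hp 1 7 (by norm_num)
    have := h.small
    nlinarith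
  have hsmall' : 2 * K ^ 5 * ‖v‖ ≤ 1 := by
    have := hp 5 7 (by norm_num)
    have := h.small
    nlinarith
  obtain ⟨c₁, u₁, b₁⟩ := covector_bounds hdim h.sheet₁ hK hv hsmall h.coercive₁ h.norm_P₁ h.norm_g₁
    h.critical₁ hd hd₁
  obtain ⟨c₂, u₂, b₂⟩ := covector_bounds hdim h.sheet₂ hK hv hsmall h.coercive₂ h.norm_P₂ h.norm_g₂
    h.critical₂ hd hd₂
  obtain ⟨hm, -⟩ := normals_close hdim h hl₁ hl₂
  have hν₁ := norm_normal_le_of_unit hK h.coercive₁ h.sheet₁.unit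
  have hν₂ := norm_normal_le_of_unit hK h.coercive₂ h.sheet₂.unit
  generalize hl : (inner ℝ v (P₁ ν₁) : ℝ) = l₁ at *
  generalize hl' : (inner ℝ v (P₂ ν₂) : ℝ) = l₂ at *
  rw [abs_of_pos hl₁] at u₁ b₁
  rw [abs_of_pos hl₂] at u₂ b₂
  have hn₁ : ‖l₁ • ν₁‖ ≤ K ^ 3 * ‖v‖ := by
    rw [norm_smul, Real.norm_of_nonneg hl₁.le]
    calc l₁ * ‖ν₁‖ ≤ (K ^ 2 * ‖v‖) * K := by gcongr
      _ = _ := by ring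
  have hn₂ : ‖l₂ • ν₂‖ ≤ K ^ 3 * ‖v‖ := by
    rw [norm_smul, Real.norm_of_nonneg hl₂.le]
    calc l₂ * ‖ν₂‖ ≤ (K ^ 2 * ‖v‖) * K := by gcongr
      _ = _ := by ring
  obtain ⟨L, hL⟩ := h.sheet₂.exists_projection hdim A₁
  refine ⟨L, fun a => ?_⟩
  have hso := h.second_order a (L a)
  have hL := hL a
  simp only [firstForm_apply, secondForm_apply]
  have hcu := h.coercive₁ (A₁ a)
  have hcrit := h.critical₁ a
  set u := A₁ a
  set w := A₂ (L a)
  -- The difference u - w is the g₂-normal part of u. Its size is governed by l₂ g₂(ν₂, u) = ⟨v, P₂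
  -- u⟩ = -⟨v, (P₁ - P₂) u⟩, because ⟨v, P₁ u⟩ = 0. This is O(‖v‖² ‖u‖), and l₂ is comparable to
  -- ‖v‖.
  have huw : ‖u - w‖ ≤ 2 * K ^ 5 * ‖v‖ * ‖u‖ := by
    have e1 : l₂ * g₂ ν₂ u = -inner ℝ v ((P₁ - P₂) u) := by
      rw [← c₂, sub_apply, inner_sub_right, hcrit]; ring
    have e2 : |(inner ℝ v ((P₁ - P₂) u) : ℝ)| ≤ ‖v‖ * (K * ‖v‖ * ‖u‖) :=
      (abs_real_inner_le_norm _ _).trans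
        (by gcongr; exact ContinuousLinearMap.norm_apply_le h.norm_P_sub le_rfl)
    have e3 : l₂ * |g₂ ν₂ u| ≤ ‖v‖ * (K * ‖v‖ * ‖u‖) := by
      rwa [← abs_neg, ← e1, abs_mul, abs_of_pos hl₂] at e2
    have e4 : ‖v‖ * |g₂ ν₂ u| ≤ ‖v‖ * (2 * K ^ 4 * ‖v‖ * ‖u‖) := by
      calc ‖v‖ * |g₂ ν₂ u| ≤ 2 * K ^ 3 * l₂ * |g₂ ν₂ u| := by gcongr
        _ = 2 * K ^ 3 * (l₂ * |g₂ ν₂ u|) := by ring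
        _ ≤ 2 * K ^ 3 * (‖v‖ * (K * ‖v‖ * ‖u‖)) := by gcongr
        _ = _ := by ring
    have e5 := le_of_mul_le_mul_left e4 hv
    rw [hL, sub_sub_cancel, norm_smul, h.sheet₂.symm u ν₂, Real.norm_eq_abs]
    calc |g₂ ν₂ u| * ‖ν₂‖ ≤ (2 * K ^ 4 * ‖v‖ * ‖u‖) * K := by gcongr
      _ = _ := by ring
  have hu := norm_nonneg u
  have hw : ‖w‖ ≤ 2 * ‖u‖ := by
    have : ‖w‖ ≤ ‖u‖ + ‖u - w‖ := by
      calc ‖w‖ = ‖u - (u - w)‖ := by rw [sub_sub_cancel]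
        _ ≤ _ := norm_sub_le _ _
    nlinarith
  have hε := hv.le
  have hv2 : 0 ≤ ‖v‖ ^ 2 * ‖u‖ ^ 2 := by positivity
  have hv1 : 0 ≤ ‖v‖ * ‖u‖ ^ 2 := by positivity
  constructor
  · have e1 := ContinuousLinearMap.norm_apply_self_sub_le h.norm_g_sub h.norm_g₂
      (le_refl ‖u‖) hw huw
    rw [Real.norm_eq_abs] at e1
    calc |g₁ u u - g₂ w w| ≤ _ := e1
      _ = K ^ 1 * (‖v‖ * ‖u‖ ^ 2) + 6 * (K ^ 6 * (‖v‖ * ‖u‖ ^ 2)) := by ring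
      _ ≤ K ^ 6 * (‖v‖ * ‖u‖ ^ 2) + 6 * (K ^ 6 * (‖v‖ * ‖u‖ ^ 2)) := by
        gcongr
        norm_num
      _ = 7 * K ^ 6 * ‖v‖ * ‖u‖ ^ 2 := by ring
      _ ≤ 7 * K ^ 6 * ‖v‖ * (K * g₁ u u) := by gcongr
      _ = _ := by ring
  · have e1 : ‖P₁ u - P₂ w‖ ≤ 3 * K ^ 6 * ‖v‖ * ‖u‖ := by
      have : P₁ u - P₂ w = (P₁ - P₂) u + P₂ (u - w) := by simp
      rw [this]
      calc _ ≤ K * ‖v‖ * ‖u‖ + K * (2 * K ^ 5 * ‖v‖ * ‖u‖) :=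
            (norm_add_le _ _).trans (add_le_add
              (ContinuousLinearMap.norm_apply_le h.norm_P_sub le_rfl)
              (ContinuousLinearMap.norm_apply_le h.norm_P₂ huw))
        _ = K ^ 1 * (‖v‖ * ‖u‖) + 2 * (K ^ 6 * (‖v‖ * ‖u‖)) := by ring
        _ ≤ K ^ 6 * (‖v‖ * ‖u‖) + 2 * (K ^ 6 * (‖v‖ * ‖u‖)) := by
          gcongr
          norm_num
        _ = _ := by ring
    have e2 : ‖P₁ u - P₂ w‖ ^ 2 ≤ 9 * K ^ 12 * (‖v‖ ^ 2 * ‖u‖ ^ 2) := by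
      calc ‖P₁ u - P₂ w‖ ^ 2 ≤ (3 * K ^ 6 * ‖v‖ * ‖u‖) ^ 2 := by gcongr
        _ = _ := by ring
    have e3 : inner ℝ v (Q₁ u u - Q₂ w w) ≤ 7 * K ^ 6 * (‖v‖ ^ 2 * ‖u‖ ^ 2) := by
      have := ContinuousLinearMap.norm_apply_self_sub_le h.norm_Q_sub h.norm_Q₂
        (le_refl ‖u‖) hw huw
      calc inner ℝ v (Q₁ u u - Q₂ w w) ≤ ‖v‖ * ‖Q₁ u u - Q₂ w w‖ := real_inner_le_norm _ _
        _ ≤ ‖v‖ * (K * ‖v‖ * ‖u‖ * ‖u‖ + K * (2 * K ^ 5 * ‖v‖ * ‖u‖) * (‖u‖ + 2 * ‖u‖)) := by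
          gcongr
        _ = K ^ 1 * (‖v‖ ^ 2 * ‖u‖ ^ 2) + 6 * (K ^ 6 * (‖v‖ ^ 2 * ‖u‖ ^ 2)) := by ring
        _ ≤ K ^ 6 * (‖v‖ ^ 2 * ‖u‖ ^ 2) + 6 * (K ^ 6 * (‖v‖ ^ 2 * ‖u‖ ^ 2)) := by
          gcongr
          norm_num
        _ = _ := by ring
    have e4 : l₂ * christoffelForm D₂ ν₂ w w - l₁ * christoffelForm D₁ ν₁ u u
        ≤ 14 * K ^ 9 * (‖v‖ ^ 2 * ‖u‖ ^ 2) := by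
      -- Telescoping in the metric derivative, the normal and the two tangent vectors. With the
      -- factors l_i absorbed into the normals, which become O(‖v‖), every term is O(‖v‖²).
      have d1 : l₁ * christoffelForm D₁ ν₁ u u - l₂ * christoffelForm D₂ ν₂ w w
          = christoffelForm (D₁ - D₂) (l₁ • ν₁) u u
            + christoffelForm D₂ (l₁ • ν₁ - l₂ • ν₂) u u
            + (christoffelForm D₂ (l₂ • ν₂) (u - w) u
              + christoffelForm D₂ (l₂ • ν₂) w (u - w)) := by
        simp only [christoffelForm_apply, map_sub, map_smul, sub_apply, _root_.smul_apply,
          smul_eq_mul]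
        ring
      have d2 := (abs_le.1 (abs_christoffelForm_le h.norm_D_sub hn₁ (le_refl ‖u‖) (le_refl ‖u‖))).1
      have d3 := (abs_le.1 (abs_christoffelForm_le h.norm_D₂ hm (le_refl ‖u‖) (le_refl ‖u‖))).1
      have d4 := (abs_le.1 (abs_christoffelForm_le h.norm_D₂ hn₂ huw (le_refl ‖u‖))).1
      have d5 := (abs_le.1 (abs_christoffelForm_le h.norm_D₂ hn₂ hw huw)).1
      have d6 : l₂ * christoffelForm D₂ ν₂ w w - l₁ * christoffelForm D₁ ν₁ u u ≤
          3 / 2 * (K ^ 4 * (‖v‖ ^ 2 * ‖u‖ ^ 2)) + 3 * (K ^ 6 * (‖v‖ ^ 2 * ‖u‖ ^ 2))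
            + 9 * (K ^ 9 * (‖v‖ ^ 2 * ‖u‖ ^ 2)) := by
        linear_combination -d1 + d2 + d3 + d4 + d5
      have := mul_le_mul_of_nonneg_right (hp 4 9 (by norm_num)) hv2
      have := mul_le_mul_of_nonneg_right (hp 6 9 (by norm_num)) hv2
      have : 0 ≤ K ^ 9 * (‖v‖ ^ 2 * ‖u‖ ^ 2) := by positivity
      linarith
    -- The identity ⟨v, P_i u⟩ = l_i g_i(ν_i, u) turns the accelerations into the leading terms of
    -- the second fundamental forms.
    have e5 : inner ℝ v (Q₁ u u + P₁ (S₁ a a) - (Q₂ w w + P₂ (S₂ (L a) (L a))))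
        = inner ℝ v (Q₁ u u - Q₂ w w) + l₁ * g₁ (S₁ a a) ν₁ - l₂ * g₂ (S₂ (L a) (L a)) ν₂ := by
      rw [h.sheet₁.symm _ ν₁, h.sheet₂.symm _ ν₂, ← c₁, ← c₂, ← inner_add_right, ← inner_sub_right]
      congr 1
      abel
    rw [e5] at hso
    -- Here 30 = 9 + 7 + 14 collects the errors `e2`, `e3`, `e4`; the additional factor K comes from
    -- coercivity.
    have e6 : 30 * K ^ 12 * (‖v‖ ^ 2 * ‖u‖ ^ 2) ≤ 30 * K ^ 13 * ‖v‖ ^ 2 * g₁ u u := by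
      calc 30 * K ^ 12 * (‖v‖ ^ 2 * ‖u‖ ^ 2) ≤ 30 * K ^ 12 * (‖v‖ ^ 2 * (K * g₁ u u)) := by gcongr
        _ = _ := by ring
    have := mul_le_mul_of_nonneg_right (hp 6 12 (by norm_num)) hv2
    have := mul_le_mul_of_nonneg_right (hp 9 12 (by norm_num)) hv2
    linarith

/-- At an almost minimal pair the ordered principal curvatures are ordered, up to an error
controlled by the distance. -/
theorem eigenvalue_comparison {n : ℕ} [FiniteDimensional ℝ V]
    (hdim : Module.finrank ℝ V = Module.finrank ℝ H + 1)
    (h : IsMinimalPair K v P₁ P₂ Q₁ Q₂ g₁ g₂ D₁ D₂ A₁ A₂ S₁ S₂ ν₁ ν₂)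
    (hl₁ : 0 < (inner ℝ v (P₁ ν₁) : ℝ)) (hl₂ : 0 < (inner ℝ v (P₂ ν₂) : ℝ)) {k₁ k₂ : Fin n → ℝ}
    (hk₁ : IsEigenvalueList (firstForm g₁ A₁) (secondForm g₁ D₁ A₁ S₁ ν₁) k₁)
    (hk₂ : IsEigenvalueList (firstForm g₂ A₂) (secondForm g₂ D₂ A₂ S₂ ν₂) k₂)
    (hmono₁ : Monotone k₁) (hmono₂ : Monotone k₂) {j : Fin n} (hK₂ : |k₂ j| ≤ K) :
    k₂ j - 80 * K ^ 16 * ‖v‖ ≤ k₁ j := by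
  obtain ⟨d, hd, hd₁, hd₂⟩ := h.chord
  have hK := h.one_le
  have hv := h.pos
  have hK0 : 0 < K := by linarith
  have hp : ∀ m n : ℕ, m ≤ n → K ^ m ≤ K ^ n := fun m n hmn => pow_le_pow_right₀ hK hmn
  have hsmall : 2 * K * ‖v‖ ≤ 1 := by
    have := hp 1 7 (by norm_num)
    have := h.small
    nlinarith
  obtain ⟨-, u₁, b₁⟩ := covector_bounds hdim h.sheet₁ hK hv hsmall h.coercive₁ h.norm_P₁ h.norm_g₁
    h.critical₁ hd hd₁
  obtain ⟨-, u₂, b₂⟩ := covector_bounds hdim h.sheet₂ hK hv hsmall h.coercive₂ h.norm_P₂ h.norm_g₂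
    h.critical₂ hd hd₂
  obtain ⟨-, hl⟩ := normals_close hdim h hl₁ hl₂
  obtain ⟨L, hL⟩ := secondForm_comparison hdim h hl₁ hl₂
  obtain ⟨a, ha, r₁, r₂⟩ := hk₁.exists_rayleigh hk₂ hmono₁ hmono₂ L j
  obtain ⟨hN, hB⟩ := hL a
  have hpos := hk₁.apply_self_pos ha
  generalize firstForm g₁ A₁ a a = N₁ at *
  generalize firstForm g₂ A₂ (L a) (L a) = N₂ at *
  generalize secondForm g₁ D₁ A₁ S₁ ν₁ a a = q₁ at *
  generalize secondForm g₂ D₂ A₂ S₂ ν₂ (L a) (L a) = q₂ at *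
  generalize (inner ℝ v (P₁ ν₁) : ℝ) = l₁ at *
  generalize (inner ℝ v (P₂ ν₂) : ℝ) = l₂ at *
  generalize k₁ j = x₁ at *
  generalize k₂ j = x₂ at *
  rw [abs_of_pos hl₁] at u₁ b₁
  rw [abs_of_pos hl₂] at u₂ b₂
  have e1 : l₂ * (x₂ * N₂) ≤ l₁ * (x₁ * N₁) + 30 * K ^ 13 * ‖v‖ ^ 2 * N₁ := by
    have := mul_le_mul_of_nonneg_left r₁ hl₁.le
    have := mul_le_mul_of_nonneg_left r₂ hl₂.le
    linarith
  -- Replacing l₂ N₂ by l₁ N₁ produces an error multiplied only by the second eigenvalue, so no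
  -- bound on the first one is needed.
  have e2 : |x₂ * (l₁ * N₁ - l₂ * N₂)| ≤ 10 * K ^ 10 * ‖v‖ ^ 2 * N₁ := by
    have d1 : l₁ * N₁ - l₂ * N₂ = (l₁ - l₂) * N₁ + l₂ * (N₁ - N₂) := by ring
    have d2 : |(l₁ - l₂) * N₁| ≤ 3 * K ^ 9 * ‖v‖ ^ 2 * N₁ := by
      rw [abs_mul, abs_of_pos hpos]; gcongr
    have d3 : |l₂ * (N₁ - N₂)| ≤ K ^ 2 * ‖v‖ * (7 * K ^ 7 * ‖v‖ * N₁) := by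
      rw [abs_mul, abs_of_pos hl₂]; gcongr
    rw [abs_mul, d1]
    calc _ ≤ K * (3 * K ^ 9 * ‖v‖ ^ 2 * N₁ + K ^ 2 * ‖v‖ * (7 * K ^ 7 * ‖v‖ * N₁)) := by
          gcongr
          exact (abs_add_le _ _).trans (add_le_add d2 d3)
      _ = _ := by ring
  have e3 := (abs_le.1 e2).2
  have e4 : l₁ * (x₂ - x₁) ≤ 40 * K ^ 13 * ‖v‖ ^ 2 := by
    have d1 : 10 * K ^ 10 * ‖v‖ ^ 2 * N₁ ≤ 10 * K ^ 13 * ‖v‖ ^ 2 * N₁ := by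
      have := hp 10 13 (by norm_num)
      gcongr
    have : N₁ * (l₁ * (x₂ - x₁)) ≤ N₁ * (40 * K ^ 13 * ‖v‖ ^ 2) := by linarith
    exact le_of_mul_le_mul_left this hpos
  -- Dividing by l₁ ≥ ‖v‖ / (2 K³) turns 40 K¹³ ‖v‖² into 80 K¹⁶ ‖v‖. The estimate uses x₂ - x₁ > 0,
  -- which the contradiction hypothesis supplies.
  by_contra hcon
  push Not at hcon
  have e5 : 0 < x₂ - x₁ := by
    have : 0 < 80 * K ^ 16 * ‖v‖ := by positivity
    linarith
  have e6 : ‖v‖ * (x₂ - x₁) ≤ ‖v‖ * (80 * K ^ 16 * ‖v‖) := by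
    calc ‖v‖ * (x₂ - x₁) ≤ 2 * K ^ 3 * l₁ * (x₂ - x₁) := by gcongr
      _ = 2 * K ^ 3 * (l₁ * (x₂ - x₁)) := by ring
      _ ≤ 2 * K ^ 3 * (40 * K ^ 13 * ‖v‖ ^ 2) := by gcongr
      _ = _ := by ring
  have := le_of_mul_le_mul_left e6 hv
  linarith

end IsMinimalPair
end SheetPairs

/-! ### Second order conditions, Taylor estimates and continuity of ordered eigenvalues. -/

section Calculus

set_option maxSynthPendingDepth 3

open Filter

/-- If c < 0, the second derivative test makes 0 a local maximum as well. Then φ is locally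
constant, which forces c = 0. -/
theorem IsLocalMin.deriv_deriv_nonneg {φ φ' : ℝ → ℝ} {c : ℝ} (hmin : IsLocalMin φ 0)
    (h1 : ∀ᶠ s in 𝓝 (0 : ℝ), HasDerivAt φ (φ' s) s) (h2 : HasDerivAt φ' c 0) :
    φ' 0 = 0 ∧ 0 ≤ c := by
  have hφ0 : φ' 0 = 0 := hmin.hasDerivAt_eq_zero h1.self_of_nhds
  refine ⟨hφ0, ?_⟩
  by_contra! hneg
  have hd : deriv φ =ᶠ[𝓝 0] φ' := h1.mono fun s hs => hs.deriv
  have hmax : IsLocalMin (-φ) 0 := by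
    apply isLocalMin_of_deriv_deriv_pos
    · have e : deriv (-φ) =ᶠ[𝓝 0] -φ' := by
        rw [deriv.neg']
        exact hd.neg
      rw [e.deriv_eq, h2.neg.deriv]
      linarith
    · rw [deriv.neg]
      simp [hd.self_of_nhds, hφ0]
    · exact h1.self_of_nhds.continuousAt.neg
  have hconst : φ =ᶠ[𝓝 0] fun _ => φ 0 := by
    filter_upwards [hmin, hmax] with s hs hs'
    simp only [Pi.neg_apply] at hs'
    linarith
  have hd0 : φ' =ᶠ[𝓝 0] fun _ => 0 := by
    refine hd.symm.trans (hconst.eventuallyEq_nhds.mono fun s hs => ?_)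
    rw [hs.deriv_eq, deriv_const]
  have := hd0.deriv_eq
  rw [h2.deriv, deriv_const] at this
  exact hneg.ne this

variable {H V E : Type*} [NormedAddCommGroup H] [NormedSpace ℝ H]
  [NormedAddCommGroup V] [NormedSpace ℝ V] [NormedAddCommGroup E] [InnerProductSpace ℝ E]

theorem hasDerivAt_line {X : Type*} [NormedAddCommGroup X] [NormedSpace ℝ X] (x a : X) (s : ℝ) :
    HasDerivAt (fun s : ℝ => x + s • a) a s := by
  simpa using ((hasDerivAt_id s).smul_const a).const_add x

theorem ContDiffAt.eventually_hasDerivAt_line {g : H → E} {x : H} (hg : ContDiffAt ℝ 2 g x)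
    (a : H) : (∀ᶠ s in 𝓝 (0 : ℝ),
      HasDerivAt (fun s : ℝ => g (x + s • a)) (fderiv ℝ g (x + s • a) a) s) ∧
      HasDerivAt (fun s : ℝ => fderiv ℝ g (x + s • a) a) (fderiv ℝ (fderiv ℝ g) x a a) 0 := by
  have hx : x + (0 : ℝ) • a = x := by simp
  constructor
  · have h1 : ∀ᶠ y in 𝓝 x, ContDiffAt ℝ 2 g y := hg.eventually (by simp)
    have h2 : Tendsto (fun s : ℝ => x + s • a) (𝓝 0) (𝓝 x) := by
      have := (hasDerivAt_line x a 0).continuousAt.tendsto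
      rwa [hx] at this
    filter_upwards [h2.eventually h1] with s hs
    exact (hs.differentiableAt (by norm_num)).hasFDerivAt.comp_hasDerivAt s (hasDerivAt_line x a s)
  · have h1 : HasFDerivAt (fderiv ℝ g) (fderiv ℝ (fderiv ℝ g) x) (x + (0 : ℝ) • a) := by
      rw [hx]
      exact ((hg.fderiv_right (m := 1) (by norm_num)).differentiableAt (by norm_num)).hasFDerivAt
    have h2 := h1.comp_hasDerivAt (0 : ℝ) (hasDerivAt_line x a 0)
    exact h2.clm_apply (hasDerivAt_const (0 : ℝ) a) |>.congr_deriv (by simp)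

/-- First and second order conditions at a pair of points minimizing the distance between two
parametrized sets. -/
theorem IsLocalMin.conditions_of_dist_sq {g₁ g₂ : H → E} {x z : H} (h₁ : ContDiffAt ℝ 2 g₁ x)
    (h₂ : ContDiffAt ℝ 2 g₂ z)
    (hmin : IsLocalMin (fun p : H × H => ‖g₁ p.1 - g₂ p.2‖ ^ 2) (x, z)) (a b : H) :
    inner ℝ (g₁ x - g₂ z) (fderiv ℝ g₁ x a - fderiv ℝ g₂ z b) = 0 ∧
    0 ≤ ‖fderiv ℝ g₁ x a - fderiv ℝ g₂ z b‖ ^ 2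
      + inner ℝ (g₁ x - g₂ z) (fderiv ℝ (fderiv ℝ g₁) x a a - fderiv ℝ (fderiv ℝ g₂) z b b) := by
  obtain ⟨d1, s1⟩ := h₁.eventually_hasDerivAt_line a
  obtain ⟨d2, s2⟩ := h₂.eventually_hasDerivAt_line b
  -- Both points move at once, in the directions a and b. The freedom to correlate b with a is what
  -- the curvature comparison exploits.
  have hline : IsLocalMin (fun s : ℝ => ‖g₁ (x + s • a) - g₂ (z + s • b)‖ ^ 2) 0 := by
    have hc : ContinuousAt (fun s : ℝ => (x + s • a, z + s • b)) 0 :=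
      (hasDerivAt_line x a 0).continuousAt.prodMk (hasDerivAt_line z b 0).continuousAt
    have hm : IsLocalMin (fun p : H × H => ‖g₁ p.1 - g₂ p.2‖ ^ 2)
        (x + (0 : ℝ) • a, z + (0 : ℝ) • b) := by simpa using hmin
    exact hc.eventually hm
  have h3 : ∀ᶠ s in 𝓝 (0 : ℝ), HasDerivAt (fun s : ℝ => ‖g₁ (x + s • a) - g₂ (z + s • b)‖ ^ 2)
      (2 * inner ℝ (g₁ (x + s • a) - g₂ (z + s • b))
        (fderiv ℝ g₁ (x + s • a) a - fderiv ℝ g₂ (z + s • b) b)) s := by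
    filter_upwards [d1, d2] with s e1 e2
    exact (e1.sub e2).norm_sq
  have h4 := (((d1.self_of_nhds.sub d2.self_of_nhds).inner ℝ (s1.sub s2))).const_mul (2 : ℝ)
  obtain ⟨r1, r2⟩ := hline.deriv_deriv_nonneg h3 h4
  simp only [zero_smul, add_zero] at r1 r2
  have r3 : ‖fderiv ℝ g₁ x a - fderiv ℝ g₂ z b‖ ^ 2
      = inner ℝ (fderiv ℝ g₁ x a - fderiv ℝ g₂ z b) (fderiv ℝ g₁ x a - fderiv ℝ g₂ z b) :=
    (real_inner_self_eq_norm_sq _).symm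
  constructor
  · linarith
  · rw [r3]
    simp only [Pi.sub_apply, zero_smul, add_zero] at r2
    linarith

theorem fderiv_fderiv_comp {X Y Z : Type*} [NormedAddCommGroup X] [NormedSpace ℝ X]
    [NormedAddCommGroup Y] [NormedSpace ℝ Y] [NormedAddCommGroup Z] [NormedSpace ℝ Z]
    {J : Y → Z} {f : X → Y} {x : X} (hJ : ContDiffAt ℝ 2 J (f x)) (hf : ContDiffAt ℝ 2 f x)
    (a b : X) :
    fderiv ℝ (fderiv ℝ (fun x => J (f x))) x a b
      = fderiv ℝ (fderiv ℝ J) (f x) (fderiv ℝ f x a) (fderiv ℝ f x b)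
        + fderiv ℝ J (f x) (fderiv ℝ (fderiv ℝ f) x a b) := by
  have hfe : ∀ᶠ y in 𝓝 x, ContDiffAt ℝ 2 f y := hf.eventually (by simp)
  have hJe : ∀ᶠ y in 𝓝 x, ContDiffAt ℝ 2 J (f y) :=
    hf.continuousAt.tendsto.eventually (hJ.eventually (by simp))
  have h1 : fderiv ℝ (fun x => J (f x)) =ᶠ[𝓝 x] fun y => (fderiv ℝ J (f y)).comp (fderiv ℝ f y) := by
    filter_upwards [hfe, hJe] with y e1 e2
    exact fderiv_comp y (e2.differentiableAt (by norm_num)) (e1.differentiableAt (by norm_num))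
  rw [h1.fderiv_eq]
  have h2 : HasFDerivAt (fderiv ℝ J) (fderiv ℝ (fderiv ℝ J) (f x)) (f x) :=
    ((hJ.fderiv_right (m := 1) (by norm_num)).differentiableAt (by norm_num)).hasFDerivAt
  have h3 : HasFDerivAt (fderiv ℝ f) (fderiv ℝ (fderiv ℝ f) x) x :=
    ((hf.fderiv_right (m := 1) (by norm_num)).differentiableAt (by norm_num)).hasFDerivAt
  have h4 := h2.comp x (hf.differentiableAt (by norm_num)).hasFDerivAt
  have h5 := h4.clm_comp h3
  have h6 : (fun y => (fderiv ℝ J (f y)).comp (fderiv ℝ f y))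
      = fun y => ((fderiv ℝ J ∘ f) y).comp (fderiv ℝ f y) := rfl
  rw [h6, h5.fderiv]
  simp [add_comm]

/-- A `C²` map whose derivative at a point is injective is bi-Lipschitz near this point, with
quadratic error in its Taylor expansion. -/
theorem ContDiffAt.eventually_antilipschitz [FiniteDimensional ℝ V] {J : V → E} {y₀ : V}
    (hJ : ContDiffAt ℝ 2 J y₀) (hinj : Function.Injective (fderiv ℝ J y₀)) :
    ∀ᶠ K : ℝ in atTop, ∀ᶠ p : V × V in 𝓝 (y₀, y₀), ‖p.1 - p.2‖ ≤ K * ‖J p.1 - J p.2‖ := by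
  obtain ⟨c, hc, hanti⟩ := (fderiv ℝ J y₀ : V →ₗ[ℝ] E).exists_antilipschitzWith
    (LinearMap.ker_eq_bot.2 hinj)
  have hc' : (0 : ℝ) < c := hc
  filter_upwards [eventually_ge_atTop (2 * c : ℝ)] with K hK
  -- The tolerance 1 / (2c) lets the linearization error be absorbed into half of the left-hand
  -- side.
  have hs := (hJ.hasStrictFDerivAt (by norm_num)).isLittleO.def
    (c := 1 / (2 * c)) (by positivity)
  filter_upwards [hs] with p hp
  have h1 : ‖p.1 - p.2‖ ≤ c * ‖fderiv ℝ J y₀ (p.1 - p.2)‖ := by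
    have := hanti.le_mul_dist p.1 p.2
    rwa [dist_eq_norm, dist_eq_norm, ← map_sub] at this
  have h2 : ‖fderiv ℝ J y₀ (p.1 - p.2)‖ ≤ ‖J p.1 - J p.2‖ + 1 / (2 * c) * ‖p.1 - p.2‖ := by
    calc _ = ‖(J p.1 - J p.2) - (J p.1 - J p.2 - fderiv ℝ J y₀ (p.1 - p.2))‖ := by
          rw [sub_sub_cancel]
      _ ≤ _ := (norm_sub_le _ _).trans (by gcongr)
  have h3 : ‖p.1 - p.2‖ ≤ c * ‖J p.1 - J p.2‖ + ‖p.1 - p.2‖ / 2 := by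
    calc _ ≤ _ := h1
      _ ≤ c * (‖J p.1 - J p.2‖ + 1 / (2 * c) * ‖p.1 - p.2‖) := by gcongr
      _ = _ := by field_simp
  have h4 : 2 * c * ‖J p.1 - J p.2‖ ≤ K * ‖J p.1 - J p.2‖ := by gcongr
  linarith

theorem ContDiffAt.eventually_norm_sub_le {X Y : Type*} [NormedAddCommGroup X] [NormedSpace ℝ X]
    [NormedAddCommGroup Y] [NormedSpace ℝ Y] {Φ : X → Y} {x₀ : X}
    (hΦ : ContDiffAt ℝ 1 Φ x₀) :
    ∀ᶠ K : ℝ in atTop, ∀ᶠ p : X × X in 𝓝 (x₀, x₀), ‖Φ p.1 - Φ p.2‖ ≤ K * ‖p.1 - p.2‖ := by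
  obtain ⟨C, t, ht, hL⟩ := hΦ.exists_lipschitzOnWith
  filter_upwards [eventually_ge_atTop (C : ℝ)] with K hK
  filter_upwards [prod_mem_nhds ht ht] with p hp
  have := hL.dist_le_mul p.1 hp.1 p.2 hp.2
  rw [dist_eq_norm, dist_eq_norm] at this
  exact this.trans (by gcongr)

/-- Mean value inequality on the segment: the derivative of J is Lipschitz near x₀, so there it
differs from its value at p.1 by at most K ‖p.1 - p.2‖. -/
theorem ContDiffAt.eventually_taylor {X Y : Type*} [NormedAddCommGroup X] [NormedSpace ℝ X]
    [NormedAddCommGroup Y] [NormedSpace ℝ Y] {J : X → Y} {x₀ : X} (hJ : ContDiffAt ℝ 2 J x₀) :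
    ∀ᶠ K : ℝ in atTop, ∀ᶠ p : X × X in 𝓝 (x₀, x₀),
      ‖J p.1 - J p.2 - fderiv ℝ J p.1 (p.1 - p.2)‖ ≤ K * ‖p.1 - p.2‖ ^ 2 := by
  have h1 := (hJ.fderiv_right (m := 1) (by norm_num)).eventually_norm_sub_le
  filter_upwards [h1, eventually_ge_atTop (0 : ℝ)] with K hK hK0
  have h2 : ∀ᶠ p : X × X in 𝓝 (x₀, x₀), ContDiffAt ℝ 2 J p.1 :=
    continuousAt_fst.eventually (hJ.eventually (by simp))
  obtain ⟨r, hr, hball⟩ := Metric.eventually_nhds_iff_ball.1 (hK.and h2)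
  filter_upwards [Metric.ball_mem_nhds (x₀, x₀) hr] with p hp
  have hp1 : p.1 ∈ Metric.ball x₀ r := by
    rw [← ball_prod_same] at hp; exact hp.1
  have hp2 : p.2 ∈ Metric.ball x₀ r := by
    rw [← ball_prod_same] at hp; exact hp.2
  have hseg : segment ℝ p.2 p.1 ⊆ Metric.ball x₀ r :=
    (convex_ball x₀ r).segment_subset hp2 hp1
  have hmem : ∀ y ∈ segment ℝ p.2 p.1, (y, p.1) ∈ Metric.ball (x₀, x₀) r := fun y hy => by
    rw [← ball_prod_same]; exact ⟨hseg hy, hp1⟩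
  have key := Convex.norm_image_sub_le_of_norm_hasFDerivWithin_le' (f := J) (C := K * ‖p.1 - p.2‖)
    (s := segment ℝ p.2 p.1) (x := p.2) (y := p.1) (f' := fun y => fderiv ℝ J y)
    (φ := fderiv ℝ J p.1)
    (fun y hy => ((hball _ (hmem y hy)).2.differentiableAt
      (by norm_num)).hasFDerivAt.hasFDerivWithinAt)
    (fun y hy => ((hball _ (hmem y hy)).1).trans (by
      have := norm_sub_le_of_mem_segment hy
      have h3 : ‖y - p.1‖ ≤ ‖p.1 - p.2‖ := by
        have hy' : y ∈ segment ℝ p.1 p.2 := by rwa [segment_symm]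
        have := norm_sub_le_of_mem_segment hy'
        rwa [norm_sub_rev p.1 p.2]
      exact mul_le_mul_of_nonneg_left h3 hK0)) (convex_segment _ _)
    (left_mem_segment ℝ _ _) (right_mem_segment ℝ _ _)
  calc _ ≤ _ := key
    _ = _ := by ring

theorem exists_coercive_of_pos [FiniteDimensional ℝ V] {g : V →L[ℝ] V →L[ℝ] ℝ}
    (hg : ∀ u, u ≠ 0 → 0 < g u u) : ∃ c : ℝ, 0 < c ∧ ∀ u, c * ‖u‖ ^ 2 ≤ g u u := by
  rcases (Metric.sphere (0 : V) 1).eq_empty_or_nonempty with hs | hs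
  · refine ⟨1, one_pos, fun u => ?_⟩
    have hu : u = 0 := by
      by_contra hu
      have : ‖u‖⁻¹ • u ∈ Metric.sphere (0 : V) 1 := by
        simp [norm_smul, norm_ne_zero_iff.2 hu]
      rw [hs] at this
      exact this
    simp [hu]
  · obtain ⟨u₀, hu₀, hmin⟩ := (isCompact_sphere (0 : V) 1).exists_isMinOn hs
      (f := fun u => g u u) (by fun_prop)
    have hu0 : u₀ ≠ 0 := by
      rintro rfl
      simp at hu₀
    refine ⟨g u₀ u₀, hg u₀ hu0, fun u => ?_⟩
    by_cases hu : u = 0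
    · simp [hu]
    · have hn : ‖u‖ ≠ 0 := norm_ne_zero_iff.2 hu
      have : ‖u‖⁻¹ • u ∈ Metric.sphere (0 : V) 1 := by simp [norm_smul, hn]
      have h2 : g u₀ u₀ ≤ g (‖u‖⁻¹ • u) (‖u‖⁻¹ • u) := hmin this
      simp only [map_smul, _root_.smul_apply, smul_eq_mul] at h2
      calc g u₀ u₀ * ‖u‖ ^ 2 ≤ (‖u‖⁻¹ * (‖u‖⁻¹ * g u u)) * ‖u‖ ^ 2 := by gcongr
        _ = g u u := by field_simp

theorem ContinuousAt.eventually_coercive [FiniteDimensional ℝ V] {X : Type*} [TopologicalSpace X]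
    {g : X → V →L[ℝ] V →L[ℝ] ℝ} {x₀ : X} (hc : ContinuousAt g x₀)
    (hg : ∀ u, u ≠ 0 → 0 < g x₀ u u) :
    ∀ᶠ K : ℝ in atTop, ∀ᶠ x in 𝓝 x₀, ∀ u, ‖u‖ ^ 2 ≤ K * g x u u := by
  obtain ⟨c, hc0, hcg⟩ := exists_coercive_of_pos hg
  filter_upwards [eventually_ge_atTop (2 / c)] with K hK
  have h1 : ∀ᶠ x in 𝓝 x₀, ‖g x - g x₀‖ < c / 2 := by
    have := Metric.tendsto_nhds.1 hc (c / 2) (by positivity)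
    simpa only [dist_eq_norm] using this
  filter_upwards [h1] with x hx u
  have h2 : |(g x - g x₀) u u| ≤ c / 2 * ‖u‖ * ‖u‖ :=
    ContinuousLinearMap.norm_apply₂_le hx.le le_rfl le_rfl
  have h3 := (abs_le.1 h2).1
  simp only [sub_apply] at h3
  have h4 : c / 2 * ‖u‖ ^ 2 ≤ g x u u := by
    have := hcg u
    nlinarith
  have h5 : 0 ≤ g x u u := le_trans (by positivity) h4
  have h6 : 0 ≤ K := le_trans (by positivity) hK
  calc ‖u‖ ^ 2 = 2 / c * (c / 2 * ‖u‖ ^ 2) := by field_simp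
    _ ≤ K * g x u u := by gcongr

/-- Ordered eigenvalues of a continuous family of forms are continuous. -/
theorem IsEigenvalueList.eventually_close {n : ℕ} {X : Type*} [TopologicalSpace X]
    [FiniteDimensional ℝ H] {g B : X → H →L[ℝ] H →L[ℝ] ℝ} {x₀ : X} (hg : ContinuousAt g x₀)
    (hB : ContinuousAt B x₀) {k₀ : Fin n → ℝ} (h₀ : IsEigenvalueList (g x₀) (B x₀) k₀)
    (hk₀ : Monotone k₀) {ρ : ℝ} (hρ : 0 < ρ) :
    ∀ᶠ x in 𝓝 x₀, ∀ k : Fin n → ℝ, Monotone k → IsEigenvalueList (g x) (B x) k →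
      ‖k - k₀‖ ≤ ρ := by
  obtain ⟨c, hc0, hcg⟩ := exists_coercive_of_pos fun u hu => h₀.apply_self_pos hu
  -- The bound 1/2 is required by `IsEigenvalueList.abs_sub_le`; the other term makes its conclusion
  -- at most ρ.
  set η : ℝ := min (1 / 2) (ρ / (2 * (1 + ‖k₀‖))) with hη
  have hk0 := norm_nonneg k₀
  have hη0 : 0 < η := by positivity
  have cl : ∀ {Φ : X → H →L[ℝ] H →L[ℝ] ℝ}, ContinuousAt Φ x₀ →
      ∀ᶠ x in 𝓝 x₀, ∀ a, |Φ x a a - Φ x₀ a a| ≤ η * g x₀ a a := by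
    intro Φ hΦ
    have h1 : ∀ᶠ x in 𝓝 x₀, ‖Φ x - Φ x₀‖ < η * c := by
      have := Metric.tendsto_nhds.1 hΦ (η * c) (by positivity)
      simpa only [dist_eq_norm] using this
    filter_upwards [h1] with x hx a
    have h2 : |(Φ x - Φ x₀) a a| ≤ η * c * ‖a‖ * ‖a‖ :=
      ContinuousLinearMap.norm_apply₂_le hx.le le_rfl le_rfl
    simp only [sub_apply] at h2
    calc _ ≤ _ := h2
      _ = η * (c * ‖a‖ ^ 2) := by ring
      _ ≤ _ := by gcongr; exact hcg a
  filter_upwards [cl hg, cl hB] with x e1 e2 k hk hlist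
  rw [pi_norm_le_iff_of_nonneg hρ.le]
  intro j
  have h3 := hlist.abs_sub_le h₀ hk hk₀ (min_le_left _ _) e1 e2 j
  have h4 : |k₀ j| ≤ ‖k₀‖ := norm_le_pi_norm k₀ j
  calc ‖(k - k₀) j‖ = |k j - k₀ j| := rfl
    _ ≤ 2 * (1 + |k₀ j|) * η := h3
    _ ≤ 2 * (1 + ‖k₀‖) * (ρ / (2 * (1 + ‖k₀‖))) := by
      gcongr
      exact min_le_right _ _
    _ = ρ := by field_simp

end Calculus

/-! ### Uniform constants for minimizing pairs near a contact. -/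

section LocalEstimate

set_option maxSynthPendingDepth 3

open Filter

variable {H V E : Type*} [NormedAddCommGroup H] [NormedSpace ℝ H]
  [NormedAddCommGroup V] [NormedSpace ℝ V] [NormedAddCommGroup E] [InnerProductSpace ℝ E]

/-- The derivative of `f` with respect to its first argument. -/
noncomputable def spaceDeriv (f : H × ℝ → V) (p : H × ℝ) : H →L[ℝ] V :=
  fderiv ℝ (fun x => f (x, p.2)) p.1

theorem ContDiffAt.spaceDeriv {f : H × ℝ → V} {p : H × ℝ} (hf : ContDiffAt ℝ ∞ f p) :
    ContDiffAt ℝ ∞ (spaceDeriv f) p := by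
  refine ContDiffAt.fderiv (f := fun (p : H × ℝ) (x : H) => f (x, p.2)) (g := Prod.fst) (n := ∞)
    ?_ contDiffAt_fst (by simp)
  exact ContDiffAt.comp (g := f) (f := fun q : (H × ℝ) × H => (q.2, q.1.2)) (p, p.1) hf
    (by fun_prop)

theorem ContDiffAt.eventually_slice {f : H × ℝ → V} {p : H × ℝ} (hf : ContDiffAt ℝ ∞ f p) :
    ∀ᶠ q in 𝓝 p, ContDiffAt ℝ 2 (fun x => f (x, q.2)) q.1 := by
  filter_upwards [(hf.of_le (ENat.LEInfty.out) :
    ContDiffAt ℝ 2 f p).eventually (by simp)] with q hq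
  exact ContDiffAt.comp (g := f) (f := fun x : H => (x, q.2)) q.1 hq (by fun_prop)

theorem ContinuousAt.eventually_norm_le {X Y : Type*} [TopologicalSpace X]
    [NormedAddCommGroup Y] {Φ : X → Y} {x₀ : X} (h : ContinuousAt Φ x₀) :
    ∀ᶠ K : ℝ in atTop, ∀ᶠ x in 𝓝 x₀, ‖Φ x‖ ≤ K := by
  filter_upwards [eventually_gt_atTop ‖Φ x₀‖] with K hK
  exact (h.norm.eventually_lt continuousAt_const hK).mono fun x hx => hx.le

/-- Near a common point of two sheets, pairs of points which locally minimize the positive distance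
of the sheets in `E` satisfy the quantitative conditions `IsMinimalPair` with a uniform constant. -/
theorem eventually_isMinimalPair [FiniteDimensional ℝ V] {f₁ f₂ : H × ℝ → V} {J : V → E}
    {G : V → V →L[ℝ] V →L[ℝ] ℝ} {x₀ z₀ : H} {t₀ : ℝ} {y₀ : V}
    (hf₁ : ContDiffAt ℝ ∞ f₁ (x₀, t₀)) (hf₂ : ContDiffAt ℝ ∞ f₂ (z₀, t₀))
    (hy₁ : f₁ (x₀, t₀) = y₀) (hy₂ : f₂ (z₀, t₀) = y₀) (hJ : ContDiffAt ℝ ∞ J y₀)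
    (hinj : Function.Injective (fderiv ℝ J y₀)) (hG : ContDiffAt ℝ ∞ G y₀)
    (hpos : ∀ u, u ≠ 0 → 0 < G y₀ u u) :
    ∀ᶠ K : ℝ in atTop, ∀ᶠ ξ : H × H × ℝ in 𝓝 (x₀, z₀, t₀), ∀ ν₁ ν₂ : V,
      IsSheet (G (f₁ (ξ.1, ξ.2.2))) (spaceDeriv f₁ (ξ.1, ξ.2.2)) ν₁ →
      IsSheet (G (f₂ (ξ.2.1, ξ.2.2))) (spaceDeriv f₂ (ξ.2.1, ξ.2.2)) ν₂ →
      J (f₁ (ξ.1, ξ.2.2)) - J (f₂ (ξ.2.1, ξ.2.2)) ≠ 0 →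
      IsLocalMin (fun p : H × H => ‖J (f₁ (p.1, ξ.2.2)) - J (f₂ (p.2, ξ.2.2))‖ ^ 2) (ξ.1, ξ.2.1) →
      IsMinimalPair K (J (f₁ (ξ.1, ξ.2.2)) - J (f₂ (ξ.2.1, ξ.2.2)))
        (fderiv ℝ J (f₁ (ξ.1, ξ.2.2))) (fderiv ℝ J (f₂ (ξ.2.1, ξ.2.2)))
        (fderiv ℝ (fderiv ℝ J) (f₁ (ξ.1, ξ.2.2))) (fderiv ℝ (fderiv ℝ J) (f₂ (ξ.2.1, ξ.2.2)))
        (G (f₁ (ξ.1, ξ.2.2))) (G (f₂ (ξ.2.1, ξ.2.2)))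
        (fderiv ℝ G (f₁ (ξ.1, ξ.2.2))) (fderiv ℝ G (f₂ (ξ.2.1, ξ.2.2)))
        (spaceDeriv f₁ (ξ.1, ξ.2.2)) (spaceDeriv f₂ (ξ.2.1, ξ.2.2))
        (spaceDeriv (spaceDeriv f₁) (ξ.1, ξ.2.2)) (spaceDeriv (spaceDeriv f₂) (ξ.2.1, ξ.2.2))
        ν₁ ν₂ := by
  have le2 : (2 : ℕ∞ω) ≤ ∞ := ENat.LEInfty.out
  have hP := hJ.fderiv_right (m := ∞) (by simp)
  have hQ := hP.fderiv_right (m := ∞) (by simp)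
  have hD := hG.fderiv_right (m := ∞) (by simp)
  have le1 : (1 : ℕ∞ω) ≤ ∞ := ENat.LEInfty.out
  obtain ⟨K₁, hanti, htay, lP, lQ, lG, lD, bP, bQ, bG, bD, hco, hK₁⟩ :=
    ((hJ.of_le le2).eventually_antilipschitz hinj |>.and <|
      (hJ.of_le le2).eventually_taylor.and <| (hP.of_le le1).eventually_norm_sub_le.and <|
      (hQ.of_le le1).eventually_norm_sub_le.and <| (hG.of_le le1).eventually_norm_sub_le.and <|
      (hD.of_le le1).eventually_norm_sub_le.and <|
      hP.continuousAt.eventually_norm_le.and <| hQ.continuousAt.eventually_norm_le.and <|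
      hG.continuousAt.eventually_norm_le.and <| hD.continuousAt.eventually_norm_le.and <|
      (hG.continuousAt.eventually_coercive hpos).and (eventually_ge_atTop 1)).exists
  have hK0 : 0 ≤ K₁ := by linarith
  -- Distances in V are converted into ‖v‖ at the cost of a factor K₁. Lipschitz bounds therefore
  -- need K₁², and the quadratic Taylor bound needs K₁ · K₁².
  filter_upwards [eventually_ge_atTop (K₁ ^ 3)] with K hK
  have hKK₁ : K₁ ≤ K := (le_self_pow₀ hK₁ (by norm_num)).trans hK
  have hKK₂ : K₁ * K₁ ≤ K := by nlinarith
  have c₁ : ContinuousAt (fun ξ : H × H × ℝ => (ξ.1, ξ.2.2)) (x₀, z₀, t₀) := by fun_prop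
  have c₂ : ContinuousAt (fun ξ : H × H × ℝ => (ξ.2.1, ξ.2.2)) (x₀, z₀, t₀) := by fun_prop
  have d₁ : ContinuousAt (fun ξ : H × H × ℝ => f₁ (ξ.1, ξ.2.2)) (x₀, z₀, t₀) :=
    ContinuousAt.comp (g := f₁) (f := fun ξ : H × H × ℝ => (ξ.1, ξ.2.2)) hf₁.continuousAt c₁
  have d₂ : ContinuousAt (fun ξ : H × H × ℝ => f₂ (ξ.2.1, ξ.2.2)) (x₀, z₀, t₀) :=
    ContinuousAt.comp (g := f₂) (f := fun ξ : H × H × ℝ => (ξ.2.1, ξ.2.2)) hf₂.continuousAt c₂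
  have t₁ : Tendsto (fun ξ : H × H × ℝ => f₁ (ξ.1, ξ.2.2)) (𝓝 (x₀, z₀, t₀)) (𝓝 y₀) := by
    have := d₁.tendsto; rwa [hy₁] at this
  have t₂ : Tendsto (fun ξ : H × H × ℝ => f₂ (ξ.2.1, ξ.2.2)) (𝓝 (x₀, z₀, t₀)) (𝓝 y₀) := by
    have := d₂.tendsto; rwa [hy₂] at this
  have t₁₂ : Tendsto (fun ξ : H × H × ℝ => (f₁ (ξ.1, ξ.2.2), f₂ (ξ.2.1, ξ.2.2)))
      (𝓝 (x₀, z₀, t₀)) (𝓝 (y₀, y₀)) := by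
    exact t₁.prodMk_nhds t₂
  have t₂₁ : Tendsto (fun ξ : H × H × ℝ => (f₂ (ξ.2.1, ξ.2.2), f₁ (ξ.1, ξ.2.2)))
      (𝓝 (x₀, z₀, t₀)) (𝓝 (y₀, y₀)) := by
    exact t₂.prodMk_nhds t₁
  have tv : Tendsto (fun ξ : H × H × ℝ => ‖J (f₁ (ξ.1, ξ.2.2)) - J (f₂ (ξ.2.1, ξ.2.2))‖)
      (𝓝 (x₀, z₀, t₀)) (𝓝 0) := by
    have := ((hJ.continuousAt.tendsto.comp t₁).sub (hJ.continuousAt.tendsto.comp t₂)).norm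
    simpa using this
  have hKpos : 0 < K := by linarith
  have hsmall : ∀ᶠ ξ : H × H × ℝ in 𝓝 (x₀, z₀, t₀),
      ‖J (f₁ (ξ.1, ξ.2.2)) - J (f₂ (ξ.2.1, ξ.2.2))‖ < 1 / (28 * K ^ 7) :=
    tv.eventually_lt_const (by positivity)
  have hJ2 : ∀ᶠ y in 𝓝 y₀, ContDiffAt ℝ 2 J y := (hJ.of_le le2).eventually (by simp)
  filter_upwards [t₁₂.eventually hanti, t₁₂.eventually htay, t₂₁.eventually htay,
    t₁₂.eventually lP, t₁₂.eventually lQ, t₁₂.eventually lG, t₁₂.eventually lD,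
    t₁.eventually bP, t₂.eventually bP, t₂.eventually bQ, t₁.eventually bG, t₂.eventually bG,
    t₂.eventually bD, t₁.eventually hco, t₂.eventually hco, hsmall, t₁.eventually hJ2,
    t₂.eventually hJ2, c₁.eventually hf₁.eventually_slice, c₂.eventually hf₂.eventually_slice]
    with ξ e1 e2 e3 e4 e5 e6 e7 e8 e9 e10 e11 e12 e13 e14 e15 e16 e17 e18 e19 e20 ν₁ ν₂ s₁ s₂ hv hmin
  obtain ⟨x, z, t⟩ := ξ
  simp only at *
  have hcomp₁ : ContDiffAt ℝ 2 (fun x => J (f₁ (x, t))) x :=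
    ContDiffAt.comp (g := J) (f := fun x => f₁ (x, t)) x e17 e19
  have hcomp₂ : ContDiffAt ℝ 2 (fun z => J (f₂ (z, t))) z :=
    ContDiffAt.comp (g := J) (f := fun z => f₂ (z, t)) z e18 e20
  have hfd₁ : ∀ a, fderiv ℝ (fun x => J (f₁ (x, t))) x a
      = fderiv ℝ J (f₁ (x, t)) (spaceDeriv f₁ (x, t) a) := fun a => by
    rw [fderiv_fun_comp x (e17.differentiableAt (by norm_num)) (e19.differentiableAt (by norm_num))]
    rfl
  have hfd₂ : ∀ a, fderiv ℝ (fun z => J (f₂ (z, t))) z a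
      = fderiv ℝ J (f₂ (z, t)) (spaceDeriv f₂ (z, t) a) := fun a => by
    rw [fderiv_fun_comp z (e18.differentiableAt (by norm_num)) (e20.differentiableAt (by norm_num))]
    rfl
  have hcond := fun a b => hmin.conditions_of_dist_sq hcomp₁ hcomp₂ a b
  have hlip : ∀ {r : ℝ}, r ≤ K₁ * ‖f₁ (x, t) - f₂ (z, t)‖ →
      r ≤ K * ‖J (f₁ (x, t)) - J (f₂ (z, t))‖ := fun hr => by
    calc _ ≤ _ := hr
      _ ≤ K₁ * (K₁ * ‖J (f₁ (x, t)) - J (f₂ (z, t))‖) := by gcongr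
      _ = K₁ * K₁ * ‖J (f₁ (x, t)) - J (f₂ (z, t))‖ := by ring
      _ ≤ _ := by gcongr
  have hquad : ∀ {r : ℝ}, r ≤ K₁ * ‖f₁ (x, t) - f₂ (z, t)‖ ^ 2 →
      r ≤ K * ‖J (f₁ (x, t)) - J (f₂ (z, t))‖ ^ 2 := fun hr => by
    calc _ ≤ _ := hr
      _ ≤ K₁ * (K₁ * ‖J (f₁ (x, t)) - J (f₂ (z, t))‖) ^ 2 := by gcongr
      _ = K₁ ^ 3 * ‖J (f₁ (x, t)) - J (f₂ (z, t))‖ ^ 2 := by ring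
      _ ≤ _ := by gcongr
  have hco' : ∀ {g : V →L[ℝ] V →L[ℝ] ℝ}, (∀ u, ‖u‖ ^ 2 ≤ K₁ * g u u) → ∀ u, ‖u‖ ^ 2 ≤ K * g u u := by
    intro g hg u
    have h1 := hg u
    have h2 : 0 ≤ g u u := by
      by_contra! h2
      nlinarith [sq_nonneg ‖u‖]
    exact h1.trans (by gcongr)
  constructor
  · linarith
  · exact norm_pos_iff.2 hv
  · rw [lt_div_iff₀ (by positivity)] at e16
    linarith
  · exact s₁
  · exact s₂
  · exact hco' e14
  · exact hco' e15
  · exact e8.trans hKK₁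
  · exact e9.trans hKK₁
  · exact hlip e4
  · exact e10.trans hKK₁
  · exact hlip e5
  · exact e11.trans hKK₁
  · exact e12.trans hKK₁
  · exact hlip e6
  · exact e13.trans hKK₁
  · exact hlip e7
  · intro a
    have := (hcond a 0).1
    rwa [map_zero, sub_zero, hfd₁] at this
  · intro b
    have := (hcond 0 b).1
    rwa [map_zero, zero_sub, inner_neg_right, neg_eq_zero, hfd₂] at this
  -- The chord is the coordinate difference of the two points; Taylor's formula is used once at each
  -- endpoint.
  · refine ⟨f₁ (x, t) - f₂ (z, t), ?_, hquad e2, hquad ?_⟩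
    · exact e1.trans (by gcongr)
    · rw [norm_sub_rev (f₂ (z, t))] at e3
      convert e3 using 1
      rw [← norm_neg, ← neg_sub (f₁ (x, t)), map_neg]
      congr 1
      abel
  · intro a b
    have := (hcond a b).2
    rw [hfd₁, hfd₂, fderiv_fderiv_comp (f := fun x => f₁ (x, t)) e17 e19,
      fderiv_fderiv_comp (f := fun z => f₂ (z, t)) e18 e20] at this
    exact this

end LocalEstimate

/-! ### From ordered curvatures to ordered speeds. -/

section CurvatureEstimate

set_option maxSynthPendingDepth 3

open Filter

variable {H V E : Type*} [NormedAddCommGroup H] [NormedSpace ℝ H]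
  [NormedAddCommGroup V] [NormedSpace ℝ V] [NormedAddCommGroup E] [InnerProductSpace ℝ E]

theorem ContinuousAt.firstForm {X : Type*} [TopologicalSpace X] [FiniteDimensional ℝ H]
    {g : X → V →L[ℝ] V →L[ℝ] ℝ} {A : X → H →L[ℝ] V} {x : X}
    (hg : ContinuousAt g x) (hA : ContinuousAt A x) :
    ContinuousAt (fun x => firstForm (g x) (A x)) x := by
  refine continuousAt_clm_apply.2 fun a => continuousAt_clm_apply.2 fun b => ?_
  simp only [firstForm_apply]
  fun_prop

theorem ContinuousAt.secondForm {X : Type*} [TopologicalSpace X] [FiniteDimensional ℝ H]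
    {g : X → V →L[ℝ] V →L[ℝ] ℝ} {D : X → V →L[ℝ] V →L[ℝ] V →L[ℝ] ℝ}
    {A : X → H →L[ℝ] V} {S : X → H →L[ℝ] H →L[ℝ] V} {ν : X → V} {x : X}
    (hg : ContinuousAt g x) (hD : ContinuousAt D x) (hA : ContinuousAt A x) (hS : ContinuousAt S x)
    (hν : ContinuousAt ν x) :
    ContinuousAt (fun x => secondForm (g x) (D x) (A x) (S x) (ν x)) x := by
  refine continuousAt_clm_apply.2 fun a => continuousAt_clm_apply.2 fun b => ?_
  simp only [secondForm_apply, christoffelForm_apply]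
  fun_prop

variable {n : ℕ} {Γ : Set (Fin n → ℝ)} {W : (Fin n → ℝ) → ℝ}

theorem IsWeingartenFunction.exists_local_lipschitz (hW : IsWeingartenFunction Γ W)
    {k₀ : Fin n → ℝ} (hk₀ : k₀ ∈ Γ) :
    ∃ r C : ℝ, 0 < r ∧ 0 ≤ C ∧ Metric.closedBall k₀ r ⊆ Γ ∧
      ∀ k ∈ Metric.closedBall k₀ r, ∀ k' ∈ Metric.closedBall k₀ r, |W k - W k'| ≤ C * ‖k - k'‖ := by
  have hc : ContDiffAt ℝ 1 W k₀ :=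
    (hW.smooth.contDiffAt (hW.isOpen.mem_nhds hk₀)).of_le ENat.LEInfty.out
  obtain ⟨C, t, ht, hL⟩ := hc.exists_lipschitzOnWith
  obtain ⟨r, hr, hsub⟩ := Metric.nhds_basis_closedBall.mem_iff.1
    (inter_mem (hW.isOpen.mem_nhds hk₀) ht)
  refine ⟨r, C, hr, C.2, hsub.trans inter_subset_left, fun k hk k' hk' => ?_⟩
  have := hL.dist_le_mul k (hsub hk).2 k' (hsub hk').2
  rwa [dist_eq_norm, dist_eq_norm] at this

/-- In the metric `G`, the sheet parametrized by `f` at time `p.2` has at `p.1` the unit normal `ν`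
and the principal curvatures `k`. -/
structure HasCurvatures (G : V → V →L[ℝ] V →L[ℝ] ℝ) (f : H × ℝ → V) (p : H × ℝ) (ν : V)
    (k : Fin n → ℝ) : Prop where
  sheet : IsSheet (G (f p)) (spaceDeriv f p) ν
  list : IsEigenvalueList (firstForm (G (f p)) (spaceDeriv f p))
    (secondForm (G (f p)) (fderiv ℝ G (f p)) (spaceDeriv f p) (spaceDeriv (spaceDeriv f) p) ν) k

theorem HasCurvatures.neg {G : V → V →L[ℝ] V →L[ℝ] ℝ} {f : H × ℝ → V} {p : H × ℝ} {ν : V}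
    {k : Fin n → ℝ} (h : HasCurvatures G f p ν k) : HasCurvatures G f p (-ν) (-k) :=
  ⟨h.sheet.neg, by rw [secondForm_neg]; exact h.list.neg⟩

/-- The right-hand side of the evolution equation of the distance of two sheets is bounded below,
for normals that point from the second sheet to the first. -/
theorem eventually_speed_comparison_of_pos [FiniteDimensional ℝ V] [FiniteDimensional ℝ H]
    (hdim : Module.finrank ℝ V = Module.finrank ℝ H + 1) (hW : IsWeingartenFunction Γ W)
    {f₁ f₂ : H × ℝ → V} {J : V → E}
    {G : V → V →L[ℝ] V →L[ℝ] ℝ} {x₀ z₀ : H} {t₀ : ℝ} {y₀ : V}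
    (hf₁ : ContDiffAt ℝ ∞ f₁ (x₀, t₀)) (hf₂ : ContDiffAt ℝ ∞ f₂ (z₀, t₀))
    (hy₁ : f₁ (x₀, t₀) = y₀) (hy₂ : f₂ (z₀, t₀) = y₀) (hJ : ContDiffAt ℝ ∞ J y₀)
    (hinj : Function.Injective (fderiv ℝ J y₀)) (hG : ContDiffAt ℝ ∞ G y₀)
    (hpos : ∀ u, u ≠ 0 → 0 < G y₀ u u) {ν : H × ℝ → V} (hν : ContinuousAt ν (z₀, t₀))
    {k₀ : Fin n → ℝ} (hk₀ : k₀ ∈ Γ)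
    (hlist : HasCurvatures G f₂ (z₀, t₀) (ν (z₀, t₀)) k₀) :
    ∀ᶠ C : ℝ in atTop, ∀ᶠ ξ : H × H × ℝ in 𝓝 (x₀, z₀, t₀), ∀ (ν₁ : V) (k₁ k₂ : Fin n → ℝ),
      k₁ ∈ Γ → k₂ ∈ Γ →
      HasCurvatures G f₁ (ξ.1, ξ.2.2) ν₁ k₁ →
      HasCurvatures G f₂ (ξ.2.1, ξ.2.2) (ν (ξ.2.1, ξ.2.2)) k₂ →
      J (f₁ (ξ.1, ξ.2.2)) - J (f₂ (ξ.2.1, ξ.2.2)) ≠ 0 →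
      IsLocalMin (fun p : H × H => ‖J (f₁ (p.1, ξ.2.2)) - J (f₂ (p.2, ξ.2.2))‖ ^ 2) (ξ.1, ξ.2.1) →
      0 < (inner ℝ (J (f₁ (ξ.1, ξ.2.2)) - J (f₂ (ξ.2.1, ξ.2.2)))
        (fderiv ℝ J (f₁ (ξ.1, ξ.2.2)) ν₁) : ℝ) →
      0 < (inner ℝ (J (f₁ (ξ.1, ξ.2.2)) - J (f₂ (ξ.2.1, ξ.2.2)))
        (fderiv ℝ J (f₂ (ξ.2.1, ξ.2.2)) (ν (ξ.2.1, ξ.2.2))) : ℝ) →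
      -C * ‖J (f₁ (ξ.1, ξ.2.2)) - J (f₂ (ξ.2.1, ξ.2.2))‖ ^ 2 ≤
        W k₁ * inner ℝ (J (f₁ (ξ.1, ξ.2.2)) - J (f₂ (ξ.2.1, ξ.2.2)))
          (fderiv ℝ J (f₁ (ξ.1, ξ.2.2)) ν₁) -
        W k₂ * inner ℝ (J (f₁ (ξ.1, ξ.2.2)) - J (f₂ (ξ.2.1, ξ.2.2)))
          (fderiv ℝ J (f₂ (ξ.2.1, ξ.2.2)) (ν (ξ.2.1, ξ.2.2))) := by
  -- Only sorted lists can be compared entry by entry; symmetry of W makes sorting harmless.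
  set κ₀ := k₀ ∘ Tuple.sort k₀ with hκ₀
  have hκ₀Γ : κ₀ ∈ Γ := hW.perm_mem _ _ hk₀
  obtain ⟨r, c, hr, hc, hball, hLip⟩ := hW.exists_local_lipschitz hκ₀Γ
  obtain ⟨K, hmp, hK1, hKk, hKW⟩ := ((eventually_isMinimalPair hf₁ hf₂ hy₁ hy₂ hJ hinj hG
    hpos).and <| (eventually_ge_atTop 1).and <| (eventually_ge_atTop (‖κ₀‖ + r)).and
    (eventually_ge_atTop (|W κ₀| + c * r))).exists
  have hK0 : 0 < K := by linarith
  -- The first summand is the Lipschitz loss c δ with δ = 80 K¹⁶ ‖v‖, multiplied by a₁ ≤ K² ‖v‖. The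
  -- second is |W κ₂| ≤ K times |a₁ - a₂| ≤ 3 K⁹ ‖v‖².
  filter_upwards [eventually_ge_atTop (K ^ 2 * (c * (80 * K ^ 16)) + 3 * K ^ 9 * K)] with C hC
  have hfc : ContinuousAt f₂ (z₀, t₀) := hf₂.continuousAt
  have hG2 : ContinuousAt G (f₂ (z₀, t₀)) := by rw [hy₂]; exact hG.continuousAt
  have hD2 : ContinuousAt (fderiv ℝ G) (f₂ (z₀, t₀)) := by
    rw [hy₂]; exact (hG.fderiv_right (m := ∞) (by simp)).continuousAt
  have hA := hf₂.spaceDeriv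
  -- The radius r/2 leaves room for the later downward shift by δ ≤ r/2.
  have hclose := IsEigenvalueList.eventually_close
    (ContinuousAt.firstForm (hG2.comp hfc) hA.continuousAt)
    (ContinuousAt.secondForm (hG2.comp hfc) (hD2.comp hfc) hA.continuousAt
      hA.spaceDeriv.continuousAt hν) (k₀ := κ₀)
    (hlist.list.comp_perm (Tuple.sort k₀))
    (Tuple.monotone_sort k₀) (half_pos hr)
  have c₂ : ContinuousAt (fun ξ : H × H × ℝ => (ξ.2.1, ξ.2.2)) (x₀, z₀, t₀) := by fun_prop
  have d₁ : ContinuousAt (fun ξ : H × H × ℝ => f₁ (ξ.1, ξ.2.2)) (x₀, z₀, t₀) :=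
    ContinuousAt.comp (g := f₁) (f := fun ξ : H × H × ℝ => (ξ.1, ξ.2.2)) hf₁.continuousAt
      (by fun_prop)
  have d₂ : ContinuousAt (fun ξ : H × H × ℝ => f₂ (ξ.2.1, ξ.2.2)) (x₀, z₀, t₀) :=
    ContinuousAt.comp (g := f₂) (f := fun ξ : H × H × ℝ => (ξ.2.1, ξ.2.2)) hfc c₂
  have tv : Tendsto (fun ξ : H × H × ℝ => ‖J (f₁ (ξ.1, ξ.2.2)) - J (f₂ (ξ.2.1, ξ.2.2))‖)
      (𝓝 (x₀, z₀, t₀)) (𝓝 0) := by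
    have t₁ := d₁.tendsto
    have t₂ := d₂.tendsto
    simp only [hy₁, hy₂] at t₁ t₂
    have := ((hJ.continuousAt.tendsto.comp t₁).sub (hJ.continuousAt.tendsto.comp t₂)).norm
    simpa using this
  have hsmall : ∀ᶠ ξ : H × H × ℝ in 𝓝 (x₀, z₀, t₀),
      ‖J (f₁ (ξ.1, ξ.2.2)) - J (f₂ (ξ.2.1, ξ.2.2))‖ < r / 2 / (80 * K ^ 16) :=
    tv.eventually_lt_const (by positivity)
  filter_upwards [hmp, c₂.eventually hclose, hsmall]
    with ξ e1 e2 e3 ν₁ k₁ k₂ hk₁ hk₂ ⟨s₁, l₁⟩ ⟨s₂, l₂⟩ hv hmin p₁ p₂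
  obtain ⟨x, z, t⟩ := ξ
  simp only [Function.comp_apply] at *
  have h := e1 ν₁ (ν (z, t)) s₁ s₂ hv hmin
  set v := J (f₁ (x, t)) - J (f₂ (z, t))
  have hmono₁ := Tuple.monotone_sort k₁
  have hmono₂ := Tuple.monotone_sort k₂
  have hl₁ := l₁.comp_perm (Tuple.sort k₁)
  have hl₂ := l₂.comp_perm (Tuple.sort k₂)
  have hκ₂ := e2 _ hmono₂ hl₂
  rw [← hW.symmetric (Tuple.sort k₁) k₁ hk₁, ← hW.symmetric (Tuple.sort k₂) k₂ hk₂]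
  have hκ₁Γ := hW.perm_mem (Tuple.sort k₁) k₁ hk₁
  set κ₁ := k₁ ∘ Tuple.sort k₁
  set κ₂ := k₂ ∘ Tuple.sort k₂
  have hκ₂b : κ₂ ∈ Metric.closedBall κ₀ r := by
    rw [mem_closedBall_iff_norm]; linarith
  set δ : ℝ := 80 * K ^ 16 * ‖v‖ with hδ
  have hδ0 : 0 ≤ δ := by positivity
  have hδr : δ ≤ r / 2 := by
    rw [lt_div_iff₀ (by positivity)] at e3
    linarith
  have hκ₂K : ∀ j, |κ₂ j| ≤ K := fun j => by
    have h1 : |κ₂ j| ≤ ‖κ₂‖ := norm_le_pi_norm κ₂ j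
    have h2 : ‖κ₂‖ ≤ ‖κ₂ - κ₀‖ + ‖κ₀‖ := by
      calc ‖κ₂‖ = ‖(κ₂ - κ₀) + κ₀‖ := by rw [sub_add_cancel]
        _ ≤ _ := norm_add_le _ _
    linarith
  set τ : Fin n → ℝ := fun _ => δ with hτ
  have hτn : ‖τ‖ ≤ δ := by
    rw [pi_norm_le_iff_of_nonneg hδ0]
    intro j
    rw [hτ, Real.norm_of_nonneg hδ0]
  have hord : κ₂ - τ ≤ κ₁ := fun j =>
    h.eigenvalue_comparison hdim p₁ p₂ hl₁ hl₂ hmono₁ hmono₂ (hκ₂K j)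
  have hshift : κ₂ - τ ∈ Metric.closedBall κ₀ r := by
    rw [mem_closedBall_iff_norm]
    calc ‖κ₂ - τ - κ₀‖ = ‖(κ₂ - κ₀) - τ‖ := by congr 1; abel
      _ ≤ ‖κ₂ - κ₀‖ + ‖τ‖ := norm_sub_le _ _
      _ ≤ r := by linarith
  -- The list κ₁ may be far from κ₀, where no Lipschitz bound is known. The Lipschitz bound is used
  -- only between κ₂ and its shift, both in the ball; monotonicity on Γ does the rest.
  have hW₁ : W κ₂ - c * δ ≤ W κ₁ := by
    have h1 := hW.monotone (hball hshift) hκ₁Γ hord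
    have h2 := (abs_le.1 (hLip κ₂ hκ₂b _ hshift)).2
    rw [sub_sub_cancel] at h2
    have h3 : c * ‖τ‖ ≤ c * δ := by gcongr
    linarith
  have hW₂ : |W κ₂| ≤ K := by
    have h1 := hLip κ₂ hκ₂b κ₀ (Metric.mem_closedBall_self hr.le)
    have h2 : |W κ₂| ≤ |W κ₂ - W κ₀| + |W κ₀| := by
      calc |W κ₂| = |(W κ₂ - W κ₀) + W κ₀| := by rw [sub_add_cancel]
        _ ≤ _ := abs_add_le _ _
    have h3 : c * ‖κ₂ - κ₀‖ ≤ c * r := by gcongr; linarith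
    linarith
  obtain ⟨-, hll⟩ := h.normals_close hdim p₁ p₂
  obtain ⟨d, hd, hd₁, -⟩ := h.chord
  have hu₁ := (IsMinimalPair.covector_bounds hdim h.sheet₁ h.one_le h.pos (by
    have : K ≤ K ^ 7 := le_self_pow₀ hK1 (by norm_num)
    have := h.small
    have := h.pos
    nlinarith) h.coercive₁ h.norm_P₁ h.norm_g₁ h.critical₁ hd hd₁).2.1
  generalize (inner ℝ v (fderiv ℝ J (f₁ (x, t)) ν₁) : ℝ) = a₁ at *
  generalize (inner ℝ v (fderiv ℝ J (f₂ (z, t)) (ν (z, t))) : ℝ) = a₂ at *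
  rw [abs_of_pos p₁] at hu₁
  have q1 : a₁ * (W κ₂ - c * δ) ≤ a₁ * W κ₁ := by gcongr
  have q2 : a₁ * (c * δ) ≤ K ^ 2 * ‖v‖ * (c * δ) := by gcongr
  have q3 : |W κ₂ * (a₁ - a₂)| ≤ K * (3 * K ^ 9 * ‖v‖ ^ 2) := by
    rw [abs_mul]; gcongr
  have q4 := (abs_le.1 q3).1
  have q5 : (K ^ 2 * (c * (80 * K ^ 16)) + 3 * K ^ 9 * K) * ‖v‖ ^ 2 ≤ C * ‖v‖ ^ 2 := by gcongr
  rw [hδ] at q1 q2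
  linarith

/-- The right-hand side of the evolution equation of the distance of two sheets is bounded below,
if the speed is an odd Weingarten function. -/
theorem exists_eventually_speed_comparison [FiniteDimensional ℝ V] [FiniteDimensional ℝ H]
    (hdim : Module.finrank ℝ V = Module.finrank ℝ H + 1) (hW : IsWeingartenFunction Γ W)
    (hneg : ∀ k ∈ Γ, -k ∈ Γ) (hodd : ∀ k ∈ Γ, W (-k) = -W k)
    {f₁ f₂ : H × ℝ → V} {J : V → E}
    {G : V → V →L[ℝ] V →L[ℝ] ℝ} {x₀ z₀ : H} {t₀ : ℝ} {y₀ : V}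
    (hf₁ : ContDiffAt ℝ ∞ f₁ (x₀, t₀)) (hf₂ : ContDiffAt ℝ ∞ f₂ (z₀, t₀))
    (hy₁ : f₁ (x₀, t₀) = y₀) (hy₂ : f₂ (z₀, t₀) = y₀) (hJ : ContDiffAt ℝ ∞ J y₀)
    (hinj : Function.Injective (fderiv ℝ J y₀)) (hG : ContDiffAt ℝ ∞ G y₀)
    (hpos : ∀ u, u ≠ 0 → 0 < G y₀ u u) {ν : H × ℝ → V} (hν : ContinuousAt ν (z₀, t₀))
    {k₀ : Fin n → ℝ} (hk₀ : k₀ ∈ Γ)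
    (hlist : HasCurvatures G f₂ (z₀, t₀) (ν (z₀, t₀)) k₀) :
    ∃ C : ℝ, ∀ᶠ ξ : H × H × ℝ in 𝓝 (x₀, z₀, t₀), ∀ (ν₁ : V) (k₁ k₂ : Fin n → ℝ),
      k₁ ∈ Γ → k₂ ∈ Γ → HasCurvatures G f₁ (ξ.1, ξ.2.2) ν₁ k₁ →
      HasCurvatures G f₂ (ξ.2.1, ξ.2.2) (ν (ξ.2.1, ξ.2.2)) k₂ →
      J (f₁ (ξ.1, ξ.2.2)) - J (f₂ (ξ.2.1, ξ.2.2)) ≠ 0 →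
      IsLocalMin (fun p : H × H => ‖J (f₁ (p.1, ξ.2.2)) - J (f₂ (p.2, ξ.2.2))‖ ^ 2) (ξ.1, ξ.2.1) →
      -C * ‖J (f₁ (ξ.1, ξ.2.2)) - J (f₂ (ξ.2.1, ξ.2.2))‖ ^ 2 ≤
        inner ℝ (J (f₁ (ξ.1, ξ.2.2)) - J (f₂ (ξ.2.1, ξ.2.2)))
          (fderiv ℝ J (f₁ (ξ.1, ξ.2.2)) (W k₁ • ν₁) -
            fderiv ℝ J (f₂ (ξ.2.1, ξ.2.2)) (W k₂ • ν (ξ.2.1, ξ.2.2))) := by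
  -- One constant serves both orientations of the second sheet, hence both data (ν, k₀) and (-ν,
  -- -k₀).
  obtain ⟨C, hC₁, hC₂⟩ := ((eventually_speed_comparison_of_pos hdim hW hf₁ hf₂ hy₁ hy₂ hJ
    hinj hG hpos hν hk₀ hlist).and (eventually_speed_comparison_of_pos hdim hW hf₁ hf₂ hy₁ hy₂ hJ
    hinj hG hpos hν.neg (hneg k₀ hk₀) hlist.neg)).exists
  obtain ⟨K, hK⟩ := (eventually_isMinimalPair hf₁ hf₂ hy₁ hy₂ hJ hinj hG hpos).exists
  refine ⟨C, ?_⟩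
  filter_upwards [hC₁, hC₂, hK] with ξ e1 e2 e3 ν₁ k₁ k₂ hk₁ hk₂ h₁ h₂ hv hmin
  obtain ⟨x, z, t⟩ := ξ
  simp only at *
  have h := e3 ν₁ (ν (z, t)) h₁.sheet h₂.sheet hv hmin
  obtain ⟨d, hd, hd₁, hd₂⟩ := h.chord
  have hsmall : 2 * K * ‖J (f₁ (x, t)) - J (f₂ (z, t))‖ ≤ 1 := by
    have h1 := h.one_le
    have : K ≤ K ^ 7 := le_self_pow₀ h1 (by norm_num)
    have := h.small
    have := h.pos
    nlinarith
  have b₁ := (IsMinimalPair.covector_bounds hdim h.sheet₁ h.one_le h.pos hsmall h.coercive₁ h.norm_P₁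
    h.norm_g₁ h.critical₁ hd hd₁).2.2
  have b₂ := (IsMinimalPair.covector_bounds hdim h.sheet₂ h.one_le h.pos hsmall h.coercive₂ h.norm_P₂
    h.norm_g₂ h.critical₂ hd hd₂).2.2
  have hvpos := h.pos
  -- These products are nonzero because ‖v‖ is bounded by a multiple of their absolute values; so
  -- each normal has a definite side.
  have ne₁ : (inner ℝ (J (f₁ (x, t)) - J (f₂ (z, t))) (fderiv ℝ J (f₁ (x, t)) ν₁) : ℝ) ≠ 0 :=
    fun h0 => by rw [h0] at b₁; simp at b₁; exact hv b₁
  have ne₂ : (inner ℝ (J (f₁ (x, t)) - J (f₂ (z, t))) (fderiv ℝ J (f₂ (z, t)) (ν (z, t))) : ℝ) ≠ 0 :=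
    fun h0 => by rw [h0] at b₂; simp at b₂; exact hv b₂
  rw [map_smul, map_smul, inner_sub_right, inner_smul_right, inner_smul_right]
  -- Four choices of orientation. Reversing a normal changes the sign of its curvatures and, by
  -- oddness, of its speed, so the quantity to be bounded is the same in all four.
  have r1 := e1 ν₁ k₁ k₂ hk₁ hk₂ h₁ h₂ hv hmin
  have r2 := e1 (-ν₁) (-k₁) k₂ (hneg _ hk₁) hk₂ h₁.neg h₂ hv hmin
  have r3 := e2 ν₁ k₁ (-k₂) hk₁ (hneg _ hk₂) h₁ h₂.neg hv hmin
  have r4 := e2 (-ν₁) (-k₁) (-k₂) (hneg _ hk₁) (hneg _ hk₂) h₁.neg h₂.neg hv hmin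
  simp only [Pi.neg_apply, map_neg, inner_neg_right, hodd _ hk₁, hodd _ hk₂, neg_mul_neg,
    Left.neg_pos_iff] at r1 r2 r3 r4
  rcases ne₁.lt_or_gt with p₁ | p₁ <;> rcases ne₂.lt_or_gt with p₂ | p₂
  · exact r4 p₁ p₂
  · exact r2 p₁ p₂
  · exact r3 p₁ p₂
  · exact r1 p₁ p₂

end CurvatureEstimate

/-! ### A minimum principle with exponential weight. -/

section MinimumPrinciple

open Filter

/-- A minimum principle: if the minimum over the compact set `Z` of a positive function `h · t`
decreases at most exponentially as long as it is small, then it does not reach zero. -/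
theorem IsCompact.ne_zero_of_deriv_ge {X : Type*} [TopologicalSpace X] {Z : Set X}
    (hZ : IsCompact Z) {h : X → ℝ → ℝ} {a t₀ : ℝ} (hat : a < t₀)
    (hc : ContinuousOn (fun q : X × ℝ => h q.1 q.2) (Z ×ˢ Icc a t₀))
    (hpos : ∀ x ∈ Z, ∀ t ∈ Ico a t₀, 0 < h x t)
    (hmin : ∀ x ∈ Z, h x t₀ = 0 → ∃ C : ℝ, ∀ᶠ q : X × ℝ in 𝓝 (x, t₀), q.2 < t₀ → q.1 ∈ Z →
      IsMinOn (fun y => h y q.2) Z q.1 → ∃ d, HasDerivAt (h q.1) d q.2 ∧ -C * h q.1 q.2 ≤ d)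
    {x₀ : X} (hx₀ : x₀ ∈ Z) : h x₀ t₀ ≠ 0 := by
  intro hzero
  have hnear : ∀ᶠ t in 𝓝[<] t₀, t ∈ Ico a t₀ := Ico_mem_nhdsLT hat
  have hlim : Tendsto (fun t => h x₀ t) (𝓝[<] t₀) (𝓝 0) := by
    have h1 := hc (x₀, t₀) ⟨hx₀, right_mem_Icc.2 hat.le⟩
    have h2 : Tendsto (fun t : ℝ => (x₀, t)) (𝓝[<] t₀) (𝓝[Z ×ˢ Icc a t₀] (x₀, t₀)) := by
      apply tendsto_nhdsWithin_of_tendsto_nhds_of_eventually_within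
      · exact ((by fun_prop : Continuous fun t : ℝ => (x₀, t)).tendsto t₀).mono_left
          nhdsWithin_le_nhds
      · filter_upwards [hnear] with t ht using ⟨hx₀, Ico_subset_Icc_self ht⟩
    have := h1.tendsto.comp h2
    simp only [hzero] at this
    exact this
  -- Compactness makes C uniform. Near a zero of h(·, t₀) the hypothesis applies; near a point where
  -- h(·, t₀) > 0 there are no minimizers for t close to t₀, since the minimum is at most h(x₀, t) →
  -- 0.
  have hunif : ∃ C : ℝ, ∀ᶠ t in 𝓝[<] t₀, ∀ x ∈ Z, x ∈ Z → IsMinOn (fun y => h y t) Z x →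
      ∃ d, HasDerivAt (h x) d t ∧ -C * h x t ≤ d := by
    refine hZ.induction_on (p := fun s => ∃ C : ℝ, ∀ᶠ t in 𝓝[<] t₀, ∀ x ∈ s, x ∈ Z →
      IsMinOn (fun y => h y t) Z x → ∃ d, HasDerivAt (h x) d t ∧ -C * h x t ≤ d)
      ⟨0, by simp⟩ ?_ ?_ ?_
    · rintro s s' hss ⟨C, hC⟩
      exact ⟨C, hC.mono fun t ht x hx => ht x (hss hx)⟩
    · rintro s s' ⟨C, hC⟩ ⟨C', hC'⟩
      refine ⟨max C C', ?_⟩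
      filter_upwards [hC, hC', hnear] with t h1 h2 h3 x hx hxZ hxm
      have h4 := (hpos x hxZ t h3).le
      rcases hx with hx | hx
      · obtain ⟨d, hd, hle⟩ := h1 x hx hxZ hxm
        exact ⟨d, hd, le_trans (by have := le_max_left C C'; nlinarith) hle⟩
      · obtain ⟨d, hd, hle⟩ := h2 x hx hxZ hxm
        exact ⟨d, hd, le_trans (by have := le_max_right C C'; nlinarith) hle⟩
    · intro x hx
      have hprod : ∀ {P : X × ℝ → Prop}, (∀ᶠ q in 𝓝[Z ×ˢ Icc a t₀] (x, t₀), P q) →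
          ∃ s ∈ 𝓝[Z] x, ∀ᶠ t in 𝓝[<] t₀, ∀ y ∈ s, P (y, t) := by
        intro P hP
        rw [nhdsWithin_prod_eq, eventually_prod_iff] at hP
        obtain ⟨pa, ha, pb, hb, hab⟩ := hP
        refine ⟨{y | pa y}, ha, ?_⟩
        have : 𝓝[<] t₀ ≤ 𝓝[Icc a t₀] t₀ := by
          rw [nhdsWithin_Icc_eq_nhdsLE hat]
          exact nhdsWithin_mono _ Iio_subset_Iic_self
        filter_upwards [this hb] with t ht y hy using hab hy ht
      by_cases hx0 : h x t₀ = 0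
      · obtain ⟨C, hC⟩ := hmin x hx hx0
        obtain ⟨s, hs, hst⟩ := hprod (hC.filter_mono nhdsWithin_le_nhds)
        refine ⟨s, hs, C, ?_⟩
        filter_upwards [hst, hnear] with t h1 h2 y hy hyZ hym using h1 y hy h2.2 hyZ hym
      · have hge : 0 ≤ h x t₀ := by
          have h1 := hc (x, t₀) ⟨hx, right_mem_Icc.2 hat.le⟩
          have h2 : Tendsto (fun t : ℝ => (x, t)) (𝓝[<] t₀) (𝓝[Z ×ˢ Icc a t₀] (x, t₀)) := by
            apply tendsto_nhdsWithin_of_tendsto_nhds_of_eventually_within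
            · exact ((by fun_prop : Continuous fun t : ℝ => (x, t)).tendsto t₀).mono_left
                nhdsWithin_le_nhds
            · filter_upwards [hnear] with t ht using ⟨hx, Ico_subset_Icc_self ht⟩
          refine ge_of_tendsto (h1.tendsto.comp h2) ?_
          filter_upwards [hnear] with t ht using (hpos x hx t ht).le
        have hgt : 0 < h x t₀ := lt_of_le_of_ne hge (Ne.symm hx0)
        have h1 : ∀ᶠ q in 𝓝[Z ×ˢ Icc a t₀] (x, t₀), h x t₀ / 2 < h q.1 q.2 :=
          (hc (x, t₀) ⟨hx, right_mem_Icc.2 hat.le⟩).tendsto.eventually_const_lt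
            (half_lt_self hgt)
        obtain ⟨s, hs, hst⟩ := hprod h1
        refine ⟨s, hs, 0, ?_⟩
        filter_upwards [hst, hlim.eventually_lt_const (half_pos hgt)] with t h2 h3 y hy hyZ hym
        have h4 := h2 y hy
        have h5 : h y t ≤ h x₀ t := hym hx₀
        linarith
  obtain ⟨C, hC⟩ := hunif
  obtain ⟨l, hl, hlC⟩ := (mem_nhdsLT_iff_exists_Ioo_subset.1 (hC.and hnear))
  obtain ⟨b, hlb, hbt⟩ := exists_between (mem_Iio.1 hl)
  have hab : a ≤ b := (hlC ⟨hlb, hbt⟩).2.1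
  -- The excess 1 makes the time derivative of exp(D t) h strictly positive at minimizers.
  set D : ℝ := C + 1 with hD
  have hφc : ContinuousOn (fun q : X × ℝ => Real.exp (D * q.2) * h q.1 q.2) (Z ×ˢ Icc a t₀) :=
    (by fun_prop : Continuous fun q : X × ℝ => Real.exp (D * q.2)).continuousOn.mul hc
  -- The minimum of exp(D t) h over Z × [b, t] is attained at time b: at a later time the positive
  -- derivative would give smaller values slightly earlier.
  have key : ∀ t ∈ Ico b t₀, ∃ y ∈ Z, ∀ x ∈ Z,
      Real.exp (D * b) * h y b ≤ Real.exp (D * t) * h x t := by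
    intro t ht
    have hsub : Z ×ˢ Icc b t ⊆ Z ×ˢ Icc a t₀ :=
      prod_mono le_rfl (Icc_subset_Icc hab ht.2.le)
    obtain ⟨⟨y, s⟩, ⟨hy, hs⟩, hmin⟩ := (hZ.prod isCompact_Icc).exists_isMinOn
      ⟨(x₀, b), hx₀, left_mem_Icc.2 ht.1⟩ (hφc.mono hsub)
    have hmin' : ∀ x ∈ Z, ∀ r ∈ Icc b t,
        Real.exp (D * s) * h y s ≤ Real.exp (D * r) * h x r := fun x hx r hr =>
      hmin (show (x, r) ∈ Z ×ˢ Icc b t from ⟨hx, hr⟩)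
    rcases hs.1.eq_or_lt with hbs | hbs
    · refine ⟨y, hy, fun x hx => ?_⟩
      simp only at hbs hs
      rw [hbs]
      exact hmin' x hx t (right_mem_Icc.2 ht.1)
    · exfalso
      simp only at hbs hs hy
      have hst : s < t₀ := hs.2.trans_lt ht.2
      have hym : IsMinOn (fun x => h x s) Z y := fun x hx =>
        le_of_mul_le_mul_left (hmin' x hx s hs) (Real.exp_pos _)
      obtain ⟨d, hd, hle⟩ := (hlC ⟨hlb.trans hbs, hst⟩).1 y hy hy hym
      have hys : 0 < h y s := hpos y hy s ⟨hab.trans hbs.le, hst⟩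
      have hder : HasDerivAt (fun r => Real.exp (D * r) * h y r)
          (Real.exp (D * s) * D * h y s + Real.exp (D * s) * d) s := by
        have h1 : HasDerivAt (fun r : ℝ => Real.exp (D * r)) (Real.exp (D * s) * D) s := by
          simpa using ((hasDerivAt_id s).const_mul D).exp
        exact h1.mul hd
      have hdpos : 0 < Real.exp (D * s) * D * h y s + Real.exp (D * s) * d := by
        have : 0 < Real.exp (D * s) * (D * h y s + d) := by
          apply mul_pos (Real.exp_pos _)
          rw [hD]; nlinarith
        linarith
      have hslope := (hasDerivAt_iff_tendsto_slope.1 hder).eventually_const_lt hdpos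
      have hslope' := hslope.filter_mono (nhdsWithin_mono s (s := Iio s) fun r hr => ne_of_lt hr)
      obtain ⟨r, hr1, hr2⟩ := (hslope'.and (Ioo_mem_nhdsLT hbs)).exists
      have h3 := hmin' y hy r ⟨hr2.1.le, hr2.2.le.trans hs.2⟩
      rw [slope_def_field] at hr1
      have h4 : r - s < 0 := by linarith [hr2.2]
      have h5 := div_nonpos_of_nonneg_of_nonpos (sub_nonneg.2 h3) h4.le
      linarith
  obtain ⟨z, hz, hzmin⟩ := hZ.exists_isMinOn ⟨x₀, hx₀⟩ (f := fun x => h x b)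
    (hc.comp (f := fun x : X => (x, b)) (by fun_prop) fun x hx => ⟨hx, hab, hbt.le⟩)
  have hzb := hpos z hz b ⟨hab, hbt⟩
  have hlim' : Tendsto (fun t => Real.exp (D * t) * h x₀ t) (𝓝[<] t₀) (𝓝 0) := by
    have h1 : Tendsto (fun t => Real.exp (D * t)) (𝓝[<] t₀) (𝓝 (Real.exp (D * t₀))) :=
      ((by fun_prop : Continuous fun t => Real.exp (D * t)).tendsto t₀).mono_left
        nhdsWithin_le_nhds
    simpa using h1.mul hlim
  -- The minimizer y depends on t, but its value at time b is at least that of z, a positive bound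
  -- independent of t.
  have hge : Real.exp (D * b) * h z b ≤ 0 := by
    refine ge_of_tendsto hlim' ?_
    filter_upwards [Ico_mem_nhdsLT hbt] with t ht
    obtain ⟨y, hy, hyt⟩ := key t ht
    refine le_trans ?_ (hyt x₀ hx₀)
    gcongr
    exact hzmin hy
  have := mul_pos (Real.exp_pos (D * b)) hzb
  linarith

end MinimumPrinciple

/-! ### Coordinate invariance of the second fundamental form. -/

section ChangeOfCoordinates

set_option maxSynthPendingDepth 3

open Filter

variable {H V : Type*} [NormedAddCommGroup H] [NormedSpace ℝ H]
  [NormedAddCommGroup V] [NormedSpace ℝ V]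

/-- The transformation law of the Christoffel symbols of the first kind. -/
theorem christoffelForm_pullback {G G' : V → V →L[ℝ] V →L[ℝ] ℝ} {τ : V → V} {y : V}
    (hτ : ContDiffAt ℝ 2 τ y) (hG : DifferentiableAt ℝ G y) (hG' : DifferentiableAt ℝ G' (τ y))
    (hsymm : ∀ a b, G' (τ y) a b = G' (τ y) b a)
    (hpull : ∀ᶠ z in 𝓝 y, ∀ a b, G z a b = G' (τ z) (fderiv ℝ τ z a) (fderiv ℝ τ z b))
    (a b c : V) :
    christoffelForm (fderiv ℝ G y) c a b
      = christoffelForm (fderiv ℝ G' (τ y)) (fderiv ℝ τ y c) (fderiv ℝ τ y a) (fderiv ℝ τ y b)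
        + G' (τ y) (fderiv ℝ (fderiv ℝ τ) y a b) (fderiv ℝ τ y c) := by
  have hτ1 : HasFDerivAt τ (fderiv ℝ τ y) y := (hτ.differentiableAt (by norm_num)).hasFDerivAt
  have hτ2 : HasFDerivAt (fderiv ℝ τ) (fderiv ℝ (fderiv ℝ τ) y) y :=
    ((hτ.fderiv_right (m := 1) (by norm_num)).differentiableAt (by norm_num)).hasFDerivAt
  have key : ∀ a b c, fderiv ℝ G y a b c
      = fderiv ℝ G' (τ y) (fderiv ℝ τ y a) (fderiv ℝ τ y b) (fderiv ℝ τ y c)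
        + G' (τ y) (fderiv ℝ (fderiv ℝ τ) y a b) (fderiv ℝ τ y c)
        + G' (τ y) (fderiv ℝ τ y b) (fderiv ℝ (fderiv ℝ τ) y a c) := by
    intro a b c
    have h1 := (hG.hasFDerivAt.clm_apply (hasFDerivAt_const b y)).clm_apply
      (hasFDerivAt_const c y)
    have h2 := ((hG'.hasFDerivAt.comp y hτ1).clm_apply
      (hτ2.clm_apply (hasFDerivAt_const b y))).clm_apply (hτ2.clm_apply (hasFDerivAt_const c y))
    have h3 : (fun z => G z b c) =ᶠ[𝓝 y]
        fun z => (G' ∘ τ) z (fderiv ℝ τ z b) (fderiv ℝ τ z c) := hpull.mono fun z hz => hz b c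
    have h4 := h1.unique (h2.congr_of_eventuallyEq h3)
    have h5 := congrArg (fun L => L a) h4
    simp at h5
    rw [h5]
    ring
  -- Of the six terms with second derivatives of τ, four cancel by symmetry and the other two
  -- coincide.
  have hs : ∀ a b, fderiv ℝ (fderiv ℝ τ) y a b = fderiv ℝ (fderiv ℝ τ) y b a := fun a b =>
    (hτ.isSymmSndFDerivAt (by simp)).eq a b
  rw [christoffelForm_apply, christoffelForm_apply, key, key, key, hs b a, hs c a, hs c b,
    hsymm (fderiv ℝ (fderiv ℝ τ) y a c)]
  ring

/-- The second fundamental form does not depend on the coordinates. -/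
theorem secondForm_pullback {G G' : V → V →L[ℝ] V →L[ℝ] ℝ} {τ : V → V} {σ : H → H} {f f' : H → V}
    {x : H} (hf : ContDiffAt ℝ 2 f x) (hf' : ContDiffAt ℝ 2 f' (σ x)) (hσ : ContDiffAt ℝ 2 σ x)
    (hτ : ContDiffAt ℝ 2 τ (f x)) (hG : DifferentiableAt ℝ G (f x))
    (hG' : DifferentiableAt ℝ G' (f' (σ x)))
    (hsymm : ∀ a b, G' (f' (σ x)) a b = G' (f' (σ x)) b a)
    (hpull : ∀ᶠ z in 𝓝 (f x), ∀ a b, G z a b = G' (τ z) (fderiv ℝ τ z a) (fderiv ℝ τ z b))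
    (hcomp : ∀ᶠ x' in 𝓝 x, τ (f x') = f' (σ x')) {ν : V}
    (hν : ∀ a, G' (f' (σ x)) (fderiv ℝ f' (σ x) a) (fderiv ℝ τ (f x) ν) = 0) (u v : H) :
    secondForm (G (f x)) (fderiv ℝ G (f x)) (fderiv ℝ f x) (fderiv ℝ (fderiv ℝ f) x) ν u v
      = secondForm (G' (f' (σ x))) (fderiv ℝ G' (f' (σ x))) (fderiv ℝ f' (σ x))
        (fderiv ℝ (fderiv ℝ f') (σ x)) (fderiv ℝ τ (f x) ν) (fderiv ℝ σ x u) (fderiv ℝ σ x v) := by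
  have hx : τ (f x) = f' (σ x) := hcomp.self_of_nhds
  have h1 : ∀ a, fderiv ℝ τ (f x) (fderiv ℝ f x a) = fderiv ℝ f' (σ x) (fderiv ℝ σ x a) := by
    have e1 : HasFDerivAt (f' ∘ σ) _ x :=
      ((hτ.differentiableAt (by norm_num)).hasFDerivAt.comp x
        (hf.differentiableAt (by norm_num)).hasFDerivAt).congr_of_eventuallyEq
          (hcomp.mono fun _ h => h.symm)
    have e2 := (hf'.differentiableAt (by norm_num)).hasFDerivAt.comp x
      (hσ.differentiableAt (by norm_num)).hasFDerivAt
    exact fun a => congrArg (fun L => L a) (e1.unique e2)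
  have h2 : fderiv ℝ (fun x' => τ (f x')) =ᶠ[𝓝 x] fderiv ℝ (fun x' => f' (σ x')) :=
    EventuallyEq.fderiv hcomp
  have h3 := congrArg (fun L : H →L[ℝ] H →L[ℝ] V => L u v) h2.fderiv_eq
  simp only [fderiv_fderiv_comp hτ hf, fderiv_fderiv_comp hf' hσ] at h3
  have hpv : ∀ a b, G (f x) a b = G' (τ (f x)) (fderiv ℝ τ (f x) a) (fderiv ℝ τ (f x) b) :=
    hpull.self_of_nhds
  rw [secondForm_apply, secondForm_apply, christoffelForm_pullback hτ hG (by rwa [hx])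
    (by rwa [hx]) hpull, hpv, h1, h1, hx]
  -- Pairing with the normal kills the tangential term coming from the second derivative of σ. The
  -- second derivative of τ is compensated by the Christoffel transformation law.
  have h4 := congrArg (fun w => G' (f' (σ x)) w (fderiv ℝ τ (f x) ν)) h3
  simp only [map_add, add_apply, hν, add_zero] at h4
  linarith

end ChangeOfCoordinates

/-! ### Differentials of charts and transition maps. -/

section Charts

variable {k : ℕ} {X : Type*} [TopologicalSpace X] [ChartedSpace (EuclideanSpace ℝ (Fin k)) X]

/-- The differential at `q'` of the chart around `q`. -/
noncomputable def chartDiff (q q' : X) :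
    TangentSpace (𝓡 k) q' →L[ℝ] EuclideanSpace ℝ (Fin k) :=
  mfderiv (𝓡 k) 𝓘(ℝ, EuclideanSpace ℝ (Fin k)) (extChartAt (𝓡 k) q) q'

/-- The differential at `y` of the inverse of the chart around `q`. -/
noncomputable def chartSymmDiff (q : X) (y : EuclideanSpace ℝ (Fin k)) :
    EuclideanSpace ℝ (Fin k) →L[ℝ] TangentSpace (𝓡 k) ((extChartAt (𝓡 k) q).symm y) :=
  mfderiv 𝓘(ℝ, EuclideanSpace ℝ (Fin k)) (𝓡 k) (extChartAt (𝓡 k) q).symm y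

/-- The change of coordinates from the chart around `q` to the chart around `q'`. -/
noncomputable def chartTransition (q q' : X) (y : EuclideanSpace ℝ (Fin k)) :
    EuclideanSpace ℝ (Fin k) :=
  extChartAt (𝓡 k) q' ((extChartAt (𝓡 k) q).symm y)

variable [IsManifold (𝓡 k) ∞ X]

theorem chartDiff_chartSymmDiff {q : X} {y v : EuclideanSpace ℝ (Fin k)}
    (h : y ∈ (extChartAt (𝓡 k) q).target) :
    chartDiff q ((extChartAt (𝓡 k) q).symm y) (chartSymmDiff q y v) = v := by
  have h1 := mfderiv_extChartAt_comp_mfderivWithin_extChartAt_symm (I := 𝓡 k) h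
  have h2 := congrArg (fun L => L v) h1
  simp only [ModelWithCorners.range_eq_univ, mfderivWithin_univ] at h2
  exact h2

theorem chartSymmDiff_chartDiff {q : X} {y : EuclideanSpace ℝ (Fin k)}
    (h : y ∈ (extChartAt (𝓡 k) q).target) (w : TangentSpace (𝓡 k) ((extChartAt (𝓡 k) q).symm y)) :
    chartSymmDiff q y (chartDiff q ((extChartAt (𝓡 k) q).symm y) w) = w := by
  have h1 := mfderivWithin_extChartAt_symm_comp_mfderiv_extChartAt (I := 𝓡 k) h
  have h2 := congrArg (fun L => L w) h1
  simp only [ModelWithCorners.range_eq_univ, mfderivWithin_univ] at h2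
  exact h2

theorem contDiffAt_chartTransition {q q' : X} {y : EuclideanSpace ℝ (Fin k)}
    (h : y ∈ (extChartAt (𝓡 k) q).target)
    (h' : (extChartAt (𝓡 k) q).symm y ∈ (extChartAt (𝓡 k) q').source) :
    ContDiffAt ℝ ∞ (chartTransition q q') y := by
  rw [← contMDiffAt_iff_contDiffAt]
  have h1 : ContMDiffAt 𝓘(ℝ, EuclideanSpace ℝ (Fin k)) (𝓡 k) ∞ (extChartAt (𝓡 k) q).symm y :=
    (contMDiffOn_extChartAt_symm q).contMDiffAt ((isOpen_extChartAt_target q).mem_nhds h)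
  have h2 : ContMDiffAt (𝓡 k) 𝓘(ℝ, EuclideanSpace ℝ (Fin k)) ∞ (extChartAt (𝓡 k) q')
      ((extChartAt (𝓡 k) q).symm y) :=
    contMDiffAt_extChartAt' (by rwa [extChartAt_source] at h')
  exact h2.comp y h1

theorem chartDiff_eq_fderiv_chartTransition {q q₁ q' : X} (h : q' ∈ (extChartAt (𝓡 k) q).source)
    (h₁ : q' ∈ (extChartAt (𝓡 k) q₁).source) (w : TangentSpace (𝓡 k) q') :
    chartDiff q₁ q' w
      = fderiv ℝ (chartTransition q q₁) (extChartAt (𝓡 k) q q') (chartDiff q q' w) := by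
  have hl := (extChartAt (𝓡 k) q).left_inv h
  have h2 : MDifferentiableAt 𝓘(ℝ, EuclideanSpace ℝ (Fin k)) 𝓘(ℝ, EuclideanSpace ℝ (Fin k))
      (chartTransition q q₁) (extChartAt (𝓡 k) q q') :=
    ((contDiffAt_chartTransition ((extChartAt (𝓡 k) q).map_source h)
      (by rwa [hl])).differentiableAt (by simp)).mdifferentiableAt
  have h3 : MDifferentiableAt (𝓡 k) 𝓘(ℝ, EuclideanSpace ℝ (Fin k)) (extChartAt (𝓡 k) q) q' :=
    mdifferentiableAt_extChartAt (by rwa [extChartAt_source] at h)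
  have h4 : (extChartAt (𝓡 k) q₁) =ᶠ[𝓝 q'] chartTransition q q₁ ∘ extChartAt (𝓡 k) q := by
    filter_upwards [(isOpen_extChartAt_source q).mem_nhds h] with z hz
    rw [Function.comp_apply, chartTransition, (extChartAt (𝓡 k) q).left_inv hz]
  have h5 := (h2.hasMFDerivAt.comp q' h3.hasMFDerivAt).congr_of_eventuallyEq h4
  have h6 := h5.mfderiv
  have h7 := congrArg (fun L => L w) h6
  simp only [mfderiv_eq_fderiv] at h7
  exact h7

end Charts

/-! ### The Riemannian metric in a chart. -/

section ChartMetric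

set_option maxSynthPendingDepth 3

open Filter

variable {n m : ℕ}
  {M : Type*} [TopologicalSpace M] [ChartedSpace (EuclideanSpace ℝ (Fin n)) M]
  {N : Type*} [TopologicalSpace N] [ChartedSpace (EuclideanSpace ℝ (Fin m)) N]
  [RiemannianBundle (fun q : N => TangentSpace (𝓡 m) q)]

theorem metricInChart_eq (q : N) (y a b : EuclideanSpace ℝ (Fin m)) :
    metricInChart q y a b = inner ℝ (chartSymmDiff q y a) (chartSymmDiff q y b) := rfl

/-- The Riemannian metric in the chart around `q`, as a bilinear form. -/
noncomputable def chartMetric (q : N) (y : EuclideanSpace ℝ (Fin m)) :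
    EuclideanSpace ℝ (Fin m) →L[ℝ] EuclideanSpace ℝ (Fin m) →L[ℝ] ℝ :=
  LinearMap.toContinuousLinearMap (LinearMap.toContinuousLinearMap.toLinearMap ∘ₗ
    LinearMap.mk₂ ℝ (metricInChart q y)
      (fun a a' b => by simp only [metricInChart_eq, map_add, inner_add_left])
      (fun c a b => by simp only [metricInChart_eq, map_smul, real_inner_smul_left, smul_eq_mul])
      (fun a b b' => by simp only [metricInChart_eq, map_add, inner_add_right])
      (fun c a b => by simp only [metricInChart_eq, map_smul, real_inner_smul_right, smul_eq_mul]))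

theorem chartMetric_apply (q : N) (y a b : EuclideanSpace ℝ (Fin m)) :
    chartMetric q y a b = metricInChart q y a b := rfl

theorem chartMetric_symm (q : N) (y a b : EuclideanSpace ℝ (Fin m)) :
    chartMetric q y a b = chartMetric q y b a := by
  rw [chartMetric_apply, chartMetric_apply, metricInChart_eq, metricInChart_eq, real_inner_comm]

variable [IsManifold (𝓡 m) ∞ N]

theorem inner_eq_chartMetric {q q' : N} (h : q' ∈ (extChartAt (𝓡 m) q).source)
    (w w' : TangentSpace (𝓡 m) q') :
    inner ℝ w w' = chartMetric q (extChartAt (𝓡 m) q q') (chartDiff q q' w) (chartDiff q q' w') := by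
  obtain ⟨y, hy, rfl⟩ : ∃ y ∈ (extChartAt (𝓡 m) q).target, q' = (extChartAt (𝓡 m) q).symm y :=
    ⟨_, (extChartAt (𝓡 m) q).map_source h, ((extChartAt (𝓡 m) q).left_inv h).symm⟩
  rw [(extChartAt (𝓡 m) q).right_inv hy, chartMetric_apply, metricInChart_eq,
    chartSymmDiff_chartDiff hy, chartSymmDiff_chartDiff hy]

theorem chartMetric_pos {q : N} {y u : EuclideanSpace ℝ (Fin m)}
    (h : y ∈ (extChartAt (𝓡 m) q).target) (hu : u ≠ 0) : 0 < chartMetric q y u u := by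
  rw [chartMetric_apply, metricInChart_eq, real_inner_self_pos]
  intro h0
  have := chartDiff_chartSymmDiff (v := u) h
  rw [h0, map_zero] at this
  exact hu this.symm

/-- Coordinate fields are smooth sections of the tangent bundle, so their inner products are smooth;
in finite dimension the form may be checked on constant vectors. -/
theorem contDiffAt_chartMetric [IsContMDiffRiemannianBundle (𝓡 m) ∞ (EuclideanSpace ℝ (Fin m))
      (fun q : N => TangentSpace (𝓡 m) q)] {q : N} {y : EuclideanSpace ℝ (Fin m)}
    (h : y ∈ (extChartAt (𝓡 m) q).target) : ContDiffAt ℝ ∞ (chartMetric q) y := by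
  have hopen := isOpen_extChartAt_target (I := 𝓡 m) q
  have hsec : ∀ a : EuclideanSpace ℝ (Fin m), ContMDiffOn 𝓘(ℝ, EuclideanSpace ℝ (Fin m))
      (𝓡 m).tangent ∞ (fun z => (⟨(extChartAt (𝓡 m) q).symm z, chartSymmDiff q z a⟩ :
        TangentBundle (𝓡 m) N)) (extChartAt (𝓡 m) q).target := by
    intro a
    have h1 : ContMDiffOn 𝓘(ℝ, EuclideanSpace ℝ (Fin m)) (𝓡 m) ∞ (extChartAt (𝓡 m) q).symm
        (extChartAt (𝓡 m) q).target := contMDiffOn_extChartAt_symm q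
    have h2 := h1.contMDiffOn_tangentMapWithin (m := ∞) (by simp) hopen.uniqueMDiffOn
    have h3 : ContMDiff 𝓘(ℝ, EuclideanSpace ℝ (Fin m)) 𝓘(ℝ, EuclideanSpace ℝ (Fin m)).tangent ∞
        (fun z => (⟨z, a⟩ : TangentBundle 𝓘(ℝ, EuclideanSpace ℝ (Fin m))
          (EuclideanSpace ℝ (Fin m)))) :=
      contMDiff_vectorSpace_iff_contDiff.2 contDiff_const
    refine (h2.comp h3.contMDiffOn (fun z hz => hz)).congr fun z hz => ?_
    simp only [Function.comp_apply, tangentMapWithin, mfderivWithin_of_isOpen hopen hz]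
    rfl
  have hab : ∀ a b, ContDiffOn ℝ ∞ (fun z => chartMetric q z a b) (extChartAt (𝓡 m) q).target :=
    fun a b => ((hsec a).inner_bundle (hsec b)).contDiffOn
  have : ContDiffOn ℝ ∞ (chartMetric q) (extChartAt (𝓡 m) q).target := by
    rw [contDiffOn_clm_apply]
    intro a
    rw [contDiffOn_clm_apply]
    exact hab a
  exact this.contDiffAt (hopen.mem_nhds h)

theorem chartMetric_eq_pullback {q q₁ : N} {z : EuclideanSpace ℝ (Fin m)}
    (h : z ∈ (extChartAt (𝓡 m) q).target)
    (h₁ : (extChartAt (𝓡 m) q).symm z ∈ (extChartAt (𝓡 m) q₁).source)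
    (a b : EuclideanSpace ℝ (Fin m)) :
    chartMetric q z a b = chartMetric q₁ (chartTransition q q₁ z)
      (fderiv ℝ (chartTransition q q₁) z a) (fderiv ℝ (chartTransition q q₁) z b) := by
  rw [chartMetric_apply, metricInChart_eq, inner_eq_chartMetric h₁,
    chartDiff_eq_fderiv_chartTransition ((extChartAt (𝓡 m) q).map_target h) h₁,
    chartDiff_eq_fderiv_chartTransition ((extChartAt (𝓡 m) q).map_target h) h₁,
    chartDiff_chartSymmDiff h, chartDiff_chartSymmDiff h, (extChartAt (𝓡 m) q).right_inv h]
  rfl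

end ChartMetric

/-! ### Curvatures of a map in arbitrary charts. -/

section Coordinates

set_option maxSynthPendingDepth 3

open Filter

variable {n m : ℕ}
  {M : Type*} [TopologicalSpace M] [ChartedSpace (EuclideanSpace ℝ (Fin n)) M]
  {N : Type*} [TopologicalSpace N] [ChartedSpace (EuclideanSpace ℝ (Fin m)) N]

/-- The map `f` read in the charts around `p` and `q`. -/
noncomputable def chartRep (p : M) (q : N) (f : M → N) (x : EuclideanSpace ℝ (Fin n)) :
    EuclideanSpace ℝ (Fin m) :=
  extChartAt (𝓡 m) q (f ((extChartAt (𝓡 n) p).symm x))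

theorem chartRep_extChartAt {p p' : M} (q : N) (f : M → N)
    (h : p' ∈ (extChartAt (𝓡 n) p).source) :
    chartRep (m := m) p q f (extChartAt (𝓡 n) p p') = extChartAt (𝓡 m) q (f p') := by
  rw [chartRep, (extChartAt (𝓡 n) p).left_inv h]

variable [IsManifold (𝓡 m) ∞ N]

theorem contDiffAt_chartRep [IsManifold (𝓡 n) ∞ M] {p p' : M} {q : N} {f : M → N}
    (hf : ContMDiffAt (𝓡 n) (𝓡 m) ∞ f p') (hp : p' ∈ (extChartAt (𝓡 n) p).source)
    (hq : f p' ∈ (extChartAt (𝓡 m) q).source) :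
    ContDiffAt ℝ ∞ (chartRep (m := m) p q f) (extChartAt (𝓡 n) p p') := by
  rw [← contMDiffAt_iff_contDiffAt]
  have hl := (extChartAt (𝓡 n) p).left_inv hp
  have h1 : ContMDiffAt 𝓘(ℝ, EuclideanSpace ℝ (Fin n)) (𝓡 n) ∞ (extChartAt (𝓡 n) p).symm
      (extChartAt (𝓡 n) p p') :=
    (contMDiffOn_extChartAt_symm p).contMDiffAt
      ((isOpen_extChartAt_target p).mem_nhds ((extChartAt (𝓡 n) p).map_source hp))
  have h2 : ContMDiffAt (𝓡 m) 𝓘(ℝ, EuclideanSpace ℝ (Fin m)) ∞ (extChartAt (𝓡 m) q) (f p') :=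
    contMDiffAt_extChartAt' (by rwa [extChartAt_source] at hq)
  have h3 : ContMDiffAt (𝓡 n) 𝓘(ℝ, EuclideanSpace ℝ (Fin m)) ∞ (extChartAt (𝓡 m) q ∘ f)
      ((extChartAt (𝓡 n) p).symm (extChartAt (𝓡 n) p p')) := by
    rw [hl]; exact h2.comp p' hf
  exact h3.comp _ h1

theorem fderiv_chartRep [IsManifold (𝓡 n) ∞ M] {p p' : M} {q : N} {f : M → N}
    (hf : ContMDiffAt (𝓡 n) (𝓡 m) ∞ f p') (hp : p' ∈ (extChartAt (𝓡 n) p).source)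
    (hq : f p' ∈ (extChartAt (𝓡 m) q).source) (e : TangentSpace (𝓡 n) p') :
    fderiv ℝ (chartRep (m := m) p q f) (extChartAt (𝓡 n) p p') (chartDiff p p' e)
      = chartDiff q (f p') (mfderiv (𝓡 n) (𝓡 m) f p' e) := by
  have h1 : MDifferentiableAt 𝓘(ℝ, EuclideanSpace ℝ (Fin n)) 𝓘(ℝ, EuclideanSpace ℝ (Fin m))
      (chartRep (m := m) p q f) (extChartAt (𝓡 n) p p') :=
    ((contDiffAt_chartRep hf hp hq).differentiableAt (by simp)).mdifferentiableAt
  have h2 : MDifferentiableAt (𝓡 n) 𝓘(ℝ, EuclideanSpace ℝ (Fin n)) (extChartAt (𝓡 n) p) p' :=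
    mdifferentiableAt_extChartAt (by rwa [extChartAt_source] at hp)
  have h3 : MDifferentiableAt (𝓡 m) 𝓘(ℝ, EuclideanSpace ℝ (Fin m)) (extChartAt (𝓡 m) q) (f p') :=
    mdifferentiableAt_extChartAt (by rwa [extChartAt_source] at hq)
  have h4 : MDifferentiableAt (𝓡 n) (𝓡 m) f p' := hf.mdifferentiableAt (by simp)
  have h5 : extChartAt (𝓡 m) q ∘ f =ᶠ[𝓝 p'] chartRep (m := m) p q f ∘ extChartAt (𝓡 n) p := by
    filter_upwards [(isOpen_extChartAt_source p).mem_nhds hp] with z hz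
    rw [Function.comp_apply, Function.comp_apply, chartRep_extChartAt q f hz]
  have h6 := ((h1.hasMFDerivAt.comp p' h2.hasMFDerivAt).congr_of_eventuallyEq h5).mfderiv
  have h7 := (h3.hasMFDerivAt.comp p' h4.hasMFDerivAt).mfderiv
  have h8 := congrArg (fun L => L e) (h6.symm.trans h7)
  simp only [mfderiv_eq_fderiv] at h8
  exact h8

variable [RiemannianBundle (fun q : N => TangentSpace (𝓡 m) q)]
  [IsContMDiffRiemannianBundle (𝓡 m) ∞ (EuclideanSpace ℝ (Fin m))
    (fun q : N => TangentSpace (𝓡 m) q)]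

theorem christoffelInChart_eq {q : N} {y : EuclideanSpace ℝ (Fin m)}
    (h : y ∈ (extChartAt (𝓡 m) q).target) (a b c : EuclideanSpace ℝ (Fin m)) :
    christoffelInChart q y a b c = christoffelForm (fderiv ℝ (chartMetric q) y) c a b := by
  have hd : HasFDerivAt (chartMetric q) (fderiv ℝ (chartMetric q) y) y :=
    ((contDiffAt_chartMetric h).differentiableAt (by simp)).hasFDerivAt
  have key : ∀ a b c, fderiv ℝ (fun z => metricInChart q z b c) y a
      = fderiv ℝ (chartMetric q) y a b c := by
    intro a b c
    have h1 := (hd.clm_apply (hasFDerivAt_const b y)).clm_apply (hasFDerivAt_const c y)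
    have h2 : HasFDerivAt (fun z => metricInChart q z b c) _ y := h1
    rw [h2.fderiv]
    simp
  rw [christoffelInChart, key, key, key, christoffelForm_apply]

/-- This covers charts centred at p and f p. The flow argument keeps the charts fixed while the
points move, so coordinate invariance has to be added. -/
theorem secondFundamentalForm_eq {f : M → N} {p : M} (ν : TangentSpace (𝓡 m) (f p))
    (u v : TangentSpace (𝓡 n) p) :
    secondFundamentalForm f p ν u v
      = secondForm (chartMetric (f p) (chartRep (m := m) p (f p) f (extChartAt (𝓡 n) p p)))
        (fderiv ℝ (chartMetric (f p)) (chartRep (m := m) p (f p) f (extChartAt (𝓡 n) p p)))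
        (fderiv ℝ (chartRep (m := m) p (f p) f) (extChartAt (𝓡 n) p p))
        (fderiv ℝ (fderiv ℝ (chartRep (m := m) p (f p) f)) (extChartAt (𝓡 n) p p))
        (chartDiff (f p) (f p) ν) (chartDiff p p u) (chartDiff p p v) := by
  rw [secondForm_apply, ← christoffelInChart_eq, chartRep_extChartAt (f p) f (mem_extChartAt_source p)]
  · rfl
  · rw [chartRep_extChartAt (f p) f (mem_extChartAt_source p)]
    exact mem_extChartAt_target (f p)

/-- The second fundamental form computed in arbitrary charts. -/
theorem secondFundamentalForm_eq_secondForm [IsManifold (𝓡 n) ∞ M] {f : M → N} {p p₀ : M} {q₀ : N}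
    (hf : ContMDiffAt (𝓡 n) (𝓡 m) ∞ f p) (hp : p ∈ (extChartAt (𝓡 n) p₀).source)
    (hq : f p ∈ (extChartAt (𝓡 m) q₀).source) {ν : TangentSpace (𝓡 m) (f p)}
    (hν : ∀ v : TangentSpace (𝓡 n) p, inner ℝ (mfderiv (𝓡 n) (𝓡 m) f p v) ν = (0 : ℝ))
    (u v : TangentSpace (𝓡 n) p) :
    secondFundamentalForm f p ν u v
      = secondForm (chartMetric q₀ (chartRep (m := m) p₀ q₀ f (extChartAt (𝓡 n) p₀ p)))
        (fderiv ℝ (chartMetric q₀) (chartRep (m := m) p₀ q₀ f (extChartAt (𝓡 n) p₀ p)))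
        (fderiv ℝ (chartRep (m := m) p₀ q₀ f) (extChartAt (𝓡 n) p₀ p))
        (fderiv ℝ (fderiv ℝ (chartRep (m := m) p₀ q₀ f)) (extChartAt (𝓡 n) p₀ p))
        (chartDiff q₀ (f p) ν) (chartDiff p₀ p u) (chartDiff p₀ p v) := by
  have le2 : (2 : ℕ∞ω) ≤ ∞ := ENat.LEInfty.out
  have hpp := mem_extChartAt_source (I := 𝓡 n) p
  have hqq := mem_extChartAt_source (I := 𝓡 m) (f p)
  have hx₀ : extChartAt (𝓡 n) p p ∈ (extChartAt (𝓡 n) p).target := mem_extChartAt_target p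
  have hy₀ : extChartAt (𝓡 m) (f p) (f p) ∈ (extChartAt (𝓡 m) (f p)).target :=
    mem_extChartAt_target (f p)
  have hσx : chartTransition p p₀ (extChartAt (𝓡 n) p p) = extChartAt (𝓡 n) p₀ p := by
    rw [chartTransition, (extChartAt (𝓡 n) p).left_inv hpp]
  have hfx : chartRep (m := m) p (f p) f (extChartAt (𝓡 n) p p) = extChartAt (𝓡 m) (f p) (f p) :=
    chartRep_extChartAt (f p) f hpp
  have hfx' : chartRep (m := m) p₀ q₀ f (extChartAt (𝓡 n) p₀ p) = extChartAt (𝓡 m) q₀ (f p) :=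
    chartRep_extChartAt q₀ f hp
  have hsp : (extChartAt (𝓡 n) p).symm (extChartAt (𝓡 n) p p) = p :=
    (extChartAt (𝓡 n) p).left_inv hpp
  have hsq : (extChartAt (𝓡 m) (f p)).symm (extChartAt (𝓡 m) (f p) (f p)) = f p :=
    (extChartAt (𝓡 m) (f p)).left_inv hqq
  have csp : ContinuousAt (extChartAt (𝓡 n) p).symm (extChartAt (𝓡 n) p p) :=
    (continuousOn_extChartAt_symm p).continuousAt ((isOpen_extChartAt_target p).mem_nhds hx₀)
  have csq : ContinuousAt (extChartAt (𝓡 m) (f p)).symm (extChartAt (𝓡 m) (f p) (f p)) :=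
    (continuousOn_extChartAt_symm (f p)).continuousAt
      ((isOpen_extChartAt_target (f p)).mem_nhds hy₀)
  have hσ : ContDiffAt ℝ ∞ (chartTransition p p₀) (extChartAt (𝓡 n) p p) :=
    contDiffAt_chartTransition hx₀ (by rwa [hsp])
  have hτ : ContDiffAt ℝ ∞ (chartTransition (f p) q₀) (extChartAt (𝓡 m) (f p) (f p)) :=
    contDiffAt_chartTransition hy₀ (by rwa [hsq])
  have hpull : ∀ᶠ z in 𝓝 (extChartAt (𝓡 m) (f p) (f p)), ∀ a b, chartMetric (f p) z a b
      = chartMetric q₀ (chartTransition (f p) q₀ z) (fderiv ℝ (chartTransition (f p) q₀) z a)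
        (fderiv ℝ (chartTransition (f p) q₀) z b) := by
    have h2 : ∀ᶠ z in 𝓝 (extChartAt (𝓡 m) (f p) (f p)),
        (extChartAt (𝓡 m) (f p)).symm z ∈ (extChartAt (𝓡 m) q₀).source :=
      csq.eventually (by rw [hsq]; exact (isOpen_extChartAt_source q₀).mem_nhds hq)
    filter_upwards [(isOpen_extChartAt_target (f p)).mem_nhds hy₀, h2] with z h3 h4 a b
    exact chartMetric_eq_pullback h3 h4 a b
  have hcomp : ∀ᶠ x' in 𝓝 (extChartAt (𝓡 n) p p),
      chartTransition (f p) q₀ (chartRep (m := m) p (f p) f x')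
        = chartRep (m := m) p₀ q₀ f (chartTransition p p₀ x') := by
    have h1 : ∀ᶠ x' in 𝓝 (extChartAt (𝓡 n) p p),
        (extChartAt (𝓡 n) p).symm x' ∈ (extChartAt (𝓡 n) p₀).source :=
      csp.eventually (by rw [hsp]; exact (isOpen_extChartAt_source p₀).mem_nhds hp)
    have h2 : ∀ᶠ x' in 𝓝 (extChartAt (𝓡 n) p p),
        f ((extChartAt (𝓡 n) p).symm x') ∈ (extChartAt (𝓡 m) (f p)).source :=
      csp.eventually (by
        rw [hsp]
        exact hf.continuousAt.eventually ((isOpen_extChartAt_source (f p)).mem_nhds hqq))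
    filter_upwards [h1, h2] with x' h1 h2
    rw [chartTransition, chartRep, chartRep, chartTransition, (extChartAt (𝓡 m) (f p)).left_inv h2,
      (extChartAt (𝓡 n) p₀).left_inv h1]
  have hDτ : fderiv ℝ (chartTransition (f p) q₀) (extChartAt (𝓡 m) (f p) (f p))
      (chartDiff (f p) (f p) ν) = chartDiff q₀ (f p) ν :=
    (chartDiff_eq_fderiv_chartTransition hqq hq ν).symm
  have hDσ : ∀ u, fderiv ℝ (chartTransition p p₀) (extChartAt (𝓡 n) p p) (chartDiff p p u)
      = chartDiff p₀ p u := fun u => (chartDiff_eq_fderiv_chartTransition hpp hp u).symm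
  have main := secondForm_pullback (G := chartMetric (f p)) (G' := chartMetric q₀)
    (τ := chartTransition (f p) q₀) (σ := chartTransition p p₀) (f := chartRep (m := m) p (f p) f)
    (f' := chartRep (m := m) p₀ q₀ f) (x := extChartAt (𝓡 n) p p) (ν := chartDiff (f p) (f p) ν)
    ((contDiffAt_chartRep hf hpp hqq).of_le le2) (by rw [hσx]; exact (contDiffAt_chartRep hf hp hq).of_le le2)
    (hσ.of_le le2) (by rw [hfx]; exact hτ.of_le le2)
    (by rw [hfx]; exact (contDiffAt_chartMetric hy₀).differentiableAt (by simp))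
    (by
      rw [hσx, hfx']
      exact (contDiffAt_chartMetric ((extChartAt (𝓡 m) q₀).map_source hq)).differentiableAt
        (by simp))
    (fun a b => chartMetric_symm _ _ _ _) (by rwa [hfx]) hcomp
    (fun a => by
      obtain ⟨w, rfl⟩ : ∃ w : TangentSpace (𝓡 n) p, chartDiff p₀ p w = a := by
        obtain ⟨y, hy, rfl⟩ : ∃ y ∈ (extChartAt (𝓡 n) p₀).target, p = (extChartAt (𝓡 n) p₀).symm y :=
          ⟨_, (extChartAt (𝓡 n) p₀).map_source hp, ((extChartAt (𝓡 n) p₀).left_inv hp).symm⟩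
        exact ⟨_, chartDiff_chartSymmDiff hy⟩
      rw [hσx, hfx', hfx, hDτ, fderiv_chartRep hf hp hq, ← inner_eq_chartMetric hq]
      exact hν w) (chartDiff p p u) (chartDiff p p v)
  rw [secondFundamentalForm_eq, main, hσx, hfx, hDτ, hDσ, hDσ]

/-- Principal curvatures computed in arbitrary charts. -/
theorem IsPrincipalCurvatures.isEigenvalueList [IsManifold (𝓡 n) ∞ M] {f : M → N} {p p₀ : M} {q₀ : N}
    (hf : ContMDiffAt (𝓡 n) (𝓡 m) ∞ f p) (hp : p ∈ (extChartAt (𝓡 n) p₀).source)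
    (hq : f p ∈ (extChartAt (𝓡 m) q₀).source) {ν : TangentSpace (𝓡 m) (f p)} {k : Fin n → ℝ}
    (hν : IsUnitNormalAt (n := n) f p ν) (hk : IsPrincipalCurvatures f p ν k) :
    IsSheet (chartMetric q₀ (chartRep (m := m) p₀ q₀ f (extChartAt (𝓡 n) p₀ p)))
      (fderiv ℝ (chartRep (m := m) p₀ q₀ f) (extChartAt (𝓡 n) p₀ p)) (chartDiff q₀ (f p) ν) ∧
    IsEigenvalueList (firstForm (chartMetric q₀ (chartRep (m := m) p₀ q₀ f (extChartAt (𝓡 n) p₀ p)))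
      (fderiv ℝ (chartRep (m := m) p₀ q₀ f) (extChartAt (𝓡 n) p₀ p)))
      (secondForm (chartMetric q₀ (chartRep (m := m) p₀ q₀ f (extChartAt (𝓡 n) p₀ p)))
        (fderiv ℝ (chartMetric q₀) (chartRep (m := m) p₀ q₀ f (extChartAt (𝓡 n) p₀ p)))
        (fderiv ℝ (chartRep (m := m) p₀ q₀ f) (extChartAt (𝓡 n) p₀ p))
        (fderiv ℝ (fderiv ℝ (chartRep (m := m) p₀ q₀ f)) (extChartAt (𝓡 n) p₀ p))
        (chartDiff q₀ (f p) ν)) k := by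
  have hfx' : chartRep (m := m) p₀ q₀ f (extChartAt (𝓡 n) p₀ p) = extChartAt (𝓡 m) q₀ (f p) :=
    chartRep_extChartAt q₀ f hp
  have hbij : Function.Bijective (chartDiff (k := n) p₀ p) := by
    obtain ⟨y, hy, rfl⟩ : ∃ y ∈ (extChartAt (𝓡 n) p₀).target, p = (extChartAt (𝓡 n) p₀).symm y :=
      ⟨_, (extChartAt (𝓡 n) p₀).map_source hp, ((extChartAt (𝓡 n) p₀).left_inv hp).symm⟩
    exact Function.bijective_iff_has_inverse.2
      ⟨chartSymmDiff p₀ y, chartSymmDiff_chartDiff hy, fun v => chartDiff_chartSymmDiff hy⟩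
  obtain ⟨e, h1, h2⟩ := hk
  have hlist : IsEigenvalueList _ _ k := ⟨e.map (LinearEquiv.ofBijective
    (chartDiff (k := n) p₀ p : TangentSpace (𝓡 n) p →ₗ[ℝ] EuclideanSpace ℝ (Fin n)) hbij),
    fun i j => (?_ : firstForm (chartMetric q₀ (chartRep (m := m) p₀ q₀ f (extChartAt (𝓡 n) p₀ p)))
      (fderiv ℝ (chartRep (m := m) p₀ q₀ f) (extChartAt (𝓡 n) p₀ p)) _ _ = _),
    fun i j => (?_ : secondForm (chartMetric q₀ (chartRep (m := m) p₀ q₀ f (extChartAt (𝓡 n) p₀ p)))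
        (fderiv ℝ (chartMetric q₀) (chartRep (m := m) p₀ q₀ f (extChartAt (𝓡 n) p₀ p)))
        (fderiv ℝ (chartRep (m := m) p₀ q₀ f) (extChartAt (𝓡 n) p₀ p))
        (fderiv ℝ (fderiv ℝ (chartRep (m := m) p₀ q₀ f)) (extChartAt (𝓡 n) p₀ p))
        (chartDiff q₀ (f p) ν) _ _ = _)⟩
  · refine ⟨⟨chartMetric_symm _ _, ?_, ?_, ?_⟩, hlist⟩
    -- Injectivity of the differential follows from positivity of the first form, which has an
    -- orthonormal basis.
    · refine (injective_iff_map_eq_zero _).2 fun a ha => ?_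
      by_contra hne
      have := hlist.apply_self_pos hne
      rw [firstForm_apply, ha] at this
      simp at this
    · intro a
      obtain ⟨w, rfl⟩ := hbij.2 a
      rw [fderiv_chartRep hf hp hq, hfx', ← inner_eq_chartMetric hq]
      exact hν.2 w
    · rw [hfx', ← inner_eq_chartMetric hq]
      exact hν.1
  · simp only [Module.Basis.map_apply, LinearEquiv.ofBijective_apply, ContinuousLinearMap.coe_coe]
    rw [firstForm_apply, fderiv_chartRep hf hp hq, fderiv_chartRep hf hp hq, hfx',
      ← inner_eq_chartMetric hq]
    exact h1 i j
  · simp only [Module.Basis.map_apply, LinearEquiv.ofBijective_apply, ContinuousLinearMap.coe_coe]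
    rw [← secondFundamentalForm_eq_secondForm hf hp hq hν.2]
    exact h2 i j

end Coordinates

/-! ### Embedding a compact region in Euclidean space. -/

section Embedding

open Filter

variable {m : ℕ} {N : Type*} [TopologicalSpace N] [ChartedSpace (EuclideanSpace ℝ (Fin m)) N]
  [IsManifold (𝓡 m) ∞ N]

theorem chartDiff_bijective {q q' : N} (h : q' ∈ (extChartAt (𝓡 m) q).source) :
    Function.Bijective (chartDiff (k := m) q q') := by
  obtain ⟨y, hy, rfl⟩ : ∃ y ∈ (extChartAt (𝓡 m) q).target, q' = (extChartAt (𝓡 m) q).symm y :=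
    ⟨_, (extChartAt (𝓡 m) q).map_source h, ((extChartAt (𝓡 m) q).left_inv h).symm⟩
  exact Function.bijective_iff_has_inverse.2
    ⟨chartSymmDiff q y, chartSymmDiff_chartDiff hy, fun v => chartDiff_chartSymmDiff hy⟩

/-- A compact subset of a manifold can be embedded in a Euclidean space. -/
theorem IsCompact.exists_immersion_euclidean [T2Space N] {s : Set N} (hs : IsCompact s) :
    ∃ (k : ℕ) (e : N → EuclideanSpace ℝ (Fin k)),
      ContMDiff (𝓡 m) 𝓘(ℝ, EuclideanSpace ℝ (Fin k)) ∞ e ∧ InjOn e s ∧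
      ∀ x ∈ s, Function.Injective (mfderiv (𝓡 m) 𝓘(ℝ, EuclideanSpace ℝ (Fin k)) e x) := by
  let b : ∀ x : N, SmoothBumpFunction (𝓡 m) x := fun x => Classical.arbitrary _
  obtain ⟨t, -, ht⟩ := hs.elim_nhds_subcover (fun x => {y | b x =ᶠ[𝓝 y] 1}) fun x _ =>
    eventually_eventually_nhds.2 (b x).eventuallyEq_one
  -- Besides the cut-off charts, the cut-off values are recorded: equality of images forces both
  -- points into a region where the same bump function equals 1, and there the chart separates them.
  let e₀ : N → (t → EuclideanSpace ℝ (Fin m) × ℝ) := fun x i =>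
    (b i x • extChartAt (𝓡 m) (i : N) x, b i x)
  have hcov : ∀ x ∈ s, ∃ i : t, b i =ᶠ[𝓝 x] 1 := fun x hx => by
    obtain ⟨i, hi, hix⟩ := mem_iUnion₂.1 (ht hx)
    exact ⟨⟨i, hi⟩, hix⟩
  have hsrc : ∀ (i : t) (x : N), b i x = 1 → x ∈ (extChartAt (𝓡 m) (i : N)).source :=
    fun i x hx => by
      rw [extChartAt_source]
      exact (b i).support_subset_source (by rw [Function.mem_support, hx]; exact one_ne_zero)
  have he₀ : ContMDiff (𝓡 m) 𝓘(ℝ, t → EuclideanSpace ℝ (Fin m) × ℝ) ∞ e₀ :=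
    contMDiff_pi_space.2 fun i =>
      ((b i).contMDiff_smul contMDiffOn_extChartAt).prodMk_space (b i).contMDiff
  have hinj : InjOn e₀ s := by
    intro x hx y _ hxy
    obtain ⟨i, hi⟩ := hcov x hx
    have h1 : b i x = 1 := hi.self_of_nhds
    have h2 := congrFun hxy i
    simp only [e₀, Prod.mk.injEq] at h2
    have h3 : b i y = 1 := by rw [← h2.2, h1]
    have h4 := h2.1
    rw [h1, h3, one_smul, one_smul] at h4
    exact (extChartAt (𝓡 m) (i : N)).injOn (hsrc i x h1) (hsrc i y h3) h4
  have hder : ∀ x ∈ s, Function.Injective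
      (mfderiv (𝓡 m) 𝓘(ℝ, t → EuclideanSpace ℝ (Fin m) × ℝ) e₀ x) := by
    intro x hx
    obtain ⟨i, hi⟩ := hcov x hx
    let L : (t → EuclideanSpace ℝ (Fin m) × ℝ) →L[ℝ] EuclideanSpace ℝ (Fin m) :=
      (ContinuousLinearMap.fst ℝ _ ℝ).comp (ContinuousLinearMap.proj i)
    have h1 := L.hasMFDerivAt.comp x (he₀.mdifferentiableAt (x := x) (by simp)).hasMFDerivAt
    have h2 : extChartAt (𝓡 m) (i : N) =ᶠ[𝓝 x] L ∘ e₀ := by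
      filter_upwards [hi] with y hy
      have : b i y = 1 := hy
      simp [L, e₀, this]
    have h3 := (h1.congr_of_eventuallyEq h2).mfderiv
    have h4 : Function.Injective (chartDiff (i : N) x) :=
      (chartDiff_bijective (hsrc i x hi.self_of_nhds)).1
    intro v w hvw
    apply h4
    have h5 := congrArg (fun A => A v) h3
    have h6 := congrArg (fun A => A w) h3
    have h7 := congrArg (fun z : t → EuclideanSpace ℝ (Fin m) × ℝ => L z) hvw
    exact h5.trans (h7.trans h6.symm)
  -- The product carries a sup norm; an inner product is needed for the distance computations.
  let φ : (t → EuclideanSpace ℝ (Fin m) × ℝ) ≃L[ℝ]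
      EuclideanSpace ℝ (Fin (Module.finrank ℝ (t → EuclideanSpace ℝ (Fin m) × ℝ))) :=
    ContinuousLinearEquiv.ofFinrankEq finrank_euclideanSpace_fin.symm
  refine ⟨_, φ ∘ e₀, φ.contDiff.contMDiff.comp he₀, fun x hx y hy hxy =>
    hinj hx hy (φ.injective hxy), fun x hx => ?_⟩
  have h1 := (φ.hasFDerivAt (x := e₀ x)).hasMFDerivAt.comp x
    (he₀.mdifferentiableAt (x := x) (by simp)).hasMFDerivAt
  have h2 : mfderiv (𝓡 m) 𝓘(ℝ, EuclideanSpace ℝ (Fin (Module.finrank ℝ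
      (t → EuclideanSpace ℝ (Fin m) × ℝ)))) (φ ∘ e₀) x = _ := h1.mfderiv
  rw [h2]
  exact φ.injective.comp (hder x hx)

variable {E : Type*} [NormedAddCommGroup E] [NormedSpace ℝ E] {e : N → E} {q q' : N}

theorem contDiffAt_comp_extChartAt_symm (he : ContMDiff (𝓡 m) 𝓘(ℝ, E) ∞ e)
    (h : q' ∈ (extChartAt (𝓡 m) q).source) :
    ContDiffAt ℝ ∞ (fun y => e ((extChartAt (𝓡 m) q).symm y)) (extChartAt (𝓡 m) q q') := by
  rw [← contMDiffAt_iff_contDiffAt]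
  exact (he _).comp _ ((contMDiffOn_extChartAt_symm q).contMDiffAt
    ((isOpen_extChartAt_target q).mem_nhds ((extChartAt (𝓡 m) q).map_source h)))

theorem fderiv_comp_extChartAt_symm (he : ContMDiff (𝓡 m) 𝓘(ℝ, E) ∞ e)
    (h : q' ∈ (extChartAt (𝓡 m) q).source) (w : TangentSpace (𝓡 m) q') :
    fderiv ℝ (fun y => e ((extChartAt (𝓡 m) q).symm y)) (extChartAt (𝓡 m) q q') (chartDiff q q' w)
      = mfderiv (𝓡 m) 𝓘(ℝ, E) e q' w := by
  have h1 : MDifferentiableAt 𝓘(ℝ, EuclideanSpace ℝ (Fin m)) 𝓘(ℝ, E)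
      (fun y => e ((extChartAt (𝓡 m) q).symm y)) (extChartAt (𝓡 m) q q') :=
    ((contDiffAt_comp_extChartAt_symm he h).differentiableAt (by simp)).mdifferentiableAt
  have h2 : MDifferentiableAt (𝓡 m) 𝓘(ℝ, EuclideanSpace ℝ (Fin m)) (extChartAt (𝓡 m) q) q' :=
    mdifferentiableAt_extChartAt (by rwa [extChartAt_source] at h)
  have h3 : e =ᶠ[𝓝 q'] (fun y => e ((extChartAt (𝓡 m) q).symm y)) ∘ extChartAt (𝓡 m) q := by
    filter_upwards [(isOpen_extChartAt_source q).mem_nhds h] with z hz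
    rw [Function.comp_apply, (extChartAt (𝓡 m) q).left_inv hz]
  have h4 := ((h1.hasMFDerivAt.comp q' h2.hasMFDerivAt).congr_of_eventuallyEq h3).mfderiv
  have h5 := congrArg (fun L => L w) h4
  simp only [mfderiv_eq_fderiv] at h5
  exact h5.symm

theorem injective_fderiv_comp_extChartAt_symm (he : ContMDiff (𝓡 m) 𝓘(ℝ, E) ∞ e)
    (h : q' ∈ (extChartAt (𝓡 m) q).source)
    (hinj : Function.Injective (mfderiv (𝓡 m) 𝓘(ℝ, E) e q')) :
    Function.Injective
      (fderiv ℝ (fun y => e ((extChartAt (𝓡 m) q).symm y)) (extChartAt (𝓡 m) q q')) := by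
  intro a b hab
  obtain ⟨v, rfl⟩ := (chartDiff_bijective h).2 a
  obtain ⟨w, rfl⟩ := (chartDiff_bijective h).2 b
  rw [fderiv_comp_extChartAt_symm he h, fderiv_comp_extChartAt_symm he h] at hab
  rw [hinj hab]

end Embedding

/-! ### Uniform local injectivity, up to the initial time. -/

section LocalInjectivity

open Filter Metric

/-- A family of maps that is `C¹` up to the boundary of the parameter set and whose member at `t₀`
is an immersion at `x₀` is locally uniformly injective. -/
theorem ContDiffWithinAt.eventually_injOn_slice {H V : Type*} [NormedAddCommGroup H]
    [NormedSpace ℝ H] [FiniteDimensional ℝ H] [NormedAddCommGroup V] [NormedSpace ℝ V]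
    {f : H × ℝ → V} {I : Set ℝ} {x₀ : H} {t₀ : ℝ} (ht₀ : t₀ ∈ I)
    (hf : ContDiffWithinAt ℝ 1 f (univ ×ˢ I) (x₀, t₀))
    (hinj : Function.Injective (fderiv ℝ (fun x => f (x, t₀)) x₀)) :
    ∃ U ∈ 𝓝 x₀, ∀ᶠ s in 𝓝[I] t₀, InjOn (fun x => f (x, s)) U := by
  obtain ⟨u, hu, -, f', hf', hf'c⟩ :=
    (contDiffWithinAt_succ_iff_hasFDerivWithinAt (n := 0) (by simp)).1 (by simpa using hf)
  have hmem : (x₀, t₀) ∈ univ ×ˢ I := ⟨mem_univ _, ht₀⟩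
  rw [insert_eq_of_mem hmem] at hu
  have hslice : ∀ ε > 0, ∀ s, ball x₀ ε ×ˢ {s} ⊆ u → ∀ x ∈ ball x₀ ε,
      HasFDerivWithinAt (fun x => f (x, s))
        ((f' (x, s)).comp (ContinuousLinearMap.inl ℝ H ℝ)) (ball x₀ ε) x := by
    intro ε _ s hs x hx
    have h1 : HasFDerivWithinAt (fun x : H => (x, s)) (ContinuousLinearMap.inl ℝ H ℝ)
      (ball x₀ ε) x := (hasFDerivAt_prodMk_left x s).hasFDerivWithinAt
    exact (hf' (x, s) (hs ⟨hx, rfl⟩)).comp x h1 fun y hy => hs ⟨hy, rfl⟩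
  obtain ⟨ε₀, hε₀, hsub⟩ := Metric.mem_nhdsWithin_iff.1 hu
  have hbox : ∀ ε ≤ ε₀, ∀ s ∈ I, s ∈ ball t₀ ε → ball x₀ ε ×ˢ {s} ⊆ u := by
    rintro ε hε s hs hst ⟨x, s'⟩ ⟨hx, rfl : s' = s⟩
    refine hsub ⟨?_, mem_univ _, hs⟩
    rw [mem_ball, Prod.dist_eq]
    exact max_lt (lt_of_lt_of_le hx hε) (lt_of_lt_of_le hst hε)
  set L := (f' (x₀, t₀)).comp (ContinuousLinearMap.inl ℝ H ℝ) with hL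
  have hLinj : Function.Injective L := by
    have := ((hslice ε₀ hε₀ t₀ (hbox ε₀ le_rfl t₀ ht₀ (by simpa using hε₀)) x₀
      (mem_ball_self hε₀)).hasFDerivAt (ball_mem_nhds x₀ hε₀)).fderiv
    rwa [this] at hinj
  obtain ⟨K, hK, hanti⟩ := (L : H →ₗ[ℝ] V).exists_antilipschitzWith (LinearMap.ker_eq_bot.2 hLinj)
  have hcont : ContinuousWithinAt (fun z => (f' z).comp (ContinuousLinearMap.inl ℝ H ℝ)) u
      (x₀, t₀) := hf'c.continuousWithinAt.clm_comp continuousWithinAt_const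
  have hKpos : (0 : ℝ) < K := hK
  -- L expands lengths by at least 1/K, so slices whose derivative stays within 1/(2K) of L remain
  -- injective on a ball.
  have hc : (0 : ℝ) < 1 / (2 * K) := by positivity
  obtain ⟨δ, hδ, hδ'⟩ := Metric.continuousWithinAt_iff.1 hcont _ hc
  set r := min ε₀ δ
  have hr : 0 < r := lt_min hε₀ hδ
  refine ⟨ball x₀ r, ball_mem_nhds x₀ hr, ?_⟩
  filter_upwards [self_mem_nhdsWithin, nhdsWithin_le_nhds (ball_mem_nhds t₀ hr)] with s hs hst
  intro x hx y hy hxy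
  have hb := hbox r (min_le_left _ _) s hs hst
  have h1 := Convex.norm_image_sub_le_of_norm_hasFDerivWithin_le' (φ := L) (C := 1 / (2 * K))
    (hslice r hr s hb) (fun z hz => by
      rw [← dist_eq_norm]
      refine (hδ' (hb (show (z, s) ∈ ball x₀ r ×ˢ {s} from ⟨hz, rfl⟩)) ?_).le
      rw [Prod.dist_eq]
      exact max_lt (lt_of_lt_of_le hz (min_le_right _ _)) (lt_of_lt_of_le hst (min_le_right _ _)))
    (convex_ball x₀ r) hx hy
  have h2 := hanti.le_mul_dist (y - x) 0
  simp only [dist_zero_right, map_zero, ContinuousLinearMap.coe_coe] at h2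
  simp only at hxy
  rw [hxy, sub_self, zero_sub, norm_neg] at h1
  have h3 : ‖y - x‖ ≤ K * (1 / (2 * K) * ‖y - x‖) := h2.trans (by gcongr)
  have h4 : (K : ℝ) * (1 / (2 * K) * ‖y - x‖) = ‖y - x‖ / 2 := by field_simp
  have h5 : ‖y - x‖ = 0 := le_antisymm (by linarith) (norm_nonneg _)
  exact (sub_eq_zero.1 (norm_eq_zero.1 h5)).symm

end LocalInjectivity

/-! ### Families of maps and vector fields along them in charts. -/

section FlowInCharts

open Filter

variable {n m : ℕ}
  {M : Type*} [TopologicalSpace M] [ChartedSpace (EuclideanSpace ℝ (Fin n)) M]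
  {N : Type*} [TopologicalSpace N] [ChartedSpace (EuclideanSpace ℝ (Fin m)) N]

theorem ContMDiffOn.contMDiff_slice {F : ℝ → M → N} {I : Set ℝ} {t : ℝ} (ht : t ∈ I)
    (hF : ContMDiffOn ((𝓡 n).prod 𝓘(ℝ, ℝ)) (𝓡 m) ∞ (fun x : M × ℝ => F x.2 x.1) (univ ×ˢ I)) :
    ContMDiff (𝓡 n) (𝓡 m) ∞ (F t) := by
  have h1 : ContMDiff (𝓡 n) ((𝓡 n).prod 𝓘(ℝ, ℝ)) ∞ (fun p : M => (p, t)) :=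
    contMDiff_id.prodMk contMDiff_const
  exact contMDiffOn_univ.1 (hF.comp h1.contMDiffOn fun p _ => ⟨mem_univ _, ht⟩)

variable [IsManifold (𝓡 n) ∞ M]

theorem contMDiffWithinAt_family_comp_extChartAt_symm {F : ℝ → M → N} {I : Set ℝ} {p p₀ : M}
    {t : ℝ} (hF : ContMDiffWithinAt ((𝓡 n).prod 𝓘(ℝ, ℝ)) (𝓡 m) ∞
      (fun x : M × ℝ => F x.2 x.1) (univ ×ˢ I) (p, t))
    (hp : p ∈ (extChartAt (𝓡 n) p₀).source) :
    ContMDiffWithinAt 𝓘(ℝ, EuclideanSpace ℝ (Fin n) × ℝ) (𝓡 m) ∞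
      (fun z : EuclideanSpace ℝ (Fin n) × ℝ => F z.2 ((extChartAt (𝓡 n) p₀).symm z.1))
      (univ ×ˢ I) (extChartAt (𝓡 n) p₀ p, t) := by
  have h1 : ContMDiffAt 𝓘(ℝ, EuclideanSpace ℝ (Fin n)) (𝓡 n) ∞ (extChartAt (𝓡 n) p₀).symm
      (extChartAt (𝓡 n) p₀ p) :=
    (contMDiffOn_extChartAt_symm p₀).contMDiffAt
      ((isOpen_extChartAt_target p₀).mem_nhds ((extChartAt (𝓡 n) p₀).map_source hp))
  have h2 : ContMDiffAt 𝓘(ℝ, EuclideanSpace ℝ (Fin n) × ℝ) ((𝓡 n).prod 𝓘(ℝ, ℝ)) ∞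
      (fun z : EuclideanSpace ℝ (Fin n) × ℝ => ((extChartAt (𝓡 n) p₀).symm z.1, z.2))
      (extChartAt (𝓡 n) p₀ p, t) :=
    ContMDiffAt.prodMk (ContMDiffAt.comp (extChartAt (𝓡 n) p₀ p, t) h1
      contDiff_fst.contMDiff.contMDiffAt) contDiff_snd.contMDiff.contMDiffAt
  have h3 : ContMDiffWithinAt ((𝓡 n).prod 𝓘(ℝ, ℝ)) (𝓡 m) ∞
      (fun x : M × ℝ => F x.2 x.1) (univ ×ˢ I)
      ((extChartAt (𝓡 n) p₀).symm (extChartAt (𝓡 n) p₀ p), t) := by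
    rwa [(extChartAt (𝓡 n) p₀).left_inv hp]
  have h4 : MapsTo (fun z : EuclideanSpace ℝ (Fin n) × ℝ => ((extChartAt (𝓡 n) p₀).symm z.1, z.2))
      (univ ×ˢ I) (univ ×ˢ I) := fun z hz => ⟨mem_univ _, hz.2⟩
  exact ContMDiffWithinAt.comp (extChartAt (𝓡 n) p₀ p, t) h3 h2.contMDiffWithinAt h4

variable [IsManifold (𝓡 m) ∞ N]

theorem contDiffWithinAt_familyRep {F : ℝ → M → N} {I : Set ℝ} {p p₀ : M} {q₀ : N}
    {t : ℝ} (hF : ContMDiffWithinAt ((𝓡 n).prod 𝓘(ℝ, ℝ)) (𝓡 m) ∞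
      (fun x : M × ℝ => F x.2 x.1) (univ ×ˢ I) (p, t))
    (hp : p ∈ (extChartAt (𝓡 n) p₀).source) (hq : F t p ∈ (extChartAt (𝓡 m) q₀).source) :
    ContDiffWithinAt ℝ ∞ (fun z : EuclideanSpace ℝ (Fin n) × ℝ =>
      chartRep (m := m) p₀ q₀ (F z.2) z.1) (univ ×ˢ I) (extChartAt (𝓡 n) p₀ p, t) := by
  rw [← contMDiffWithinAt_iff_contDiffWithinAt]
  have h1 := contMDiffWithinAt_family_comp_extChartAt_symm hF hp
  have h2 : ContMDiffAt (𝓡 m) 𝓘(ℝ, EuclideanSpace ℝ (Fin m)) ∞ (extChartAt (𝓡 m) q₀)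
      (F t ((extChartAt (𝓡 n) p₀).symm (extChartAt (𝓡 n) p₀ p))) := by
    rw [(extChartAt (𝓡 n) p₀).left_inv hp]
    exact contMDiffAt_extChartAt' (by rwa [extChartAt_source] at hq)
  exact ContMDiffAt.comp_contMDiffWithinAt (extChartAt (𝓡 n) p₀ p, t) h2 h1

/-- Continuity of a vector field along a map, expressed in a chart. -/
theorem continuousAt_chartDiff_of_tangentBundle {X : Type*} [TopologicalSpace X] {g : X → N}
    {v : ∀ x, TangentSpace (𝓡 m) (g x)} {x₀ : X} {q : N}
    (h : ContinuousAt (fun x => (⟨g x, v x⟩ : TangentBundle (𝓡 m) N)) x₀)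
    (hq : g x₀ ∈ (extChartAt (𝓡 m) q).source) :
    ContinuousAt (fun x => chartDiff q (g x) (v x)) x₀ := by
  set e := trivializationAt (EuclideanSpace ℝ (Fin m)) (TangentSpace (𝓡 m) : N → Type _) q
  have hg : ContinuousAt g x₀ :=
    (FiberBundle.continuous_proj (EuclideanSpace ℝ (Fin m))
      (TangentSpace (𝓡 m) : N → Type _)).continuousAt.comp h
  have hsrc : ∀ᶠ x in 𝓝 x₀, g x ∈ (chartAt (EuclideanSpace ℝ (Fin m)) q).source := by
    rw [extChartAt_source] at hq
    exact hg.eventually ((chartAt (EuclideanSpace ℝ (Fin m)) q).open_source.mem_nhds hq)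
  have h1 : ContinuousAt (fun x => (e ⟨g x, v x⟩).2) x₀ := by
    have h2 : (⟨g x₀, v x₀⟩ : TangentBundle (𝓡 m) N) ∈ e.source := by
      rw [e.mem_source]
      exact hsrc.self_of_nhds
    exact continuous_snd.continuousAt.comp (ContinuousAt.comp (x := x₀) (g := e) (e.continuousAt h2) h)
  refine h1.congr ?_
  filter_upwards [hsrc] with x hx
  rw [chartDiff, ← TangentBundle.continuousLinearMapAt_trivializationAt hx]
  have h3 : g x ∈ e.baseSet := hx
  rw [Trivialization.continuousLinearMapAt_apply, e.linearMapAt_apply, if_pos h3]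

end FlowInCharts

/-! ### Double points, openness of injectivity, induction on time. -/

section Topology

open Filter

variable {X Y : Type*} [TopologicalSpace X] [CompactSpace X] [T2Space X]
  {F : ℝ → X → Y} {I : Set ℝ} {t₀ : ℝ}

/-- The double points of a locally uniformly injective family stay in a compact set of pairs which
is disjoint from the diagonal. -/
theorem exists_isCompact_doublePoints
    (hloc : ∀ p, ∃ U ∈ 𝓝 p, ∀ᶠ s in 𝓝[I] t₀, InjOn (F s) U) :
    ∃ Z : Set (X × X), IsCompact Z ∧ (∀ x ∈ Z, x.1 ≠ x.2) ∧
      ∀ᶠ s in 𝓝[I] t₀, ∀ p q, p ≠ q → F s p = F s q → Z ∈ 𝓝 (p, q) := by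
  choose U hU hinj using hloc
  obtain ⟨τ, hτ⟩ := CompactSpace.elim_nhds_subcover (fun p => interior (U p))
    fun p => interior_mem_nhds.2 (hU p)
  -- The closure of O, not only O, must avoid double points: then each of them is interior to Z =
  -- Oᶜ, and minimizers over Z near a contact are unconstrained.
  obtain ⟨O, hO, hdO, hclO⟩ := normal_exists_closure_subset (isClosed_diagonal (X := X))
    (t := ⋃ p ∈ τ, interior (U p) ×ˢ interior (U p))
    (isOpen_biUnion fun p _ => isOpen_interior.prod isOpen_interior) (by
      rintro ⟨p, q⟩ (rfl : p = q)
      have : p ∈ ⋃ x ∈ τ, interior (U x) := by rw [hτ]; trivial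
      obtain ⟨i, hi, hpi⟩ := mem_iUnion₂.1 this
      exact mem_iUnion₂.2 ⟨i, hi, hpi, hpi⟩)
  refine ⟨Oᶜ, hO.isClosed_compl.isCompact, fun x hx h => hx (hdO h), ?_⟩
  filter_upwards [(eventually_all_finset τ).2 fun i _ => hinj i] with s hs p q hpq hF
  have : (p, q) ∈ (closure O)ᶜ := fun h => by
    obtain ⟨i, hi, hp, hq⟩ := mem_iUnion₂.1 (hclO h)
    exact hpq (hs i hi (interior_subset hp) (interior_subset hq) hF)
  exact mem_of_superset (isClosed_closure.isOpen_compl.mem_nhds this)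
    (compl_subset_compl.2 subset_closure)

/-- Injectivity is an open condition in a locally uniformly injective continuous family. -/
theorem eventually_injective_of_injective [TopologicalSpace Y] [T2Space Y] (ht₀ : t₀ ∈ I)
    (hF : ContinuousOn (fun x : X × ℝ => F x.2 x.1) (univ ×ˢ I))
    (hloc : ∀ p, ∃ U ∈ 𝓝 p, ∀ᶠ s in 𝓝[I] t₀, InjOn (F s) U)
    (hinj : Function.Injective (F t₀)) : ∀ᶠ s in 𝓝[I] t₀, Function.Injective (F s) := by
  obtain ⟨Z, hZ, hne, hd⟩ := exists_isCompact_doublePoints hloc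
  have h1 : ∀ᶠ s in 𝓝 t₀, ∀ x ∈ Z, s ∈ I → F s x.1 ≠ F s x.2 := by
    refine hZ.eventually_forall_of_forall_eventually fun x hx => ?_
    have hc : ContinuousWithinAt (fun z : ℝ × (X × X) => (F z.1 z.2.1, F z.1 z.2.2))
        (I ×ˢ univ) (t₀, x) := by
      have c1 : ContinuousOn (fun z : ℝ × (X × X) => F z.1 z.2.1) (I ×ˢ univ) :=
        hF.comp (f := fun z : ℝ × (X × X) => (z.2.1, z.1)) (by fun_prop)
          fun z hz => ⟨mem_univ _, hz.1⟩
      have c2 : ContinuousOn (fun z : ℝ × (X × X) => F z.1 z.2.2) (I ×ˢ univ) :=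
        hF.comp (f := fun z : ℝ × (X × X) => (z.2.2, z.1)) (by fun_prop)
          fun z hz => ⟨mem_univ _, hz.1⟩
      exact (c1.prodMk c2) (t₀, x) ⟨ht₀, mem_univ _⟩
    have h2 : (diagonal Y)ᶜ ∈ 𝓝 (F t₀ x.1, F t₀ x.2) :=
      isClosed_diagonal.isOpen_compl.mem_nhds fun h => hne x hx (hinj h)
    filter_upwards [eventually_nhdsWithin_iff.1 (hc h2)] with z hz hzI
    exact hz ⟨hzI, mem_univ _⟩
  filter_upwards [hd, self_mem_nhdsWithin, nhdsWithin_le_nhds h1] with s hs hsI hsZ p q hpq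
  by_contra hne
  exact hsZ _ (mem_of_mem_nhds (hs p q hne hpq)) hsI hpq

/-- Induction over an interval of real numbers. -/
theorem forall_of_forall_Ico_of_eventually {P : ℝ → Prop} {a : ℝ} (hI : I.OrdConnected)
    (ha : a ∈ I) (hlow : ∀ t ∈ I, a ≤ t) (h0 : P a)
    (hopen : ∀ t ∈ I, P t → ∀ᶠ s in 𝓝[I] t, P s)
    (hclosed : ∀ t ∈ I, a < t → (∀ s ∈ Ico a t, P s) → P t) : ∀ t ∈ I, P t := by
  intro t₁ ht₁
  by_contra hP
  set A := {t | t ∈ I ∧ ¬ P t} with hA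
  have hne : A.Nonempty := ⟨t₁, ht₁, hP⟩
  have hbdd : BddBelow A := ⟨a, fun t ht => hlow t ht.1⟩
  have hinf : sInf A ∈ I :=
    hI.out ha ht₁ ⟨le_csInf hne fun t ht => hlow t ht.1, csInf_le hbdd ⟨ht₁, hP⟩⟩
  have hlt : ∀ s ∈ Ico a (sInf A), P s := fun s hs => by
    by_contra hs'
    exact (csInf_le hbdd ⟨hI.out ha hinf ⟨hs.1, hs.2.le⟩, hs'⟩).not_gt hs.2
  have hPinf : P (sInf A) := by
    rcases (hlow _ hinf).eq_or_lt with h | h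
    · rwa [← h]
    · exact hclosed _ hinf h hlt
  obtain ⟨ε, hε, hsub⟩ := Metric.mem_nhdsWithin_iff.1 (hopen _ hinf hPinf)
  obtain ⟨b, hb, hbε⟩ := exists_lt_of_csInf_lt hne (lt_add_of_pos_right (sInf A) hε)
  refine hb.2 (hsub ⟨?_, hb.1⟩)
  rw [Metric.mem_ball, Real.dist_eq, abs_of_nonneg (sub_nonneg.2 (csInf_le hbdd hb))]
  linarith

theorem timeInterval_ordConnected (T : EReal) : (timeInterval T).OrdConnected :=
  ⟨fun _ hx _ hy _ hz => ⟨hx.1.trans hz.1, lt_of_le_of_lt (EReal.coe_le_coe_iff.2 hz.2) hy.2⟩⟩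

theorem timeInterval_mem_nhds {T : EReal} {t : ℝ} (ht : t ∈ timeInterval T) (h : 0 < t) :
    timeInterval T ∈ 𝓝 t := by
  have h1 : ∀ᶠ s : ℝ in 𝓝 t, (s : EReal) < T :=
    continuous_coe_real_ereal.continuousAt.eventually (gt_mem_nhds ht.2)
  filter_upwards [h1, lt_mem_nhds h] with s hs hs'
  exact ⟨hs'.le, hs⟩

end Topology

/-! ### The differential inequality along the flow. -/

section Flow

set_option maxSynthPendingDepth 3

open Filter

variable {n : ℕ}
  {M : Type*} [TopologicalSpace M] [ChartedSpace (EuclideanSpace ℝ (Fin n)) M]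
  {N : Type*} [TopologicalSpace N] [ChartedSpace (EuclideanSpace ℝ (Fin (n + 1))) N]
  [IsManifold (𝓡 (n + 1)) ∞ N]
  [RiemannianBundle (fun q : N => TangentSpace (𝓡 (n + 1)) q)]
  {Γ : Set (Fin n → ℝ)} {W : (Fin n → ℝ) → ℝ} {T : EReal} {F : ℝ → M → N}

variable {E : Type*} [NormedAddCommGroup E] [InnerProductSpace ℝ E] {e : N → E}

/-- The velocity of a point moved by a flow, read through a smooth vector-valued map `e`. -/
theorem IsWeingartenFlow.hasDerivAt_comp
    {ν : ∀ (t : ℝ) (p : M), TangentSpace (𝓡 (n + 1)) (F t p)} {k : Fin n → ℝ}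
    (hF : IsWeingartenFlow Γ W T F) (he : ContMDiff (𝓡 (n + 1)) 𝓘(ℝ, E) ∞ e) {t : ℝ} {p : M}
    (ht : timeInterval T ∈ 𝓝 t)
    (hd : mfderivWithin 𝓘(ℝ, ℝ) (𝓡 (n + 1)) (fun s : ℝ => F s p) (timeInterval T) t (1 : ℝ)
          = W k • ν t p) :
    HasDerivAt (fun s => e (F s p)) (mfderiv (𝓡 (n + 1)) 𝓘(ℝ, E) e (F t p) (W k • ν t p)) t := by
  have h1 : MDifferentiableAt 𝓘(ℝ, ℝ) (𝓡 (n + 1)) (fun s : ℝ => F s p) t := by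
    have h2 := (hF.smooth (p, t) ⟨mem_univ _, mem_of_mem_nhds ht⟩).contMDiffAt
      (prod_mem_nhds univ_mem ht)
    have h3 : ContMDiffAt 𝓘(ℝ, ℝ) ((𝓡 n).prod 𝓘(ℝ, ℝ)) ∞ (fun s : ℝ => (p, s)) t :=
      contMDiffAt_const.prodMk contMDiffAt_id
    exact (ContMDiffAt.comp t h2 h3).mdifferentiableAt (by simp)
  rw [mfderivWithin_of_mem_nhds ht] at hd
  set L : ℝ →L[ℝ] EuclideanSpace ℝ (Fin (n + 1)) :=
    mfderiv 𝓘(ℝ, ℝ) (𝓡 (n + 1)) (fun s : ℝ => F s p) t with hL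
  set A : EuclideanSpace ℝ (Fin (n + 1)) →L[ℝ] E := mfderiv (𝓡 (n + 1)) 𝓘(ℝ, E) e (F t p) with hA
  have h4 : HasFDerivAt (fun s => e (F s p)) (A.comp L) t :=
    ((he.mdifferentiableAt (by simp)).hasMFDerivAt.comp t h1.hasMFDerivAt).hasFDerivAt
  have h5 := h4.hasDerivAt
  rw [← hd]
  exact h5

variable [IsManifold (𝓡 n) ∞ M]
  [IsContMDiffRiemannianBundle (𝓡 (n + 1)) ∞ (EuclideanSpace ℝ (Fin (n + 1)))
    (fun q : N => TangentSpace (𝓡 (n + 1)) q)]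

/-- The slices of a flow are locally uniformly injective. -/
theorem IsWeingartenFlow.eventually_injOn (hF : IsWeingartenFlow Γ W T F) {t : ℝ}
    (ht : t ∈ timeInterval T) (p : M) :
    ∃ U ∈ 𝓝 p, ∀ᶠ s in 𝓝[timeInterval T] t, InjOn (F s) U := by
  obtain ⟨ν, -, hν⟩ := hF.evolution
  obtain ⟨hn, k, -, hk, -⟩ := hν t ht p
  have hp := mem_extChartAt_source (I := 𝓡 n) p
  have hq := mem_extChartAt_source (I := 𝓡 (n + 1)) (F t p)
  have h1 := (hk.isEigenvalueList ((hF.smooth.contMDiff_slice ht) p) hp hq hn).1.injective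
  have h2 := (contDiffWithinAt_familyRep (hF.smooth (p, t) ⟨mem_univ _, ht⟩) hp hq).of_le
    (m := 1) (by simp)
  obtain ⟨U, hU, hinj⟩ := h2.eventually_injOn_slice ht h1
  refine ⟨(extChartAt (𝓡 n) p).source ∩ extChartAt (𝓡 n) p ⁻¹' U,
    inter_mem (extChartAt_source_mem_nhds p) ((continuousAt_extChartAt p).preimage_mem_nhds hU), ?_⟩
  filter_upwards [hinj] with s hs x hx y hy hxy
  refine (extChartAt (𝓡 n) p).injOn hx.1 hy.1 (hs hx.2 hy.2 ?_)
  simp only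
  rw [chartRep_extChartAt _ _ hx.1, chartRep_extChartAt _ _ hy.1, hxy]

/-- A differential inequality at the first contact of two sheets of a flow. -/
theorem IsWeingartenFlow.contact_estimate (hF : IsWeingartenFlow Γ W T F)
    (hW : IsOddWeingartenFunction Γ W) (he : ContMDiff (𝓡 (n + 1)) 𝓘(ℝ, E) ∞ e) {t₀ : ℝ}
    (ht₀ : timeInterval T ∈ 𝓝 t₀) {p₀ q₀ : M} (heq : F t₀ p₀ = F t₀ q₀)
    (hinj : Function.Injective (mfderiv (𝓡 (n + 1)) 𝓘(ℝ, E) e (F t₀ p₀))) :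
    ∃ C : ℝ, ∀ᶠ x : (M × M) × ℝ in 𝓝 ((p₀, q₀), t₀),
      IsLocalMin (fun y : M × M => ‖e (F x.2 y.1) - e (F x.2 y.2)‖ ^ 2) x.1 →
      e (F x.2 x.1.1) ≠ e (F x.2 x.1.2) →
      ∃ d, HasDerivAt (fun s => ‖e (F s x.1.1) - e (F s x.1.2)‖ ^ 2) d x.2 ∧
        -C * ‖e (F x.2 x.1.1) - e (F x.2 x.1.2)‖ ^ 2 ≤ d := by
  -- From here on the extension W' on Γ ∪ -Γ is used, since reversing a normal may leave Γ.
  obtain ⟨-, W', hW', hWW', hodd⟩ := hW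
  obtain ⟨ν, hνs, hν⟩ := hF.evolution
  set y₀ := F t₀ p₀ with hy₀
  have htI : t₀ ∈ timeInterval T := mem_of_mem_nhds ht₀
  have hp := mem_extChartAt_source (I := 𝓡 n) p₀
  have hq := mem_extChartAt_source (I := 𝓡 n) q₀
  have hy : F t₀ p₀ ∈ (extChartAt (𝓡 (n + 1)) y₀).source := mem_extChartAt_source y₀
  have hy' : F t₀ q₀ ∈ (extChartAt (𝓡 (n + 1)) y₀).source := heq ▸ hy
  -- Both sheets are read in one target chart around the contact point y₀, with separate source
  -- charts around p₀ and q₀. The role of J is played by e composed with the inverse chart.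
  set rep : M → EuclideanSpace ℝ (Fin n) × ℝ → EuclideanSpace ℝ (Fin (n + 1)) := fun p z =>
    chartRep (m := n + 1) p y₀ (F z.2) z.1 with hrep
  set νr : EuclideanSpace ℝ (Fin n) × ℝ → EuclideanSpace ℝ (Fin (n + 1)) := fun z =>
    chartDiff y₀ (F z.2 ((extChartAt (𝓡 n) q₀).symm z.1)) (ν z.2 ((extChartAt (𝓡 n) q₀).symm z.1))
    with hνr
  have hrepv : ∀ (p' p : M) (t : ℝ), p ∈ (extChartAt (𝓡 n) p').source →
      rep p' (extChartAt (𝓡 n) p' p, t) = extChartAt (𝓡 (n + 1)) y₀ (F t p) := fun p' p t h =>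
    chartRep_extChartAt y₀ (F t) h
  have hrepd : ∀ p, F t₀ p ∈ (extChartAt (𝓡 (n + 1)) y₀).source →
      ContDiffAt ℝ ∞ (rep p) (extChartAt (𝓡 n) p p, t₀) := fun p h =>
    (contDiffWithinAt_familyRep (hF.smooth (p, t₀) ⟨mem_univ _, htI⟩)
      (mem_extChartAt_source p) h).contDiffAt (prod_mem_nhds univ_mem ht₀)
  have hcurv : ∀ (p' p : M) (t : ℝ), t ∈ timeInterval T → p ∈ (extChartAt (𝓡 n) p').source →
      F t p ∈ (extChartAt (𝓡 (n + 1)) y₀).source → ∀ k, IsPrincipalCurvatures (F t) p (ν t p) k →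
      HasCurvatures (chartMetric y₀) (rep p') (extChartAt (𝓡 n) p' p, t)
        (chartDiff y₀ (F t p) (ν t p)) k := fun p' p t ht hp hq k hk =>
    have h := hk.isEigenvalueList ((hF.smooth.contMDiff_slice ht) p) hp hq (hν t ht p).1
    ⟨h.1, h.2⟩
  have hνrv : ∀ q t, q ∈ (extChartAt (𝓡 n) q₀).source →
      νr (extChartAt (𝓡 n) q₀ q, t) = chartDiff y₀ (F t q) (ν t q) := fun q t h => by
    simp only [hνr]
    rw [(extChartAt (𝓡 n) q₀).left_inv h]
  have hνc : ContinuousAt νr (extChartAt (𝓡 n) q₀ q₀, t₀) := by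
    have c1 : ContinuousAt (fun x : M × ℝ =>
        (⟨F x.2 x.1, ν x.2 x.1⟩ : TangentBundle (𝓡 (n + 1)) N)) (q₀, t₀) :=
      ((hνs (q₀, t₀) ⟨mem_univ _, htI⟩).contMDiffAt (prod_mem_nhds univ_mem ht₀)).continuousAt
    have c2 : ContinuousAt (fun z : EuclideanSpace ℝ (Fin n) × ℝ =>
        ((extChartAt (𝓡 n) q₀).symm z.1, z.2)) (extChartAt (𝓡 n) q₀ q₀, t₀) :=
      (ContinuousAt.comp (x := (extChartAt (𝓡 n) q₀ q₀, t₀))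
        (f := fun z : EuclideanSpace ℝ (Fin n) × ℝ => z.1)
        (continuousAt_extChartAt_symm q₀) (by fun_prop)).prodMk (by fun_prop)
    have hl := (extChartAt (𝓡 n) q₀).left_inv hq
    refine continuousAt_chartDiff_of_tangentBundle (ContinuousAt.comp_of_eq c1 c2 ?_) ?_
    · simp only [hl]
    · simp only [hl]; exact hy'
  obtain ⟨-, k₀, hk₀, hkp, -⟩ := hν t₀ htI q₀
  obtain ⟨C, hC⟩ := exists_eventually_speed_comparison (by simp) hW'
    (by rintro k (hk | hk); exacts [Or.inr (by simpa using hk), Or.inl hk]) hodd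
    (hrepd p₀ hy) (hrepd q₀ hy') (hrepv p₀ p₀ t₀ hp) (by rw [hrepv q₀ q₀ t₀ hq, ← heq])
    (contDiffAt_comp_extChartAt_symm he hy) (injective_fderiv_comp_extChartAt_symm he hy hinj)
    (contDiffAt_chartMetric ((extChartAt (𝓡 (n + 1)) y₀).map_source hy))
    (fun u hu => chartMetric_pos ((extChartAt (𝓡 (n + 1)) y₀).map_source hy) hu) hνc
    (Or.inl hk₀) (by rw [hνrv q₀ t₀ hq]; exact hcurv q₀ q₀ t₀ htI hq hy' k₀ hkp)
  -- The factor 2 comes from differentiating the squared norm.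
  refine ⟨2 * C, ?_⟩
  have hFc : ∀ p, ContinuousAt (fun x : M × ℝ => F x.2 x.1) (p, t₀) := fun p =>
    ((hF.smooth (p, t₀) ⟨mem_univ _, htI⟩).contMDiffAt (prod_mem_nhds univ_mem ht₀)).continuousAt
  have hV := isOpen_extChartAt_source (I := 𝓡 (n + 1)) y₀
  have ev1 : ∀ᶠ x : (M × M) × ℝ in 𝓝 ((p₀, q₀), t₀),
      F x.2 x.1.1 ∈ (extChartAt (𝓡 (n + 1)) y₀).source :=
    (ContinuousAt.comp (x := ((p₀, q₀), t₀)) (f := fun x : (M × M) × ℝ => (x.1.1, x.2)) (hFc p₀)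
      (by fun_prop)).eventually (hV.mem_nhds hy)
  have ev2 : ∀ᶠ x : (M × M) × ℝ in 𝓝 ((p₀, q₀), t₀),
      F x.2 x.1.2 ∈ (extChartAt (𝓡 (n + 1)) y₀).source :=
    (ContinuousAt.comp (x := ((p₀, q₀), t₀)) (f := fun x : (M × M) × ℝ => (x.1.2, x.2)) (hFc q₀)
      (by fun_prop)).eventually (hV.mem_nhds hy')
  have ev3 : ∀ᶠ x : (M × M) × ℝ in 𝓝 ((p₀, q₀), t₀), x.1.1 ∈ (extChartAt (𝓡 n) p₀).source :=
    (by fun_prop : ContinuousAt (fun x : (M × M) × ℝ => x.1.1) ((p₀, q₀), t₀)).eventually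
      (extChartAt_source_mem_nhds p₀)
  have ev4 : ∀ᶠ x : (M × M) × ℝ in 𝓝 ((p₀, q₀), t₀), x.1.2 ∈ (extChartAt (𝓡 n) q₀).source :=
    (by fun_prop : ContinuousAt (fun x : (M × M) × ℝ => x.1.2) ((p₀, q₀), t₀)).eventually
      (extChartAt_source_mem_nhds q₀)
  have ev5 : ∀ᶠ x : (M × M) × ℝ in 𝓝 ((p₀, q₀), t₀), timeInterval T ∈ 𝓝 x.2 :=
    (by fun_prop : ContinuousAt (fun x : (M × M) × ℝ => x.2) ((p₀, q₀), t₀)).eventually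
      (eventually_eventually_nhds.2 ht₀)
  have hcoord : ContinuousAt (fun x : (M × M) × ℝ =>
      (extChartAt (𝓡 n) p₀ x.1.1, extChartAt (𝓡 n) q₀ x.1.2, x.2)) ((p₀, q₀), t₀) :=
    (ContinuousAt.comp (x := ((p₀, q₀), t₀)) (f := fun x : (M × M) × ℝ => x.1.1)
      (continuousAt_extChartAt p₀) (by fun_prop)).prodMk
    ((ContinuousAt.comp (x := ((p₀, q₀), t₀)) (f := fun x : (M × M) × ℝ => x.1.2)
      (continuousAt_extChartAt q₀) (by fun_prop)).prodMk (by fun_prop))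
  filter_upwards [ev1, ev2, ev3, ev4, ev5, hcoord.eventually hC] with x h1 h2 h3 h4 h5 h6 hmin hne
  obtain ⟨⟨p, q⟩, t⟩ := x
  simp only at h1 h2 h3 h4 h5 h6 hmin hne ⊢
  have ht : t ∈ timeInterval T := mem_of_mem_nhds h5
  obtain ⟨-, k₁, hk₁, hkp₁, hd₁⟩ := hν t ht p
  obtain ⟨-, k₂, hk₂, hkp₂, hd₂⟩ := hν t ht q
  have hJv : ∀ y ∈ (extChartAt (𝓡 (n + 1)) y₀).source,
      (extChartAt (𝓡 (n + 1)) y₀).symm (extChartAt (𝓡 (n + 1)) y₀ y) = y :=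
    fun y hy => (extChartAt (𝓡 (n + 1)) y₀).left_inv hy
  have h7 := h6 _ k₁ k₂ (Or.inl hk₁) (Or.inl hk₂) (hcurv p₀ p t ht h3 h1 k₁ hkp₁)
    (by rw [hνrv q t h4]; exact hcurv q₀ q t ht h4 h2 k₂ hkp₂)
  rw [hrepv p₀ p t h3, hrepv q₀ q t h4, hJv _ h1, hJv _ h2, hνrv q t h4, hWW' hk₁, hWW' hk₂,
    ← map_smul, ← map_smul, fderiv_comp_extChartAt_symm he h1,
    fderiv_comp_extChartAt_symm he h2] at h7
  have h8 := h7 (sub_ne_zero.2 hne) ?_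
  · refine ⟨_, ((hF.hasDerivAt_comp he h5 hd₁).sub (hF.hasDerivAt_comp he h5 hd₂)).norm_sq, ?_⟩
    have h9 := mul_le_mul_of_nonneg_left h8 (zero_le_two (α := ℝ))
    refine le_trans (le_of_eq ?_) h9
    ring
  -- Local minimality is transported to coordinates, where it holds only near the base pair because
  -- the target chart inverts only on its source.
  · have hlp := (extChartAt (𝓡 n) p₀).left_inv h3
    have hlq := (extChartAt (𝓡 n) q₀).left_inv h4
    have hFt : Continuous (F t) := (hF.smooth.contMDiff_slice ht).continuous
    have c1 : ContinuousAt (fun z : EuclideanSpace ℝ (Fin n) × EuclideanSpace ℝ (Fin n) =>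
        (extChartAt (𝓡 n) p₀).symm z.1) (extChartAt (𝓡 n) p₀ p, extChartAt (𝓡 n) q₀ q) :=
      ContinuousAt.comp (x := (extChartAt (𝓡 n) p₀ p, extChartAt (𝓡 n) q₀ q))
        (g := (extChartAt (𝓡 n) p₀).symm) (continuousAt_extChartAt_symm' h3) continuousAt_fst
    have c2 : ContinuousAt (fun z : EuclideanSpace ℝ (Fin n) × EuclideanSpace ℝ (Fin n) =>
        (extChartAt (𝓡 n) q₀).symm z.2) (extChartAt (𝓡 n) p₀ p, extChartAt (𝓡 n) q₀ q) :=
      ContinuousAt.comp (x := (extChartAt (𝓡 n) p₀ p, extChartAt (𝓡 n) q₀ q))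
        (g := (extChartAt (𝓡 n) q₀).symm) (continuousAt_extChartAt_symm' h4) continuousAt_snd
    have hmin' : ∀ᶠ y : M × M in 𝓝 (p, q),
        ‖e (F t p) - e (F t q)‖ ^ 2 ≤ ‖e (F t y.1) - e (F t y.2)‖ ^ 2 := hmin
    have e1 := (hFt.continuousAt.comp c1).eventually (hV.mem_nhds (by simpa only [Function.comp_apply, hlp] using h1))
    have e2 := (hFt.continuousAt.comp c2).eventually (hV.mem_nhds (by simpa only [Function.comp_apply, hlq] using h2))
    have e3 := (c1.prodMk c2).eventually (by simpa only [hlp, hlq] using hmin')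
    filter_upwards [e1, e2, e3] with z z1 z2 z3
    rw [hrepv p₀ p t h3, hrepv q₀ q t h4, hJv _ h1, hJv _ h2]
    have r1 : (extChartAt (𝓡 (n + 1)) y₀).symm (rep p₀ (z.1, t))
        = F t ((extChartAt (𝓡 n) p₀).symm z.1) := hJv _ z1
    have r2 : (extChartAt (𝓡 (n + 1)) y₀).symm (rep q₀ (z.2, t))
        = F t ((extChartAt (𝓡 n) q₀).symm z.2) := hJv _ z2
    rw [r1, r2]
    exact z3

end Flow

/-! ### Preservation of embeddedness. -/

section Embeddedness

open Filter

variable {n : ℕ}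
  {M : Type*} [TopologicalSpace M] [T2Space M] [CompactSpace M]
  [ChartedSpace (EuclideanSpace ℝ (Fin n)) M] [IsManifold (𝓡 n) ∞ M]
  {N : Type*} [TopologicalSpace N] [T2Space N] [ChartedSpace (EuclideanSpace ℝ (Fin (n + 1))) N]
  [IsManifold (𝓡 (n + 1)) ∞ N]
  [RiemannianBundle (fun q : N => TangentSpace (𝓡 (n + 1)) q)]
  [IsContMDiffRiemannianBundle (𝓡 (n + 1)) ∞ (EuclideanSpace ℝ (Fin (n + 1)))
    (fun q : N => TangentSpace (𝓡 (n + 1)) q)]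
  {Γ : Set (Fin n → ℝ)} {W : (Fin n → ℝ) → ℝ} {T : EReal} {F : ℝ → M → N}

/-- A flow by an odd Weingarten function which is injective before the time `t₀` is injective
at the time `t₀`. -/
theorem IsWeingartenFlow.injective_of_forall_lt (hF : IsWeingartenFlow Γ W T F)
    (hW : IsOddWeingartenFunction Γ W) {t₀ : ℝ} (ht₀ : t₀ ∈ timeInterval T) (hpos : 0 < t₀)
    (hlt : ∀ s ∈ Ico 0 t₀, Function.Injective (F s)) : Function.Injective (F t₀) := by
  have hI := timeInterval_mem_nhds ht₀ hpos
  have hsub : Icc 0 t₀ ⊆ timeInterval T := (timeInterval_ordConnected T).out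
    ⟨le_rfl, lt_of_le_of_lt (EReal.coe_le_coe_iff.2 hpos.le) ht₀.2⟩ ht₀
  have hFc : ContinuousOn (fun x : M × ℝ => F x.2 x.1) (univ ×ˢ Icc 0 t₀) :=
    hF.smooth.continuousOn.mono (prod_mono le_rfl hsub)
  -- Only the region swept out up to t₀ has to be embedded; the ambient manifold may be noncompact.
  have hK : IsCompact ((fun x : M × ℝ => F x.2 x.1) '' (univ ×ˢ Icc 0 t₀)) :=
    (isCompact_univ.prod isCompact_Icc).image_of_continuousOn hFc
  have hmem : ∀ p, ∀ s ∈ Icc 0 t₀, F s p ∈ (fun x : M × ℝ => F x.2 x.1) '' (univ ×ˢ Icc 0 t₀) :=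
    fun p s hs => ⟨(p, s), ⟨mem_univ _, hs⟩, rfl⟩
  obtain ⟨k, e, he, heinj, hed⟩ := hK.exists_immersion_euclidean (m := n + 1)
  obtain ⟨Z, hZ, hne, hd⟩ := exists_isCompact_doublePoints
    (fun p => hF.eventually_injOn ht₀ p)
  have hd₀ := hd.self_of_nhdsWithin ht₀
  have ht₀' : t₀ ∈ Icc 0 t₀ := right_mem_Icc.2 hpos.le
  intro p q hpq
  by_contra hpqne
  have hec : ContinuousOn (fun x : M × ℝ => e (F x.2 x.1)) (univ ×ˢ Icc 0 t₀) :=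
    he.continuous.comp_continuousOn hFc
  refine hZ.ne_zero_of_deriv_ge (h := fun y t => ‖e (F t y.1) - e (F t y.2)‖ ^ 2) hpos ?_ ?_ ?_
    (mem_of_mem_nhds (hd₀ p q hpqne hpq)) (by simp [hpq])
  · have c1 : ContinuousOn (fun x : (M × M) × ℝ => e (F x.2 x.1.1)) (Z ×ˢ Icc 0 t₀) :=
      hec.comp (f := fun x : (M × M) × ℝ => (x.1.1, x.2)) (by fun_prop)
        fun x hx => ⟨mem_univ _, hx.2⟩
    have c2 : ContinuousOn (fun x : (M × M) × ℝ => e (F x.2 x.1.2)) (Z ×ˢ Icc 0 t₀) :=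
      hec.comp (f := fun x : (M × M) × ℝ => (x.1.2, x.2)) (by fun_prop)
        fun x hx => ⟨mem_univ _, hx.2⟩
    exact (c1.sub c2).norm.pow 2
  · intro x hx t ht
    have ht' : t ∈ Icc 0 t₀ := ⟨ht.1, ht.2.le⟩
    have : e (F t x.1) - e (F t x.2) ≠ 0 := sub_ne_zero.2 fun h =>
      hne x hx (hlt t ht (heinj (hmem _ t ht') (hmem _ t ht') h))
    positivity
  · intro x hx hx0
    have hx1 : F t₀ x.1 = F t₀ x.2 := heinj (hmem _ t₀ ht₀') (hmem _ t₀ ht₀')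
      (sub_eq_zero.1 (norm_eq_zero.1 (pow_eq_zero_iff (two_ne_zero)|>.1 hx0)))
    obtain ⟨C, hC⟩ := hF.contact_estimate hW he hI hx1 (hed _ (hmem _ t₀ ht₀'))
    refine ⟨C, ?_⟩
    -- Near a contact Z is a neighbourhood of the pair, so a minimum over Z is a local minimum over
    -- M × M.
    have ev1 : ∀ᶠ y : (M × M) × ℝ in 𝓝 (x, t₀), Z ∈ 𝓝 y.1 :=
      continuous_fst.continuousAt.eventually
        (eventually_mem_nhds_iff.2 (hd₀ x.1 x.2 (hne x hx) hx1))
    have ev2 : ∀ᶠ y : (M × M) × ℝ in 𝓝 (x, t₀), 0 ≤ y.2 :=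
      continuous_snd.continuousAt.eventually (Ici_mem_nhds hpos)
    filter_upwards [hC, ev1, ev2] with y hy hyZ hy0 hyt hyZ' hmin
    refine hy (hmin.isLocalMin hyZ) fun h => hne y.1 hyZ' (hlt y.2 ⟨hy0, hyt⟩ ?_)
    exact heinj (hmem _ y.2 ⟨hy0, hyt.le⟩) (hmem _ y.2 ⟨hy0, hyt.le⟩) h

end Embeddedness

/-- For immersions of a compact manifold, embeddedness is injectivity. Injectivity holds initially,
is open in time, and passes to the first possible exceptional time. -/
theorem theorem1p5 {n : ℕ}
    {M : Type*} [TopologicalSpace M] [T2Space M] [CompactSpace M] [ConnectedSpace M]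
    [ChartedSpace (EuclideanSpace ℝ (Fin n)) M] [IsManifold (𝓡 n) ∞ M]
    {N : Type*} [MetricSpace N] [CompleteSpace N] [ConnectedSpace N]
    [ChartedSpace (EuclideanSpace ℝ (Fin (n + 1))) N] [IsManifold (𝓡 (n + 1)) ∞ N]
    [RiemannianBundle (fun q : N => TangentSpace (𝓡 (n + 1)) q)]
    [IsContMDiffRiemannianBundle (𝓡 (n + 1)) ∞ (EuclideanSpace ℝ (Fin (n + 1)))
      (fun q : N => TangentSpace (𝓡 (n + 1)) q)]
    [IsRiemannianManifold (𝓡 (n + 1)) N]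
    (Γ : Set (Fin n → ℝ)) (W : (Fin n → ℝ) → ℝ) (hW : IsOddWeingartenFunction Γ W)
    (T : EReal) (hT : 0 < T) (F : ℝ → M → N) (hF : IsWeingartenFlow Γ W T F)
    (h0 : IsSmoothEmbedding (𝓡 n) (𝓡 (n + 1)) ∞ (F 0)) :
    ∀ t ∈ timeInterval T, IsSmoothEmbedding (𝓡 n) (𝓡 (n + 1)) ∞ (F t) := by
  have hinj : ∀ t ∈ timeInterval T, Function.Injective (F t) :=
    forall_of_forall_Ico_of_eventually (a := 0) (timeInterval_ordConnected T)
      ⟨le_rfl, by simpa using hT⟩ (fun t ht => ht.1) h0.isEmbedding.injective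
      (fun t ht h => eventually_injective_of_injective ht hF.smooth.continuousOn
        (fun p => hF.eventually_injOn ht p) h)
      fun t ht hpos h => hF.injective_of_forall_lt hW ht hpos h
  intro t ht
  exact ⟨hF.immersion t ht,
    ((hF.smooth.contMDiff_slice ht).continuous.isClosedEmbedding (hinj t ht)).isEmbedding⟩
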